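/- **Theorem (Comparison).** Let $d\ge 1$, $T>0$, and let $\Omega\subset\mathbb R^d$ be a smooth bounded domain. Let $\mathcal P_{\rm sub}$ be the set of Borel measures $m\ge 0$ on $\Omega$ with $m(\Omega)\le 1$, with the metric $$\mathbf d(m,n)=\sup\Big\{\int_\Omega\varphi\,d(m-n)\ :\ \varphi:\overline\Omega\to\mathbb R\ \text{is 1-Lipschitz},\ \varphi=0\ \text{on}\ \partial\Omega\Big\};$$ all topological notions on $\mathcal P_{\rm sub}$ refer to $\mathbf d$. Write $m\in L^2$ if $m$ has a square-integrable density, also denoted $m$, and $\|m\|_2$ for its $L^2(\Omega)$ norm. A function $\Phi:\mathcal P_{\rm sub}\to\mathbb R$ has linear derivative $\frac{\delta\Phi}{\delta m}:\mathcal P_{\rm sub}\times\Omega\to\mathbb R$ if $\Phi(m')-\Phi(m)=\int_0^1\int_\Omega\frac{\delta\Phi}{\delta m}(rm'+(1-r)m,x)\,(m'-m)(dx)\,dr$ for all $m,m'$, and is $C^1$ if it has a continuous one. A *smooth test function* is a map $\Phi:[0,T]\times\mathcal P_{\rm sub}\to\mathbb R$ such that $\partial_t\Phi$, $\frac{\delta\Phi}{\delta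 m}$ and $\frac{\delta^2\Phi}{\delta m^2}(t,m,x,y)=\frac{\delta}{\delta m}\big[\frac{\delta\Phi}{\delta m}(t,m,x)\big](y)$ exist and are continuous, $\frac{\delta\Phi}{\delta m}(t,m,\cdot)\in C^2_c(\Omega)$ and $\frac{\delta^2\Phi}{\delta m^2}(t,m,\cdot,\cdot)\in C^1_c(\Omega\times\Omega)$ for all $(t,m)$, and $(t,m)\mapsto\frac{\delta\Phi}{\delta m}(t,m,\cdot)\in C^2(\overline\Omega)$ and $(t,m)\mapsto\frac{\delta^2\Phi}{\delta m^2}(t,m,\cdot,\cdot)\in C^1(\overline\Omega\times\overline\Omega)$ are continuous and bounded. Let $H:\Omega\times\mathbb R^d\to\mathbb R$ be Lipschitz, let $F,G:\mathcal P_{\rm sub}\to\mathbb R$ be $C^1$ and Lipschitz, and consider $$-\partial_tU-\int_\Omega\Delta_x\frac{\delta U}{\delta m}\,dm+\int_\Omega H\Big(x,D_x\frac{\delta U}{\delta m}\Big)dm=F(m)\ \text{ in }[0,T)\times\mathcal P_{\rm sub},\qquad U(T,\cdot)=G,\qquad \frac{\delta U}{\delta m}=0\ \text{ on }\partial\Omega.$$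 An upper semicontinuous $V:[0,T]\times\mathcal P_{\rm sub}\to\mathbb R$ is a *viscosity subsolution* if $V(T,\cdot)\le G$ and there is $C>0$ such that for every smooth test function $\Phi$, every $\delta>0$ and every $(t_0,m_0)\in[0,T)\times(\mathcal P_{\rm sub}\cap L^2)$ at which $V-\Phi-\delta\|m\|_2^2$ attains its maximum over $[0,T]\times(\mathcal P_{\rm sub}\cap L^2)$, one has $m_0\in H^1_0(\Omega)$ and $$-\partial_t\Phi(t_0,m_0)+\delta\int_\Omega|Dm_0|^2dx-\int_\Omega\Delta_x\frac{\delta\Phi}{\delta m}(t_0,m_0,x)\,m_0(x)\,dx+\int_\Omega H\Big(x,D_x\frac{\delta\Phi}{\delta m}(t_0,m_0,x)\Big)m_0(x)\,dx\le F(m_0)+C\delta\|m_0\|_2^2 .$$ A lower semicontinuous $V$ is a *viscosity supersolution* if $V(T,\cdot)\ge G$ and there is $C>0$ such that for all $\Phi$, $\delta>0$ and $(t_0,m_0)$ as above at which $V-\Phi+\delta\|m\|_2^2$ attains its minimum over $[0,T]\times(\mathcal P_{\rm sub}\cap L^2)$, one has $m_0\in H_0^1(\Omega)$ and $$-\partial_t\Phi(t_0,m_0)-\delta\int_\Omega|Dm_0|^2dx-\int_\Omega\Delta_x\frac{\delta\Phi}{\delta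 m}(t_0,m_0,x)\,m_0(x)\,dx+\int_\Omega H\Big(x,D_x\frac{\delta\Phi}{\delta m}(t_0,m_0,x)\Big)m_0(x)\,dx\ge F(m_0)-C\delta\|m_0\|_2^2 .$$ Let $V^-$ be a viscosity subsolution and $V^+$ a viscosity supersolution. Then $V^-(t,m)\le V^+(t,m)$ for all $t\in[0,T]$ and $m\in\mathcal P_{\rm sub}\cap L^2$; moreover, $V^-(t,m)\le V^+(t,m)$ for every $t\in[0,T]$ and every $m\in\mathcal P_{\rm sub}$ at which both $V^-(t,\cdot)$ and $V^+(t,\cdot)$ are continuous. In particular, if $V^-$ and $V^+$ are continuous, then $V^-\le V^+$ on $[0,T]\times\mathcal P_{\rm sub}$. -/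

import Mathlib

open Set Filter Topology MeasureTheory
open scoped NNReal ENNReal ContDiff Gradient Laplacian

noncomputable section

namespace AbsorbedMFC

/-- A smooth, bounded domain: bounded, open, connected (hence nonempty), and near each boundary
point the sublevel set of a smooth function with nonvanishing differential at that point. -/
structure IsSmoothBoundedDomain {d : ℕ} (Ω : Set (EuclideanSpace ℝ (Fin d))) : Prop where
  isOpen : IsOpen Ω
  isConnected : IsConnected Ω
  isBounded : Bornology.IsBounded Ω
  smooth_boundary : ∀ x ∈ frontier Ω, ∃ r : EuclideanSpace ℝ (Fin d) → ℝ,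
    ContDiff ℝ ∞ r ∧ r x = 0 ∧ fderiv ℝ r x ≠ 0 ∧ ∀ᶠ y in 𝓝 x, (y ∈ Ω ↔ r y < 0)

/-- Sub-probability measures on `Ω`, seen as Borel measures on `ℝ^d` carried by `Ω`. -/
def SubProb {d : ℕ} (Ω : Set (EuclideanSpace ℝ (Fin d))) : Type :=
  {m : Measure (EuclideanSpace ℝ (Fin d)) // m Ωᶜ = 0 ∧ m univ ≤ 1}

variable {d : ℕ} {Ω : Set (EuclideanSpace ℝ (Fin d))}

/-- The underlying measure. -/
def SubProb.meas (m : SubProb Ω) : Measure (EuclideanSpace ℝ (Fin d)) := m.1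

/-- The `1`-Lipschitz functions on the closure of `Ω` that vanish on the boundary. -/
def lipZero (Ω : Set (EuclideanSpace ℝ (Fin d))) : Set (EuclideanSpace ℝ (Fin d) → ℝ) :=
  {φ | LipschitzOnWith 1 φ (closure Ω) ∧ ∀ x ∈ frontier Ω, φ x = 0}

/-- The distance `d(m, n) = sup {∫ φ d(m - n) : φ ∈ lipZero Ω}`, as an extended nonnegative
number (it is finite when `Ω` is bounded and `d ≥ 1`). -/
instance : PseudoEMetricSpace (SubProb Ω) where
  edist m n := ⨆ φ ∈ lipZero Ω, ENNReal.ofReal (∫ x, φ x ∂m.meas - ∫ x, φ x ∂n.meas)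
  edist_self m := by simp
  edist_comm m n := by
    have key : ∀ m n : SubProb Ω,
        (⨆ φ ∈ lipZero Ω, ENNReal.ofReal (∫ x, φ x ∂m.meas - ∫ x, φ x ∂n.meas)) ≤
        ⨆ φ ∈ lipZero Ω, ENNReal.ofReal (∫ x, φ x ∂n.meas - ∫ x, φ x ∂m.meas) := by
      intro m n
      refine iSup₂_le fun φ hφ => ?_
      have hneg : (-φ) ∈ lipZero Ω := by
        refine ⟨hφ.1.neg, fun x hx => ?_⟩
        simp [hφ.2 x hx]
      refine le_trans (le_of_eq ?_)
        (le_iSup₂ (f := fun (φ : EuclideanSpace ℝ (Fin d) → ℝ) (_ : φ ∈ lipZero Ω) =>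
          ENNReal.ofReal (∫ x, φ x ∂n.meas - ∫ x, φ x ∂m.meas)) (-φ) hneg)
      simp only [Pi.neg_apply, integral_neg]
      congr 1
      ring
    exact le_antisymm (key m n) (key n m)
  edist_triangle l m n := by
    refine iSup₂_le fun φ hφ => ?_
    have h : (∫ x, φ x ∂l.meas - ∫ x, φ x ∂n.meas)
        = (∫ x, φ x ∂l.meas - ∫ x, φ x ∂m.meas) + (∫ x, φ x ∂m.meas - ∫ x, φ x ∂n.meas) := by
      ring
    rw [h]
    refine le_trans ENNReal.ofReal_add_le (add_le_add ?_ ?_)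
    · exact le_iSup₂ (f := fun (φ : EuclideanSpace ℝ (Fin d) → ℝ) (_ : φ ∈ lipZero Ω) =>
        ENNReal.ofReal (∫ x, φ x ∂l.meas - ∫ x, φ x ∂m.meas)) φ hφ
    · exact le_iSup₂ (f := fun (φ : EuclideanSpace ℝ (Fin d) → ℝ) (_ : φ ∈ lipZero Ω) =>
        ENNReal.ofReal (∫ x, φ x ∂m.meas - ∫ x, φ x ∂n.meas)) φ hφ

/-- The convex combination `r m' + (1 - r) m`. -/
def SubProb.mix (m m' : SubProb Ω) (r : unitInterval) : SubProb Ω :=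
  ⟨ENNReal.ofReal (r : ℝ) • m'.meas + ENNReal.ofReal (1 - (r : ℝ)) • m.meas, by
    constructor
    · have h₁ : m.meas Ωᶜ = 0 := m.2.1
      have h₂ : m'.meas Ωᶜ = 0 := m'.2.1
      simp [h₁, h₂]
    · have h₁ : m.meas univ ≤ 1 := m.2.2
      have h₂ : m'.meas univ ≤ 1 := m'.2.2
      have h : ENNReal.ofReal (r : ℝ) + ENNReal.ofReal (1 - (r : ℝ)) = 1 := by
        rw [← ENNReal.ofReal_add r.2.1 (sub_nonneg.2 r.2.2)]
        simp
      calc (ENNReal.ofReal (r : ℝ) • m'.meas + ENNReal.ofReal (1 - (r : ℝ)) • m.meas) univ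
          = ENNReal.ofReal (r : ℝ) * m'.meas univ
              + ENNReal.ofReal (1 - (r : ℝ)) * m.meas univ := by simp
        _ ≤ ENNReal.ofReal (r : ℝ) * 1 + ENNReal.ofReal (1 - (r : ℝ)) * 1 := by gcongr
        _ = 1 := by simpa using h⟩

/-- `D` is a linear functional derivative of `U`:
`U m' - U m = ∫₀¹ ∫_Ω D (r m' + (1 - r) m, x) (m' - m)(dx) dr` for all `m, m'`. -/
def HasLinearDerivative (U : SubProb Ω → ℝ)
    (D : SubProb Ω → EuclideanSpace ℝ (Fin d) → ℝ) : Prop :=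
  ∀ m m' : SubProb Ω, U m' - U m = ∫ r in (0 : ℝ)..1,
    (∫ x, D (m.mix m' (projIcc 0 1 zero_le_one r)) x ∂m'.meas
      - ∫ x, D (m.mix m' (projIcc 0 1 zero_le_one r)) x ∂m.meas)

/-- `U` is `C¹`: it has a continuous linear functional derivative on `SubProb Ω × Ω`. -/
def IsC1 (U : SubProb Ω → ℝ) : Prop :=
  ∃ D : SubProb Ω → EuclideanSpace ℝ (Fin d) → ℝ,
    ContinuousOn (fun p : SubProb Ω × EuclideanSpace ℝ (Fin d) => D p.1 p.2) (univ ×ˢ Ω) ∧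
    HasLinearDerivative U D

/-- `u ∈ C_c^k(S)`, where `u` is extended by zero outside `S`. -/
def IsCcOn {X : Type*} [NormedAddCommGroup X] [NormedSpace ℝ X] (k : ℕ∞) (S : Set X)
    (u : X → ℝ) : Prop :=
  ContDiff ℝ k u ∧ HasCompactSupport u ∧ tsupport u ⊆ S

/-- The map `(t, m) ↦ f t m ·` from `[0, T] × SubProb Ω` into functions with the `C^k` norm
(the supremum norms of the derivatives of order `≤ k`) is continuous and bounded. It is used for
functions that vanish outside a bounded set, so the supremum may be taken over the whole space. -/
def ContinuousBoundedInC {X : Type*} [NormedAddCommGroup X] [NormedSpace ℝ X] (k : ℕ) (T : ℝ)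
    (f : ℝ → SubProb Ω → X → ℝ) : Prop :=
  ∀ j ≤ k,
    (∀ p₀ ∈ Icc 0 T ×ˢ (univ : Set (SubProb Ω)),
      TendstoUniformly (fun (p : ℝ × SubProb Ω) x => iteratedFDeriv ℝ j (f p.1 p.2) x)
        (iteratedFDeriv ℝ j (f p₀.1 p₀.2)) (𝓝[Icc 0 T ×ˢ univ] p₀)) ∧
    ∃ B : ℝ, ∀ t ∈ Icc 0 T, ∀ m : SubProb Ω, ∀ x, ‖iteratedFDeriv ℝ j (f t m) x‖ ≤ B

/-- A smooth test function `Φ` on `[0, T] × SubProb Ω`, together with `∂_t Φ` (one-sided at the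
end points), `δΦ/δm` and `δ²Φ/δm²`. Joint continuity of the latter two follows from the
continuity into `C²` and `C¹`. -/
structure SmoothTestFunction (T : ℝ) (Ω : Set (EuclideanSpace ℝ (Fin d))) where
  /-- the function -/
  toFun : ℝ → SubProb Ω → ℝ
  /-- the time derivative -/
  dt : ℝ → SubProb Ω → ℝ
  /-- the first linear functional derivative -/
  dm : ℝ → SubProb Ω → EuclideanSpace ℝ (Fin d) → ℝ
  /-- the second linear functional derivative -/
  dmm : ℝ → SubProb Ω → EuclideanSpace ℝ (Fin d) × EuclideanSpace ℝ (Fin d) → ℝ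
  hasDeriv_dt : ∀ t ∈ Icc 0 T, ∀ m,
    HasDerivWithinAt (fun s => toFun s m) (dt t m) (Icc 0 T) t
  continuous_dt : ContinuousOn (fun p : ℝ × SubProb Ω => dt p.1 p.2) (Icc 0 T ×ˢ univ)
  hasDeriv_dm : ∀ t ∈ Icc 0 T, HasLinearDerivative (toFun t) (dm t)
  hasDeriv_dmm : ∀ t ∈ Icc 0 T, ∀ x ∈ Ω,
    HasLinearDerivative (fun m => dm t m x) (fun m y => dmm t m (x, y))
  dm_mem : ∀ t ∈ Icc 0 T, ∀ m, IsCcOn 2 Ω (dm t m)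
  dmm_mem : ∀ t ∈ Icc 0 T, ∀ m, IsCcOn 1 (Ω ×ˢ Ω) (dmm t m)
  continuous_dm : ContinuousBoundedInC 2 T dm
  continuous_dmm : ContinuousBoundedInC 1 T dmm

/-- The Lebesgue density of `m`. -/
def SubProb.density (m : SubProb Ω) (x : EuclideanSpace ℝ (Fin d)) : ℝ :=
  (m.meas.rnDeriv volume x).toReal

/-- `m ∈ L²(Ω)`: `m` has a square-integrable density. -/
def SubProb.InL2 (m : SubProb Ω) : Prop :=
  m.meas ≪ volume ∧ MemLp m.density 2 (volume.restrict Ω)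

/-- The squared `L²` norm of the density of `m`. -/
def SubProb.l2NormSq (m : SubProb Ω) : ℝ := ∫ x in Ω, m.density x ^ 2

/-- `u ∈ H₀¹(Ω)` with weak gradient `g`: `(u, g)` is a limit in `L²(Ω)` of `(φ, ∇φ)` with
`φ ∈ C_c^∞(Ω)`. -/
def IsH01 (Ω : Set (EuclideanSpace ℝ (Fin d))) (u : EuclideanSpace ℝ (Fin d) → ℝ)
    (g : EuclideanSpace ℝ (Fin d) → EuclideanSpace ℝ (Fin d)) : Prop :=
  MemLp u 2 (volume.restrict Ω) ∧ MemLp g 2 (volume.restrict Ω) ∧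
  ∃ φ : ℕ → EuclideanSpace ℝ (Fin d) → ℝ, (∀ n, IsCcOn ⊤ Ω (φ n)) ∧
    Tendsto (fun n => eLpNorm (fun x => φ n x - u x) 2 (volume.restrict Ω)) atTop (𝓝 0) ∧
    Tendsto (fun n => eLpNorm (fun x => ∇ (φ n) x - g x) 2 (volume.restrict Ω)) atTop (𝓝 0)

/-- Viscosity subsolutions of
`-∂_t U - ∫ Δ_x (δU/δm) dm + ∫ H(x, D_x (δU/δm)) dm = F(m)`, `U(T, ·) = G`,
`δU/δm = 0` on the boundary. -/
structure IsViscositySubsolution (T : ℝ) (Ω : Set (EuclideanSpace ℝ (Fin d)))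
    (H : EuclideanSpace ℝ (Fin d) → EuclideanSpace ℝ (Fin d) → ℝ) (F G : SubProb Ω → ℝ)
    (V : ℝ → SubProb Ω → ℝ) : Prop where
  usc : UpperSemicontinuousOn (fun p : ℝ × SubProb Ω => V p.1 p.2) (Icc 0 T ×ˢ univ)
  terminal : ∀ m, V T m ≤ G m
  test : ∃ C > 0, ∀ (Φ : SmoothTestFunction T Ω) (δ : ℝ), 0 < δ →
    ∀ t₀ ∈ Ico 0 T, ∀ m₀ : SubProb Ω, m₀.InL2 →
    IsMaxOn (fun p : ℝ × SubProb Ω => V p.1 p.2 - Φ.toFun p.1 p.2 - δ * p.2.l2NormSq)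
      (Icc 0 T ×ˢ {m | m.InL2}) (t₀, m₀) →
    ∃ g, IsH01 Ω m₀.density g ∧
      - Φ.dt t₀ m₀ + δ * (∫ x in Ω, ‖g x‖ ^ 2) - (∫ x, Δ (Φ.dm t₀ m₀) x ∂m₀.meas)
        + (∫ x, H x (∇ (Φ.dm t₀ m₀) x) ∂m₀.meas) ≤ F m₀ + C * δ * m₀.l2NormSq

/-- Viscosity supersolutions of the same equation. -/
structure IsViscositySupersolution (T : ℝ) (Ω : Set (EuclideanSpace ℝ (Fin d)))
    (H : EuclideanSpace ℝ (Fin d) → EuclideanSpace ℝ (Fin d) → ℝ) (F G : SubProb Ω → ℝ)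
    (V : ℝ → SubProb Ω → ℝ) : Prop where
  lsc : LowerSemicontinuousOn (fun p : ℝ × SubProb Ω => V p.1 p.2) (Icc 0 T ×ˢ univ)
  terminal : ∀ m, G m ≤ V T m
  test : ∃ C > 0, ∀ (Φ : SmoothTestFunction T Ω) (δ : ℝ), 0 < δ →
    ∀ t₀ ∈ Ico 0 T, ∀ m₀ : SubProb Ω, m₀.InL2 →
    IsMinOn (fun p : ℝ × SubProb Ω => V p.1 p.2 - Φ.toFun p.1 p.2 + δ * p.2.l2NormSq)
      (Icc 0 T ×ˢ {m | m.InL2}) (t₀, m₀) →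
    ∃ g, IsH01 Ω m₀.density g ∧
      F m₀ - C * δ * m₀.l2NormSq ≤
        - Φ.dt t₀ m₀ - δ * (∫ x in Ω, ‖g x‖ ^ 2) - (∫ x, Δ (Φ.dm t₀ m₀) x ∂m₀.meas)
          + (∫ x, H x (∇ (Φ.dm t₀ m₀) x) ∂m₀.meas)

end AbsorbedMFC

end

namespace AbsorbedMFC

variable {d : ℕ} {Ω : Set (EuclideanSpace ℝ (Fin d))}

/-! ### Sub-probability measures and the distance -/

instance (m : SubProb Ω) : IsFiniteMeasure m.meas :=
  ⟨lt_of_le_of_lt m.2.2 ENNReal.one_lt_top⟩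

lemma SubProb.meas_compl (m : SubProb Ω) : m.meas Ωᶜ = 0 := m.2.1

lemma SubProb.meas_univ_le (m : SubProb Ω) : m.meas univ ≤ 1 := m.2.2

lemma SubProb.measureReal_univ_le (m : SubProb Ω) : m.meas.real univ ≤ 1 :=
  ENNReal.toReal_le_of_le_ofReal zero_le_one (by simpa using m.meas_univ_le)

lemma SubProb.ae_mem (m : SubProb Ω) : ∀ᵐ x ∂m.meas, x ∈ Ω := by
  rw [ae_iff]; exact m.meas_compl

lemma SubProb.restrict_meas (m : SubProb Ω) : m.meas.restrict Ω = m.meas :=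
  Measure.restrict_eq_self_of_ae_mem m.ae_mem

/-- A function with Lipschitz constant one on the closure that vanishes on the boundary remains
Lipschitz with constant one after extension by zero. -/
lemma lipschitzWith_indicator (hΩ : IsOpen Ω) {φ : EuclideanSpace ℝ (Fin d) → ℝ}
    (hφ : φ ∈ lipZero Ω) : LipschitzWith 1 (Ω.indicator φ) := by
  have key : ∀ x ∈ Ω, ∀ y ∉ Ω, |φ x| ≤ dist x y := by
    intro x hx y hy
    obtain ⟨z, hz, hzf⟩ : (segment ℝ x y ∩ frontier Ω).Nonempty := by
      by_contra hne
      have hpre : IsPreconnected (segment ℝ x y) := (convex_segment x y).isPreconnected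
      have hout : ∀ z ∈ segment ℝ x y, z ∉ Ω → z ∈ (closure Ω)ᶜ := fun z hz hzΩ hzc =>
        hne ⟨z, hz, by rw [hΩ.frontier_eq]; exact ⟨hzc, hzΩ⟩⟩
      obtain ⟨z, -, hz1, hz2⟩ := hpre Ω (closure Ω)ᶜ hΩ isClosed_closure.isOpen_compl
        (fun z hz => by
          by_cases hzΩ : z ∈ Ω
          · exact Or.inl hzΩ
          · exact Or.inr (hout z hz hzΩ))
        ⟨x, left_mem_segment ℝ x y, hx⟩
        ⟨y, right_mem_segment ℝ x y, hout y (right_mem_segment ℝ x y) hy⟩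
      exact hz2 (subset_closure hz1)
    have h1 := hφ.1.dist_le_mul x (subset_closure hx) z (frontier_subset_closure hzf)
    rw [hφ.2 z hzf, Real.dist_eq, sub_zero] at h1
    have h2 := dist_add_dist_of_mem_segment hz
    have h3 : 0 ≤ dist z y := dist_nonneg
    simp only [NNReal.coe_one, one_mul] at h1
    linarith
  refine LipschitzWith.of_dist_le_mul fun x y => ?_
  rw [NNReal.coe_one, one_mul, Real.dist_eq]
  by_cases hx : x ∈ Ω <;> by_cases hy : y ∈ Ω
  · simpa [hx, hy, Real.dist_eq] using
      hφ.1.dist_le_mul x (subset_closure hx) y (subset_closure hy)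
  · simpa [hx, hy] using key x hx y hy
  · simpa [hx, hy, dist_comm] using key y hy x hx
  · simp [hx, hy]

/-- The functions with Lipschitz constant one that vanish outside `Ω`. -/
def zeroLip (Ω : Set (EuclideanSpace ℝ (Fin d))) : Set (EuclideanSpace ℝ (Fin d) → ℝ) :=
  {ψ | LipschitzWith 1 ψ ∧ ∀ x ∉ Ω, ψ x = 0}

lemma zeroLip_subset_lipZero (hΩ : IsOpen Ω) : zeroLip Ω ⊆ lipZero Ω := fun ψ hψ =>
  ⟨hψ.1.lipschitzOnWith, fun x hx => hψ.2 x fun h => by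
    rw [hΩ.frontier_eq] at hx; exact hx.2 h⟩

lemma indicator_mem_zeroLip (hΩ : IsOpen Ω) {φ : EuclideanSpace ℝ (Fin d) → ℝ}
    (hφ : φ ∈ lipZero Ω) : Ω.indicator φ ∈ zeroLip Ω :=
  ⟨lipschitzWith_indicator hΩ hφ, fun _ hx => indicator_of_notMem hx _⟩

lemma SubProb.integral_indicator_eq (m : SubProb Ω) (φ : EuclideanSpace ℝ (Fin d) → ℝ) :
    ∫ x, Ω.indicator φ x ∂m.meas = ∫ x, φ x ∂m.meas :=
  integral_congr_ae (m.ae_mem.mono fun _ hx => indicator_of_mem hx _)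

lemma edist_le_ofReal (hΩ : IsOpen Ω) {m n : SubProb Ω} {r : ℝ}
    (h : ∀ ψ ∈ zeroLip Ω, ∫ x, ψ x ∂m.meas - ∫ x, ψ x ∂n.meas ≤ r) :
    edist m n ≤ ENNReal.ofReal r := by
  refine iSup₂_le fun φ hφ => ENNReal.ofReal_le_ofReal ?_
  have := h _ (indicator_mem_zeroLip hΩ hφ)
  rwa [m.integral_indicator_eq, n.integral_indicator_eq] at this

lemma ofReal_integral_sub_le_edist (hΩ : IsOpen Ω) {m n : SubProb Ω}
    {ψ : EuclideanSpace ℝ (Fin d) → ℝ} (hψ : ψ ∈ zeroLip Ω) :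
    ENNReal.ofReal (∫ x, ψ x ∂m.meas - ∫ x, ψ x ∂n.meas) ≤ edist m n :=
  le_iSup₂ (f := fun (φ : EuclideanSpace ℝ (Fin d) → ℝ) (_ : φ ∈ lipZero Ω) =>
    ENNReal.ofReal (∫ x, φ x ∂m.meas - ∫ x, φ x ∂n.meas)) ψ (zeroLip_subset_lipZero hΩ hψ)

/-- The elements of `zeroLip Ω` are uniformly bounded. -/
lemma exists_zeroLip_bound (hd : 0 < d) (hΩ : IsSmoothBoundedDomain Ω) :
    ∃ D : ℝ, 0 < D ∧ ∀ ψ ∈ zeroLip Ω, ∀ x, |ψ x| ≤ D := by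
  have : Nonempty (Fin d) := ⟨⟨0, hd⟩⟩
  obtain ⟨y, hy⟩ : ∃ y, y ∉ Ω := by
    by_contra! h
    have : Ω = univ := eq_univ_of_forall h
    exact NormedSpace.unbounded_univ ℝ (EuclideanSpace ℝ (Fin d)) (this ▸ hΩ.isBounded)
  obtain ⟨D, hD, hb⟩ := hΩ.isBounded.exists_pos_norm_le
  refine ⟨D + ‖y‖, by positivity, fun ψ hψ x => ?_⟩
  by_cases hx : x ∈ Ω
  · have h := hψ.1.dist_le_mul x y
    rw [hψ.2 y hy, Real.dist_eq, sub_zero, NNReal.coe_one, one_mul, dist_eq_norm] at h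
    exact h.trans ((norm_sub_le _ _).trans (by gcongr; exact hb x hx))
  · rw [hψ.2 x hx]; simp; positivity

lemma SubProb.integrable_of_bound (m : SubProb Ω) {f : EuclideanSpace ℝ (Fin d) → ℝ}
    (hf : AEStronglyMeasurable f m.meas) {D : ℝ} (hD : ∀ x, |f x| ≤ D) : Integrable f m.meas :=
  Integrable.of_bound hf D (Eventually.of_forall hD)

/-- A finite family of elements of `zeroLip Ω` approximates all of them uniformly. -/
lemma exists_finite_net_zeroLip (hd : 0 < d) (hΩ : IsSmoothBoundedDomain Ω) {ε : ℝ} (hε : 0 < ε) :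
    ∃ t : Set (EuclideanSpace ℝ (Fin d) → ℝ), t.Finite ∧ t ⊆ zeroLip Ω ∧
      ∀ ψ ∈ zeroLip Ω, ∃ φ ∈ t, ∀ x ∈ Ω, |ψ x - φ x| ≤ ε := by
  obtain ⟨D, hD, hb⟩ := exists_zeroLip_bound hd hΩ
  have hK : IsCompact (closure Ω) := hΩ.isBounded.isCompact_closure
  have : CompactSpace (closure Ω) := isCompact_iff_compactSpace.1 hK
  let A : Set (BoundedContinuousFunction (closure Ω) ℝ) :=
    {f | ∃ ψ ∈ zeroLip Ω, ∀ x : closure Ω, f x = ψ x}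
  have hA : IsCompact (closure A) := by
    refine BoundedContinuousFunction.arzela_ascoli (Icc (-D) D) isCompact_Icc A ?_ ?_
    · rintro f x ⟨ψ, hψ, h⟩
      rw [h]; exact abs_le.1 (hb ψ hψ x)
    · refine UniformEquicontinuous.equicontinuous ?_
      refine LipschitzWith.uniformEquicontinuous _ 1 ?_
      rintro ⟨f, ψ, hψ, h⟩
      refine LipschitzWith.of_dist_le_mul fun x y => ?_
      have h1 := hψ.1.dist_le_mul x y
      rw [← h, ← h] at h1
      exact h1
  have htb : TotallyBounded A := hA.totallyBounded.subset subset_closure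
  obtain ⟨s, hsA, hsf, hs⟩ := totallyBounded_iff_subset.1 htb _ (Metric.dist_mem_uniformity hε)
  have hch : ∀ f : BoundedContinuousFunction (closure Ω) ℝ, ∃ ψ : EuclideanSpace ℝ (Fin d) → ℝ,
      f ∈ A → ψ ∈ zeroLip Ω ∧ ∀ x : closure Ω, f x = ψ x := by
    intro f
    by_cases hf : f ∈ A
    · obtain ⟨ψ, h⟩ := hf
      exact ⟨ψ, fun _ => h⟩
    · exact ⟨0, fun h => absurd h hf⟩
  choose r hr using hch
  refine ⟨r '' s, hsf.image r, ?_, ?_⟩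
  · rintro _ ⟨f, hf, rfl⟩
    exact (hr f (hsA hf)).1
  · intro ψ hψ
    let f : BoundedContinuousFunction (closure Ω) ℝ :=
      BoundedContinuousFunction.mkOfCompact
        ⟨fun x => ψ x, hψ.1.continuous.comp continuous_subtype_val⟩
    have hfA : f ∈ A := ⟨ψ, hψ, fun x => rfl⟩
    obtain ⟨g, hg, hfg⟩ := mem_iUnion₂.1 (hs hfA)
    refine ⟨r g, mem_image_of_mem r hg, fun x hx => ?_⟩
    have h1 : dist (f ⟨x, subset_closure hx⟩) (g ⟨x, subset_closure hx⟩) ≤ dist f g :=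
      BoundedContinuousFunction.dist_coe_le_dist _
    rw [(hr g (hsA hg)).2, Real.dist_eq] at h1
    exact h1.trans (le_of_lt hfg)

/-- The restriction to `Ω` of a measure of mass at most one. -/
noncomputable def SubProb.ofMeasure (Ω : Set (EuclideanSpace ℝ (Fin d))) (hΩ : MeasurableSet Ω)
    (μ : Measure (EuclideanSpace ℝ (Fin d))) (hμ : μ univ ≤ 1) : SubProb Ω :=
  ⟨μ.restrict Ω, by rw [Measure.restrict_apply hΩ.compl]; simp,
    le_trans (Measure.restrict_apply_le Ω univ) hμ⟩

lemma SubProb.integral_ofMeasure (hΩ : MeasurableSet Ω)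
    (μ : Measure (EuclideanSpace ℝ (Fin d))) (hμ : μ univ ≤ 1)
    {ψ : EuclideanSpace ℝ (Fin d) → ℝ} (hψ : ψ ∈ zeroLip Ω) :
    ∫ x, ψ x ∂(SubProb.ofMeasure Ω hΩ μ hμ).meas = ∫ x, ψ x ∂μ :=
  setIntegral_eq_integral_of_forall_compl_eq_zero hψ.2

/-- The space of sub-probability measures is compact. -/
theorem compactSpace_subProb (hd : 0 < d) (hΩ : IsSmoothBoundedDomain Ω) :
    CompactSpace (SubProb Ω) := by
  have hK : IsCompact (closure Ω) := hΩ.isBounded.isCompact_closure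
  set Z : Set (FiniteMeasure (EuclideanSpace ℝ (Fin d))) :=
    {μ | μ.mass ≤ 1 ∧ μ (closure Ω)ᶜ = 0} with hZ
  have hZc : IsCompact Z := isCompact_setOfPred_finiteMeasure_le_of_isCompact 1 hK
  have : CompactSpace Z := isCompact_iff_compactSpace.1 hZc
  have hmass : ∀ μ : Z, (μ.1 : Measure (EuclideanSpace ℝ (Fin d))) univ ≤ 1 := by
    intro μ
    have h := μ.2.1
    rw [← FiniteMeasure.ennreal_mass]
    exact_mod_cast h
  let f : Z → SubProb Ω := fun μ =>
    SubProb.ofMeasure Ω hΩ.isOpen.measurableSet μ.1 (hmass μ)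
  obtain ⟨D, hD, hb⟩ := exists_zeroLip_bound hd hΩ
  have hf : Continuous f := by
    rw [continuous_iff_continuousAt]
    intro μ₀
    rw [ContinuousAt, EMetric.tendsto_nhds]
    intro ε hε
    obtain ⟨ε', hε', hεε'⟩ : ∃ ε' : ℝ, 0 < ε' ∧ ENNReal.ofReal (3 * ε') < ε := by
      obtain ⟨r, hr0, hr⟩ := ENNReal.lt_iff_exists_nnreal_btwn.1 hε
      refine ⟨r / 3, by have : 0 < r := by exact_mod_cast hr0
                        positivity, ?_⟩
      rwa [mul_div_cancel₀ _ (by norm_num), ENNReal.ofReal_coe_nnreal]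
    obtain ⟨t, htf, hts, ht⟩ := exists_finite_net_zeroLip hd hΩ hε'
    have hev : ∀ φ ∈ t, ∀ᶠ μ : Z in 𝓝 μ₀,
        |∫ x, φ x ∂(f μ).meas - ∫ x, φ x ∂(f μ₀).meas| ≤ ε' := by
      intro φ hφ
      have hφz := hts hφ
      let φb : BoundedContinuousFunction (EuclideanSpace ℝ (Fin d)) ℝ :=
        BoundedContinuousFunction.ofNormedAddCommGroup φ hφz.1.continuous D (hb φ hφz)
      have h1 : Tendsto (fun μ : Z => μ.1) (𝓝 μ₀) (𝓝 μ₀.1) :=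
        continuous_subtype_val.continuousAt
      have h2 := FiniteMeasure.tendsto_iff_forall_integral_tendsto.1 h1 φb
      have h3 := Metric.tendsto_nhds.1 h2 ε' hε'
      refine h3.mono fun μ hμ => ?_
      rw [SubProb.integral_ofMeasure _ _ _ hφz, SubProb.integral_ofMeasure _ _ _ hφz]
      exact le_of_lt hμ
    filter_upwards [(Filter.eventually_all_finite htf).2 hev] with μ hμ
    refine lt_of_le_of_lt (edist_le_ofReal hΩ.isOpen fun ψ hψ => ?_) hεε'
    obtain ⟨φ, hφ, hψφ⟩ := ht ψ hψ
    have hφz := hts hφ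
    have hdiff : ∀ m : SubProb Ω, |∫ x, ψ x ∂m.meas - ∫ x, φ x ∂m.meas| ≤ ε' := by
      intro m
      rw [← integral_sub
        (m.integrable_of_bound hψ.1.continuous.aestronglyMeasurable (hb ψ hψ))
        (m.integrable_of_bound hφz.1.continuous.aestronglyMeasurable (hb φ hφz))]
      have := norm_integral_le_of_norm_le_const (μ := m.meas) (f := fun x => ψ x - φ x) (C := ε')
        (m.ae_mem.mono fun x hx => hψφ x hx)
      refine this.trans ?_
      have h1 := m.measureReal_univ_le
      nlinarith
    have h1 := abs_le.1 (hdiff (f μ))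
    have h2 := abs_le.1 (hdiff (f μ₀))
    have h3 := abs_le.1 (hμ φ hφ)
    linarith [h1.1, h1.2, h2.1, h2.2, h3.1, h3.2]
  have hsurj : Function.Surjective f := by
    intro m
    let μ : FiniteMeasure (EuclideanSpace ℝ (Fin d)) := ⟨m.meas, inferInstance⟩
    have hμ : (μ : Measure (EuclideanSpace ℝ (Fin d))) = m.meas := rfl
    refine ⟨⟨μ, ?_, ?_⟩, ?_⟩
    · have : (μ.mass : ℝ≥0∞) ≤ 1 := by
        rw [FiniteMeasure.ennreal_mass]; exact m.meas_univ_le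
      exact_mod_cast this
    · rw [FiniteMeasure.null_iff_toMeasure_null, hμ]
      exact measure_mono_null (compl_subset_compl.2 subset_closure) m.meas_compl
    · exact Subtype.ext m.restrict_meas
  exact hsurj.compactSpace hf

/-! ### Square-integrable measures -/

lemma toReal_eLpNorm_two {α F : Type*} {_ : MeasurableSpace α} [NormedAddCommGroup F]
    {μ : Measure α} {f : α → F} (hf : MemLp f 2 μ) :
    (eLpNorm f 2 μ).toReal = √(∫ x, ‖f x‖ ^ 2 ∂μ) := by
  rw [hf.eLpNorm_eq_integral_rpow_norm (by norm_num) (by norm_num), Real.sqrt_eq_rpow]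
  simp only [ENNReal.toReal_ofNat, Real.rpow_two]
  rw [ENNReal.toReal_ofReal (by positivity)]
  norm_num

/-- The Cauchy–Schwarz inequality. -/
lemma abs_integral_inner_le {α F : Type*} {_ : MeasurableSpace α} [NormedAddCommGroup F]
    [InnerProductSpace ℝ F] {μ : Measure α} {f g : α → F} (hf : MemLp f 2 μ) (hg : MemLp g 2 μ) :
    |∫ x, inner ℝ (f x) (g x) ∂μ| ≤ √(∫ x, ‖f x‖ ^ 2 ∂μ) * √(∫ x, ‖g x‖ ^ 2 ∂μ) := by
  have h := abs_real_inner_le_norm (hf.toLp f) (hg.toLp g)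
  rw [L2.inner_def, Lp.norm_toLp, Lp.norm_toLp, toReal_eLpNorm_two hf, toReal_eLpNorm_two hg] at h
  refine le_trans (le_of_eq ?_) h
  congr 1
  refine integral_congr_ae ?_
  filter_upwards [hf.coeFn_toLp, hg.coeFn_toLp] with x h1 h2
  rw [h1, h2]

lemma abs_integral_mul_le {α : Type*} {_ : MeasurableSpace α}
    {μ : Measure α} {f g : α → ℝ} (hf : MemLp f 2 μ) (hg : MemLp g 2 μ) :
    |∫ x, f x * g x ∂μ| ≤ √(∫ x, f x ^ 2 ∂μ) * √(∫ x, g x ^ 2 ∂μ) := by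
  simpa [mul_comm] using abs_integral_inner_le hf hg

lemma IsSmoothBoundedDomain.isFiniteMeasure (hΩ : IsSmoothBoundedDomain Ω) :
    IsFiniteMeasure (volume.restrict Ω) :=
  ⟨by rw [Measure.restrict_apply_univ]; exact hΩ.isBounded.measure_lt_top⟩

lemma SubProb.density_nonneg (m : SubProb Ω) (x : EuclideanSpace ℝ (Fin d)) : 0 ≤ m.density x :=
  ENNReal.toReal_nonneg

lemma SubProb.measurable_density (m : SubProb Ω) : Measurable m.density :=
  (Measure.measurable_rnDeriv _ _).ennreal_toReal

lemma SubProb.integral_eq (hΩ : IsOpen Ω) (m : SubProb Ω) (hac : m.meas ≪ volume)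
    (f : EuclideanSpace ℝ (Fin d) → ℝ) :
    ∫ x, f x ∂m.meas = ∫ x in Ω, f x * m.density x := by
  rw [← m.integral_indicator_eq f, ← integral_rnDeriv_smul hac, ← integral_indicator
    hΩ.measurableSet]
  refine integral_congr_ae (Eventually.of_forall fun x => ?_)
  by_cases hx : x ∈ Ω <;> simp [hx, SubProb.density, mul_comm]

lemma lipschitzWith_integral (hΩ : IsOpen Ω) {ψ : EuclideanSpace ℝ (Fin d) → ℝ}
    (hψ : ψ ∈ zeroLip Ω) : LipschitzWith 1 fun m : SubProb Ω => ∫ x, ψ x ∂m.meas := by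
  intro m n
  rw [ENNReal.coe_one, one_mul, edist_dist, Real.dist_eq]
  rcases abs_cases (∫ x, ψ x ∂m.meas - ∫ x, ψ x ∂n.meas) with h | h
  · rw [h.1]; exact ofReal_integral_sub_le_edist hΩ hψ
  · rw [h.1, neg_sub, edist_comm]; exact ofReal_integral_sub_le_edist hΩ hψ

lemma exists_smul_mem_zeroLip {ψ : EuclideanSpace ℝ (Fin d) → ℝ} {K : ℝ≥0}
    (hψ : LipschitzWith K ψ) (h0 : ∀ x ∉ Ω, ψ x = 0) :
    ∃ c : ℝ, 0 < c ∧ (fun x => c * ψ x) ∈ zeroLip Ω := by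
  refine ⟨((K : ℝ) + 1)⁻¹, by positivity, ?_, fun x hx => by simp [h0 x hx]⟩
  refine LipschitzWith.of_dist_le_mul fun x y => ?_
  have h := hψ.dist_le_mul x y
  rw [Real.dist_eq] at h
  rw [Real.dist_eq, ← mul_sub, abs_mul, abs_of_pos (by positivity), NNReal.coe_one, one_mul,
    inv_mul_le_iff₀ (by positivity)]
  nlinarith [dist_nonneg (x := x) (y := y)]

lemma continuous_integral (hΩ : IsOpen Ω) {ψ : EuclideanSpace ℝ (Fin d) → ℝ} {K : ℝ≥0}
    (hψ : LipschitzWith K ψ) (h0 : ∀ x ∉ Ω, ψ x = 0) :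
    Continuous fun m : SubProb Ω => ∫ x, ψ x ∂m.meas := by
  obtain ⟨c, hc, hcψ⟩ := exists_smul_mem_zeroLip hψ h0
  have h : Continuous fun m : SubProb Ω => c⁻¹ * ∫ x, c * ψ x ∂m.meas :=
    continuous_const.mul (lipschitzWith_integral hΩ hcψ).continuous
  simpa [integral_const_mul, inv_mul_cancel_left₀ hc.ne'] using h

lemma integral_le_of_zeroLip_of_lipschitz {m : SubProb Ω} {A : ℝ}
    (h : ∀ ψ ∈ zeroLip Ω, |∫ x, ψ x ∂m.meas| ≤ A * √(∫ x in Ω, ψ x ^ 2))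
    {ψ : EuclideanSpace ℝ (Fin d) → ℝ} {K : ℝ≥0}
    (hψ : LipschitzWith K ψ) (h0 : ∀ x ∉ Ω, ψ x = 0) :
    |∫ x, ψ x ∂m.meas| ≤ A * √(∫ x in Ω, ψ x ^ 2) := by
  obtain ⟨c, hc, hcψ⟩ := exists_smul_mem_zeroLip hψ h0
  have h1 := h _ hcψ
  simp only [mul_pow, integral_const_mul, abs_mul] at h1
  rw [Real.sqrt_mul (by positivity), Real.sqrt_sq hc.le, abs_of_pos hc] at h1
  have h2 : c * |∫ x, ψ x ∂m.meas| ≤ c * (A * √(∫ x in Ω, ψ x ^ 2)) := by linarith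
  exact le_of_mul_le_mul_left h2 hc

/-- The estimate extends to Lipschitz functions with no boundary condition. -/
lemma integral_le_of_zeroLip_of_bounded (hΩ : IsSmoothBoundedDomain Ω) {m : SubProb Ω} {A : ℝ}
    (h : ∀ ψ ∈ zeroLip Ω, |∫ x, ψ x ∂m.meas| ≤ A * √(∫ x in Ω, ψ x ^ 2))
    {φ : EuclideanSpace ℝ (Fin d) → ℝ} {K : ℝ≥0}
    (hφ : LipschitzWith K φ) {B : ℝ} (hB : ∀ x, |φ x| ≤ B) :
    |∫ x, φ x ∂m.meas| ≤ A * √(∫ x in Ω, φ x ^ 2) := by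
  have := hΩ.isFiniteMeasure
  rcases isEmpty_or_nonempty (Fin d) with hd | hd
  · have : Subsingleton (EuclideanSpace ℝ (Fin d)) := inferInstance
    have hu : Ω = univ := by
      obtain ⟨x, hx⟩ := hΩ.isConnected.nonempty
      exact eq_univ_of_forall fun y => Subsingleton.elim x y ▸ hx
    exact integral_le_of_zeroLip_of_lipschitz h hφ fun x hx => absurd (hu ▸ mem_univ x) hx
  have hne : (Ωᶜ).Nonempty := by
    by_contra hc
    rw [not_nonempty_iff_eq_empty, compl_empty_iff] at hc
    exact NormedSpace.unbounded_univ ℝ (EuclideanSpace ℝ (Fin d)) (hc ▸ hΩ.isBounded)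
  let χ : ℕ → EuclideanSpace ℝ (Fin d) → ℝ := fun j x => min 1 (j * Metric.infDist x Ωᶜ)
  have hχ0 : ∀ j x, 0 ≤ χ j x := fun j x =>
    le_min zero_le_one (mul_nonneg j.cast_nonneg Metric.infDist_nonneg)
  have hχ1 : ∀ j x, χ j x ≤ 1 := fun j x => min_le_left _ _
  have hχd : ∀ j x y, |χ j x - χ j y| ≤ j * dist x y := by
    intro j x y
    refine (abs_min_sub_min_le_max _ _ _ _).trans ?_
    have h1 := (Metric.lipschitz_infDist_pt (Ωᶜ : Set (EuclideanSpace ℝ (Fin d)))).dist_le_mul x y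
    rw [Real.dist_eq, NNReal.coe_one, one_mul] at h1
    rw [sub_self, abs_zero, ← mul_sub, abs_mul, Nat.abs_cast]
    exact max_le (by positivity) (by gcongr)
  have hχt : ∀ x ∈ Ω, Tendsto (fun j => χ j x) atTop (𝓝 1) := by
    intro x hx
    have hpos : 0 < Metric.infDist x Ωᶜ :=
      (hΩ.isOpen.isClosed_compl.notMem_iff_infDist_pos hne).1 (by simpa using hx)
    refine tendsto_const_nhds.congr' ?_
    have ht : Tendsto (fun j : ℕ => (j : ℝ) * Metric.infDist x Ωᶜ) atTop atTop :=
      tendsto_natCast_atTop_atTop.atTop_mul_const hpos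
    filter_upwards [ht.eventually_ge_atTop 1] with j hj
    exact (min_eq_left hj).symm
  have hB0 : 0 ≤ B := (abs_nonneg _).trans (hB 0)
  have hle : ∀ j, |∫ x, φ x * χ j x ∂m.meas| ≤ A * √(∫ x in Ω, (φ x * χ j x) ^ 2) := by
    intro j
    refine integral_le_of_zeroLip_of_lipschitz (K := ⟨B * j + K, by positivity⟩) h ?_ ?_
    · refine LipschitzWith.of_dist_le_mul fun x y => ?_
      have h1 := hφ.dist_le_mul x y
      rw [Real.dist_eq] at h1 ⊢
      calc |φ x * χ j x - φ y * χ j y| = |φ x * (χ j x - χ j y) + (φ x - φ y) * χ j y| := by ring_nf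
        _ ≤ |φ x * (χ j x - χ j y)| + |(φ x - φ y) * χ j y| := abs_add_le _ _
        _ ≤ B * (j * dist x y) + K * dist x y * 1 := by
            rw [abs_mul, abs_mul, abs_of_nonneg (hχ0 j y)]
            exact add_le_add (mul_le_mul (hB x) (hχd j x y) (abs_nonneg _) hB0)
              (mul_le_mul h1 (hχ1 j y) (hχ0 j y) (by positivity))
        _ = (B * j + K) * dist x y := by ring
    · intro x hx
      have : Metric.infDist x Ωᶜ = 0 := Metric.infDist_zero_of_mem hx
      simp [χ, this]
  have hχc : ∀ j, Continuous (χ j) := fun j =>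
    continuous_const.min (continuous_const.mul (Metric.continuous_infDist_pt _))
  have hφc := hφ.continuous
  have hlim1 : Tendsto (fun j => ∫ x, φ x * χ j x ∂m.meas) atTop (𝓝 (∫ x, φ x ∂m.meas)) := by
    refine tendsto_integral_of_dominated_convergence (fun _ => B)
      (fun j => (hφc.mul (hχc j)).aestronglyMeasurable) (integrable_const _)
      (fun j => Eventually.of_forall fun x => ?_) ?_
    · rw [Real.norm_eq_abs, abs_mul, abs_of_nonneg (hχ0 j x)]
      exact (mul_le_mul (hB x) (hχ1 j x) (hχ0 j x) hB0).trans (by rw [mul_one])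
    · filter_upwards [m.ae_mem] with x hx
      simpa using (hχt x hx).const_mul (φ x)
  have hlim2 : Tendsto (fun j => ∫ x in Ω, (φ x * χ j x) ^ 2) atTop
      (𝓝 (∫ x in Ω, φ x ^ 2)) := by
    refine tendsto_integral_of_dominated_convergence (fun _ => B ^ 2)
      (fun j => ((hφc.mul (hχc j)).pow 2).aestronglyMeasurable) (integrable_const _)
      (fun j => Eventually.of_forall fun x => ?_) ?_
    · rw [Real.norm_eq_abs, abs_of_nonneg (sq_nonneg _), ← sq_abs, abs_mul,
        abs_of_nonneg (hχ0 j x)]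
      refine pow_le_pow_left₀ (mul_nonneg (abs_nonneg _) (hχ0 j x)) ?_ 2
      exact (mul_le_mul (hB x) (hχ1 j x) (hχ0 j x) hB0).trans (by rw [mul_one])
    · filter_upwards [ae_restrict_mem hΩ.isOpen.measurableSet] with x hx
      simpa using ((hχt x hx).const_mul (φ x)).pow 2
  exact le_of_tendsto_of_tendsto' hlim1.abs
    (((Real.continuous_sqrt.tendsto _).comp hlim2).const_mul A) hle

lemma integral_le_of_zeroLip_of_memLp (hΩ : IsSmoothBoundedDomain Ω) {m : SubProb Ω} {A : ℝ}
    (hA : 0 ≤ A)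
    (h : ∀ ψ ∈ zeroLip Ω, |∫ x, ψ x ∂m.meas| ≤ A * √(∫ x in Ω, ψ x ^ 2))
    {g : EuclideanSpace ℝ (Fin d) → ℝ} (hg : MemLp g 2 (m.meas + volume.restrict Ω)) :
    |∫ x, g x ∂m.meas| ≤ A * √(∫ x in Ω, g x ^ 2) := by
  have := hΩ.isFiniteMeasure
  set μ := m.meas + volume.restrict Ω with hμ
  have hmμ : m.meas ≤ μ := Measure.le_add_right le_rfl
  have hvμ : volume.restrict Ω ≤ μ := Measure.le_add_left le_rfl
  refine le_of_forall_pos_le_add fun ε hε => ?_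
  obtain ⟨ε', hε', hεε⟩ : ∃ ε' : ℝ, 0 < ε' ∧ (A + 1) * ε' ≤ ε :=
    ⟨ε / (A + 1), by positivity, by field_simp; exact le_rfl⟩
  obtain ⟨φ, hφc, hφs, hφ⟩ := hg.exist_eLpNorm_sub_le (by norm_num) (by norm_num) hε'
  obtain ⟨K, hK⟩ := hφs.lipschitzWith_of_hasCompactSupport hφc (by simp)
  obtain ⟨B, hB⟩ := hφs.continuous.bounded_above_of_compact_support hφc
  have h1 := integral_le_of_zeroLip_of_bounded hΩ h hK hB
  have hφμ : MemLp φ 2 μ := hφs.continuous.memLp_of_hasCompactSupport hφc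
  have hsub : MemLp (g - φ) 2 μ := hg.sub hφμ
  have h2 : |∫ x, g x ∂m.meas - ∫ x, φ x ∂m.meas| ≤ ε' := by
    rw [← integral_sub ((hg.mono_measure hmμ).integrable (by norm_num))
      ((hφμ.mono_measure hmμ).integrable (by norm_num))]
    have h3 := norm_integral_le_lintegral_norm (μ := m.meas) (fun x => g x - φ x)
    refine h3.trans (ENNReal.toReal_le_of_le_ofReal hε'.le ?_)
    have h4 : ∫⁻ a, ENNReal.ofReal ‖g a - φ a‖ ∂m.meas = eLpNorm (g - φ) 1 m.meas := by
      rw [eLpNorm_one_eq_lintegral_enorm]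
      simp only [ofReal_norm, Pi.sub_apply]
    rw [h4]
    refine (eLpNorm_le_eLpNorm_mul_rpow_measure_univ (q := 2) (by norm_num)
      (hsub.mono_measure hmμ).1).trans ?_
    calc eLpNorm (g - φ) 2 m.meas * m.meas univ ^ (1 / (1 : ℝ≥0∞).toReal - 1 / (2 : ℝ≥0∞).toReal)
        ≤ eLpNorm (g - φ) 2 μ * 1 := by
          gcongr
          exact ENNReal.rpow_le_one m.meas_univ_le (by norm_num)
      _ ≤ ENNReal.ofReal ε' := by rw [mul_one]; exact hφ
  have h5 : √(∫ x in Ω, φ x ^ 2) ≤ √(∫ x in Ω, g x ^ 2) + ε' := by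
    have e1 := toReal_eLpNorm_two (hφμ.mono_measure hvμ)
    have e2 := toReal_eLpNorm_two (hg.mono_measure hvμ)
    simp only [Real.norm_eq_abs, sq_abs] at e1 e2
    rw [← e1, ← e2]
    have h6 : eLpNorm φ 2 (volume.restrict Ω)
        ≤ eLpNorm g 2 (volume.restrict Ω) + ENNReal.ofReal ε' := by
      have : φ = g - (g - φ) := by simp
      calc eLpNorm φ 2 (volume.restrict Ω) = eLpNorm (g - (g - φ)) 2 (volume.restrict Ω) := by
            rw [← this]
        _ ≤ eLpNorm g 2 (volume.restrict Ω) + eLpNorm (g - φ) 2 (volume.restrict Ω) :=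
            eLpNorm_sub_le (hg.mono_measure hvμ).1 (hsub.mono_measure hvμ).1 (by norm_num)
        _ ≤ _ := by
            gcongr
            exact (eLpNorm_mono_measure _ hvμ).trans hφ
    have h7 := ENNReal.toReal_mono (by
      exact ENNReal.add_ne_top.2 ⟨(hg.mono_measure hvμ).eLpNorm_ne_top, ENNReal.ofReal_ne_top⟩) h6
    rwa [ENNReal.toReal_add (hg.mono_measure hvμ).eLpNorm_ne_top ENNReal.ofReal_ne_top,
      ENNReal.toReal_ofReal hε'.le] at h7
  have h8 := abs_sub_abs_le_abs_sub (∫ x, g x ∂m.meas) (∫ x, φ x ∂m.meas)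
  have h9 := mul_le_mul_of_nonneg_left h5 hA
  nlinarith

/-- A measure that is bounded as a functional for the `L²` norm has a square-integrable density. -/
theorem inL2_of_zeroLip_bound (hΩ : IsSmoothBoundedDomain Ω) {m : SubProb Ω} {A : ℝ}
    (hA : 0 ≤ A)
    (h : ∀ ψ ∈ zeroLip Ω, |∫ x, ψ x ∂m.meas| ≤ A * √(∫ x in Ω, ψ x ^ 2)) :
    m.InL2 ∧ m.l2NormSq ≤ A ^ 2 := by
  have := hΩ.isFiniteMeasure
  have hac : m.meas ≪ volume := by
    refine Measure.AbsolutelyContinuous.mk fun s hs h0 => ?_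
    have hmem : MemLp (s.indicator fun _ => (1 : ℝ)) 2 (m.meas + volume.restrict Ω) :=
      memLp_indicator_const 2 hs 1 (Or.inr (measure_ne_top _ _))
    have h1 := integral_le_of_zeroLip_of_memLp hΩ hA h hmem
    have h2 : ∫ x in Ω, (s.indicator (fun _ => (1 : ℝ)) x) ^ 2 = 0 := by
      refine integral_eq_zero_of_ae (ae_restrict_of_ae ?_)
      have : ∀ᵐ x ∂(volume : Measure (EuclideanSpace ℝ (Fin d))), x ∉ s := by
        rw [ae_iff]; simpa using h0
      filter_upwards [this] with x hx
      simp [hx]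
    rw [h2, Real.sqrt_zero, mul_zero, integral_indicator_const _ hs] at h1
    simp only [smul_eq_mul, mul_one] at h1
    have h3 : m.meas.real s = 0 := abs_nonpos_iff.1 h1
    exact (measureReal_eq_zero_iff).1 h3
  set g : ℕ → EuclideanSpace ℝ (Fin d) → ℝ := fun j x => min (m.density x) j with hg
  have hg0 : ∀ j x, 0 ≤ g j x := fun j x => le_min (m.density_nonneg x) j.cast_nonneg
  have hgm : ∀ j, Measurable (g j) := fun j => m.measurable_density.min measurable_const
  have hgb : ∀ j x, ‖g j x‖ ≤ j := fun j x => by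
    rw [Real.norm_eq_abs, abs_of_nonneg (hg0 j x)]; exact min_le_right _ _
  have hbound : ∀ j, ∫ x in Ω, g j x ^ 2 ≤ A ^ 2 := by
    intro j
    have h1 := integral_le_of_zeroLip_of_memLp hΩ hA h
      (MemLp.of_bound (p := 2) (hgm j).aestronglyMeasurable j (Eventually.of_forall (hgb j)))
    rw [m.integral_eq hΩ.isOpen hac] at h1
    have hinteg : Integrable (fun x => m.density x) volume := Measure.integrable_toReal_rnDeriv
    have h2 : ∫ x in Ω, g j x ^ 2 ≤ ∫ x in Ω, g j x * m.density x := by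
      refine integral_mono ?_ ?_ fun x => ?_
      · refine Integrable.of_bound ((hgm j).pow_const 2).aestronglyMeasurable ((j : ℝ) ^ 2)
          (Eventually.of_forall fun x => ?_)
        rw [norm_pow]; gcongr; exact hgb j x
      · exact hinteg.restrict.bdd_mul (hgm j).aestronglyMeasurable (Eventually.of_forall (hgb j))
      · show g j x ^ 2 ≤ g j x * m.density x
        rw [pow_two]
        exact mul_le_mul_of_nonneg_left (min_le_left _ _) (hg0 j x)
    set X := ∫ x in Ω, g j x ^ 2 with hX
    have hX0 : 0 ≤ X := integral_nonneg fun x => sq_nonneg _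
    have h3 : X ≤ A * √X := h2.trans ((le_abs_self _).trans h1)
    have h4 : √X * √X = X := Real.mul_self_sqrt hX0
    have h5 : 0 ≤ √X := Real.sqrt_nonneg _
    nlinarith [sq_nonneg (A - √X)]
  have hlin : ∫⁻ x in Ω, ENNReal.ofReal (m.density x ^ 2) ≤ ENNReal.ofReal (A ^ 2) := by
    have hlim : ∀ x, Tendsto (fun j => ENNReal.ofReal (g j x ^ 2)) atTop
        (𝓝 (ENNReal.ofReal (m.density x ^ 2))) := by
      intro x
      refine tendsto_const_nhds.congr' ?_
      obtain ⟨N, hN⟩ := exists_nat_ge (m.density x)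
      filter_upwards [eventually_ge_atTop N] with j hj
      have : g j x = m.density x := min_eq_left (hN.trans (by exact_mod_cast hj))
      rw [this]
    calc ∫⁻ x in Ω, ENNReal.ofReal (m.density x ^ 2)
        = ∫⁻ x in Ω, liminf (fun j => ENNReal.ofReal (g j x ^ 2)) atTop := by
          simp_rw [fun x => (hlim x).liminf_eq]
      _ ≤ liminf (fun j => ∫⁻ x in Ω, ENNReal.ofReal (g j x ^ 2)) atTop :=
          lintegral_liminf_le fun j => ((hgm j).pow_const 2).ennreal_ofReal
      _ ≤ ENNReal.ofReal (A ^ 2) := by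
          refine liminf_le_of_le (by isBoundedDefault) fun b hb => ?_
          obtain ⟨j, hj⟩ := hb.exists
          refine hj.trans ?_
          rw [← ofReal_integral_eq_lintegral_ofReal]
          · exact ENNReal.ofReal_le_ofReal (hbound j)
          · refine Integrable.of_bound ((hgm j).pow_const 2).aestronglyMeasurable ((j : ℝ) ^ 2)
              (Eventually.of_forall fun x => ?_)
            rw [norm_pow]; gcongr; exact hgb j x
          · exact Eventually.of_forall fun x => sq_nonneg _
  have hsq : Integrable (fun x => m.density x ^ 2) (volume.restrict Ω) := by
    refine ⟨(m.measurable_density.pow_const 2).aestronglyMeasurable, ?_⟩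
    rw [hasFiniteIntegral_iff_ofReal (Eventually.of_forall fun x => sq_nonneg _)]
    exact lt_of_le_of_lt hlin ENNReal.ofReal_lt_top
  refine ⟨⟨hac, (memLp_two_iff_integrable_sq m.measurable_density.aestronglyMeasurable).2 hsq⟩, ?_⟩
  rw [SubProb.l2NormSq, integral_eq_lintegral_of_nonneg_ae
    (Eventually.of_forall fun x => sq_nonneg _) hsq.1]
  exact ENNReal.toReal_le_of_le_ofReal (sq_nonneg _) hlin

lemma SubProb.l2NormSq_nonneg (m : SubProb Ω) : 0 ≤ m.l2NormSq :=
  integral_nonneg fun _ => sq_nonneg _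

lemma zeroLip_memLp (hd : 0 < d) (hΩ : IsSmoothBoundedDomain Ω)
    {ψ : EuclideanSpace ℝ (Fin d) → ℝ} (hψ : ψ ∈ zeroLip Ω) (p : ℝ≥0∞) :
    MemLp ψ p (volume.restrict Ω) := by
  have := hΩ.isFiniteMeasure
  obtain ⟨D, -, hb⟩ := exists_zeroLip_bound hd hΩ
  exact MemLp.of_bound hψ.1.continuous.aestronglyMeasurable D (Eventually.of_forall (hb ψ hψ))

/-- The `L²` balls are closed. -/
theorem isClosed_l2Ball (hd : 0 < d) (hΩ : IsSmoothBoundedDomain Ω) (R : ℝ) :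
    IsClosed {m : SubProb Ω | m.InL2 ∧ m.l2NormSq ≤ R} := by
  rcases lt_or_ge R 0 with hR | hR
  · convert! isClosed_empty
    ext m
    simp only [mem_ofPred_eq, mem_empty_iff_false, iff_false, not_and, not_le]
    exact fun _ => hR.trans_le m.l2NormSq_nonneg
  refine isClosed_of_closure_subset fun m hm => ?_
  have h : ∀ ψ ∈ zeroLip Ω, |∫ x, ψ x ∂m.meas| ≤ √R * √(∫ x in Ω, ψ x ^ 2) := by
    intro ψ hψ
    have hcl : IsClosed {n : SubProb Ω | |∫ x, ψ x ∂n.meas| ≤ √R * √(∫ x in Ω, ψ x ^ 2)} :=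
      isClosed_le (lipschitzWith_integral hΩ.isOpen hψ).continuous.abs continuous_const
    refine closure_minimal ?_ hcl hm
    rintro n ⟨hn, hnR⟩
    rw [mem_ofPred_eq, n.integral_eq hΩ.isOpen hn.1, mul_comm]
    refine (abs_integral_mul_le (zeroLip_memLp hd hΩ hψ 2) hn.2).trans ?_
    gcongr
    exact hnR
  obtain ⟨h1, h2⟩ := inL2_of_zeroLip_bound hΩ (Real.sqrt_nonneg R) h
  exact ⟨h1, by rwa [Real.sq_sqrt hR] at h2⟩

/-- Square-integrable measures are dense. -/
theorem exists_inL2_edist_le (hd : 0 < d) (hΩ : IsSmoothBoundedDomain Ω) (m : SubProb Ω)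
    {r : ℝ} (hr : 0 < r) : ∃ n : SubProb Ω, n.InL2 ∧ edist n m ≤ ENNReal.ofReal r := by
  have := hΩ.isFiniteMeasure
  obtain ⟨D, hD, hb⟩ := exists_zeroLip_bound hd hΩ
  let b : Set (EuclideanSpace ℝ (Fin d)) := Metric.ball 0 r
  have hb0 : volume b ≠ 0 := (Metric.measure_ball_pos volume 0 hr).ne'
  have hbt : volume b ≠ ⊤ := measure_ball_lt_top.ne
  let c : ℝ≥0∞ := (volume b)⁻¹
  let ν : Measure (EuclideanSpace ℝ (Fin d)) := c • volume.restrict b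
  have hν : IsProbabilityMeasure ν := ⟨by
    simp only [ν, Measure.smul_apply, Measure.restrict_apply_univ, smul_eq_mul]
    exact ENNReal.inv_mul_cancel hb0 hbt⟩
  have hνle : ν ≤ c • volume := by
    refine Measure.le_iff.2 fun s _ => ?_
    simp only [ν, Measure.smul_apply, smul_eq_mul]
    gcongr
    exact Measure.restrict_le_self
  let μ := Measure.conv m.meas ν
  have hμapp : ∀ s, MeasurableSet s → μ s ≤ c * volume s := by
    intro s hs
    have h1 : μ s = ∫⁻ x, ν ((fun y => x + y) ⁻¹' s) ∂m.meas := by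
      simp only [μ, Measure.conv]
      rw [Measure.map_apply measurable_add hs, Measure.prod_apply (measurable_add hs)]
      rfl
    rw [h1]
    calc ∫⁻ x, ν ((fun y => x + y) ⁻¹' s) ∂m.meas ≤ ∫⁻ x, c * volume s ∂m.meas := by
          refine lintegral_mono fun x => (hνle _).trans ?_
          simp
      _ ≤ c * volume s := by
          rw [lintegral_const]
          exact mul_le_of_le_one_right' m.meas_univ_le
  have hμu : μ univ ≤ 1 := by
    simp only [μ, Measure.conv]
    rw [Measure.map_apply measurable_add MeasurableSet.univ, preimage_univ,
      Measure.prod_apply MeasurableSet.univ]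
    simpa using m.meas_univ_le
  have hmeas := hΩ.isOpen.measurableSet
  let n : SubProb Ω := SubProb.ofMeasure Ω hmeas μ hμu
  have hcne : c ≠ ⊤ := ENNReal.inv_ne_top.2 hb0
  have hnle : n.meas ≤ c • volume.restrict Ω := by
    refine Measure.le_iff.2 fun s hs => ?_
    show μ.restrict Ω s ≤ _
    rw [Measure.restrict_apply hs, Measure.smul_apply, Measure.restrict_apply hs, smul_eq_mul]
    exact hμapp _ (hs.inter hmeas)
  refine ⟨n, ?_, ?_⟩
  · refine (inL2_of_zeroLip_bound hΩ (A := c.toReal * √((volume.restrict Ω).real univ))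
      (by positivity) fun ψ hψ => ?_).1
    have hψ1 : Integrable ψ (c • volume.restrict Ω) :=
      (memLp_one_iff_integrable.1 (zeroLip_memLp hd hΩ hψ 1)).smul_measure hcne
    have h1 : |∫ x, ψ x ∂n.meas| ≤ c.toReal * ∫ x in Ω, |ψ x| := by
      calc |∫ x, ψ x ∂n.meas| ≤ ∫ x, |ψ x| ∂n.meas := abs_integral_le_integral_abs
        _ ≤ ∫ x, |ψ x| ∂(c • volume.restrict Ω) :=
            integral_mono_measure hnle (Eventually.of_forall fun x => abs_nonneg _) hψ1.abs
        _ = _ := by rw [integral_smul_measure, smul_eq_mul]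
    have h2 := abs_integral_mul_le (μ := volume.restrict Ω) (f := fun _ => (1 : ℝ))
      (g := fun x => |ψ x|) (memLp_const 1) (zeroLip_memLp hd hΩ hψ 2).abs
    simp only [one_mul, one_pow, integral_const, smul_eq_mul, mul_one, sq_abs] at h2
    calc |∫ x, ψ x ∂n.meas| ≤ c.toReal * ∫ x in Ω, |ψ x| := h1
      _ ≤ c.toReal * (√((volume.restrict Ω).real univ) * √(∫ x in Ω, ψ x ^ 2)) := by
          gcongr; exact (le_abs_self _).trans h2
      _ = _ := by ring
  · refine edist_le_ofReal hΩ.isOpen fun ψ hψ => ?_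
    have hψm := hψ.1.continuous.measurable
    have hμf : IsFiniteMeasure μ := ⟨lt_of_le_of_lt hμu ENNReal.one_lt_top⟩
    rw [SubProb.integral_ofMeasure _ _ _ hψ, integral_conv
      (Integrable.of_bound hψm.aestronglyMeasurable D (Eventually.of_forall (hb ψ hψ)))]
    have hbd : ∀ x, |∫ y, ψ (x + y) ∂ν - ψ x| ≤ r := by
      intro x
      have hi : Integrable (fun y => ψ (x + y)) ν := Integrable.of_bound
        (hψm.comp (measurable_const_add x)).aestronglyMeasurable D
        (Eventually.of_forall fun y => hb ψ hψ _)
      have h1 : ∫ y, ψ (x + y) ∂ν - ψ x = ∫ y, (ψ (x + y) - ψ x) ∂ν := by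
        rw [integral_sub hi (integrable_const _)]; simp
      rw [h1]
      have hball : ∀ᵐ y ∂ν, y ∈ b := by
        refine Measure.ae_smul_measure ?_ c
        exact ae_restrict_mem measurableSet_ball
      have h2 := norm_integral_le_of_norm_le_const (μ := ν) (f := fun y => ψ (x + y) - ψ x) (C := r)
        (hball.mono fun y hy => by
          have h3 := hψ.1.dist_le_mul (x + y) x
          rw [NNReal.coe_one, one_mul, dist_self_add_left, Real.dist_eq] at h3
          exact h3.trans (le_of_lt (mem_ball_zero_iff.1 hy)))
      simpa using h2
    have hI1 : Integrable (fun x => ∫ y, ψ (x + y) ∂ν) m.meas := by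
      refine Integrable.of_bound ?_ (D + r) (Eventually.of_forall fun x => ?_)
      · exact (StronglyMeasurable.integral_prod_right (f := fun x y => ψ (x + y))
          (hψm.comp measurable_add).stronglyMeasurable).aestronglyMeasurable
      · have h1 := hbd x
        have h2 := hb ψ hψ x
        rw [Real.norm_eq_abs]
        have h3 := abs_le.1 h1
        have h4 := abs_le.1 h2
        exact abs_le.2 ⟨by linarith [h3.1, h4.1], by linarith [h3.2, h4.2]⟩
    rw [← integral_sub hI1 (m.integrable_of_bound hψm.aestronglyMeasurable (hb ψ hψ))]
    have h2 := norm_integral_le_of_norm_le_const (μ := m.meas)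
      (f := fun x => ∫ y, ψ (x + y) ∂ν - ψ x) (C := r) (Eventually.of_forall hbd)
    refine (le_abs_self _).trans (h2.trans ?_)
    have h3 := m.measureReal_univ_le
    nlinarith

/-! ### Compactly supported smooth functions and a compactness estimate -/

lemma norm_gradient_eq (f : EuclideanSpace ℝ (Fin d) → ℝ) (x : EuclideanSpace ℝ (Fin d)) :
    ‖∇ f x‖ = ‖fderiv ℝ f x‖ := by
  rw [← toDual_gradient, LinearIsometryEquiv.norm_map]

lemma IsCcOn.eq_zero {k : ℕ∞} {w : EuclideanSpace ℝ (Fin d) → ℝ} (hw : IsCcOn k Ω w)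
    {x : EuclideanSpace ℝ (Fin d)} (hx : x ∉ Ω) : w x = 0 :=
  image_eq_zero_of_notMem_tsupport fun h => hx (hw.2.2 h)

lemma IsCcOn.continuous {k : ℕ∞} {w : EuclideanSpace ℝ (Fin d) → ℝ} (hw : IsCcOn k Ω w) :
    Continuous w := hw.1.continuous

lemma IsCcOn.differentiable {w : EuclideanSpace ℝ (Fin d) → ℝ} (hw : IsCcOn ⊤ Ω w) :
    Differentiable ℝ w := hw.1.differentiable (by simp)

lemma IsCcOn.continuous_fderiv {w : EuclideanSpace ℝ (Fin d) → ℝ} (hw : IsCcOn ⊤ Ω w) :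
    Continuous (fderiv ℝ w) := hw.1.continuous_fderiv (by simp)

lemma IsCcOn.continuous_gradient {w : EuclideanSpace ℝ (Fin d) → ℝ} (hw : IsCcOn ⊤ Ω w) :
    Continuous (∇ w) :=
  (InnerProductSpace.toDual ℝ (EuclideanSpace ℝ (Fin d))).symm.continuous.comp hw.continuous_fderiv

lemma IsCcOn.hasCompactSupport_gradient {w : EuclideanSpace ℝ (Fin d) → ℝ}
    (hw : IsCcOn ⊤ Ω w) : HasCompactSupport (∇ w) :=
  (hw.2.1.fderiv ℝ).comp_left (map_zero _)

lemma IsCcOn.gradient_eq_zero {w : EuclideanSpace ℝ (Fin d) → ℝ}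
    (hw : IsCcOn ⊤ Ω w) {x : EuclideanSpace ℝ (Fin d)} (hx : x ∉ Ω) : ∇ w x = 0 := by
  have h : fderiv ℝ w x = 0 :=
    image_eq_zero_of_notMem_tsupport fun h => hx (hw.2.2 (tsupport_fderiv_subset ℝ h))
  rw [gradient, h, map_zero]

lemma IsCcOn.memLp {w : EuclideanSpace ℝ (Fin d) → ℝ} (hw : IsCcOn ⊤ Ω w)
    (p : ℝ≥0∞) (μ : Measure (EuclideanSpace ℝ (Fin d))) [IsFiniteMeasureOnCompacts μ] :
    MemLp w p μ := hw.continuous.memLp_of_hasCompactSupport hw.2.1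

lemma IsCcOn.memLp_gradient {w : EuclideanSpace ℝ (Fin d) → ℝ} (hw : IsCcOn ⊤ Ω w)
    (p : ℝ≥0∞) (μ : Measure (EuclideanSpace ℝ (Fin d))) [IsFiniteMeasureOnCompacts μ] :
    MemLp (∇ w) p μ :=
  hw.continuous_gradient.memLp_of_hasCompactSupport hw.hasCompactSupport_gradient

lemma IsCcOn.lipschitz {w : EuclideanSpace ℝ (Fin d) → ℝ} (hw : IsCcOn ⊤ Ω w) :
    ∃ K : ℝ≥0, LipschitzWith K w := hw.1.lipschitzWith_of_hasCompactSupport hw.2.1 (by simp)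

/-- The `L²` modulus of continuity of translations. -/
lemma integral_sq_translate_sub_le {w : EuclideanSpace ℝ (Fin d) → ℝ} (hw : IsCcOn ⊤ Ω w)
    (z : EuclideanSpace ℝ (Fin d)) :
    ∫ x, (w (x + z) - w x) ^ 2 ≤ ‖z‖ ^ 2 * ∫ x, ‖∇ w x‖ ^ 2 := by
  have hc := hw.continuous_gradient
  have hpt : ∀ x, (w (x + z) - w x) ^ 2 ≤ ∫ s in Ioc (0 : ℝ) 1, ‖z‖ ^ 2 * ‖∇ w (x + s • z)‖ ^ 2 := by
    intro x
    have hder : ∀ s : ℝ, HasDerivAt (fun s : ℝ => w (x + s • z)) (inner ℝ (∇ w (x + s • z)) z) s := by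
      intro s
      rw [inner_gradient_left]
      have h1 : HasDerivAt (fun s : ℝ => x + s • z) z s := by
        simpa using ((hasDerivAt_id s).smul_const z).const_add x
      exact (hw.differentiable _).hasFDerivAt.comp_hasDerivAt s h1
    have hcont : Continuous fun s : ℝ => inner ℝ (∇ w (x + s • z)) z :=
      (hc.comp (by fun_prop)).inner continuous_const
    have hftc := intervalIntegral.integral_eq_sub_of_hasDerivAt (a := 0) (b := 1)
      (fun s _ => hder s) (hcont.intervalIntegrable 0 1)
    rw [one_smul, zero_smul, add_zero, intervalIntegral.integral_of_le zero_le_one] at hftc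
    rw [← hftc]
    have hb : ∀ f : ℝ → ℝ, Continuous f → Integrable f (volume.restrict (Ioc (0 : ℝ) 1)) :=
      fun f hf => hf.integrableOn_Ioc
    have hm : MemLp (fun s : ℝ => inner ℝ (∇ w (x + s • z)) z) 2 (volume.restrict (Ioc 0 1)) :=
      (memLp_two_iff_integrable_sq hcont.aestronglyMeasurable).2 (hb _ (hcont.pow 2))
    have hcs := abs_integral_mul_le (memLp_const (1 : ℝ)) hm
    simp only [one_mul, one_pow, integral_const, smul_eq_mul, mul_one, measureReal_restrict_apply_univ,
      Real.volume_real_Ioc, sub_zero, zero_le_one, max_eq_left, Real.sqrt_one] at hcs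
    have h2 : (∫ s in Ioc (0 : ℝ) 1, inner ℝ (∇ w (x + s • z)) z) ^ 2
        ≤ ∫ s in Ioc (0 : ℝ) 1, (inner ℝ (∇ w (x + s • z)) z) ^ 2 := by
      rw [← sq_abs]
      refine (pow_le_pow_left₀ (abs_nonneg _) hcs 2).trans (le_of_eq ?_)
      exact Real.sq_sqrt (integral_nonneg fun _ => sq_nonneg _)
    refine h2.trans (integral_mono (hb _ (hcont.pow 2)) (hb _ ?_) fun s => ?_)
    · exact continuous_const.mul ((hc.comp (by fun_prop)).norm.pow 2)
    · show (inner ℝ (∇ w (x + s • z)) z) ^ 2 ≤ ‖z‖ ^ 2 * ‖∇ w (x + s • z)‖ ^ 2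
      rw [← sq_abs, ← mul_pow, mul_comm]
      exact pow_le_pow_left₀ (abs_nonneg _) (abs_real_inner_le_norm _ _) 2
  have hgi : Integrable (fun x => ‖∇ w x‖ ^ 2) volume :=
    (hw.memLp_gradient 2 volume).integrable_norm_pow (by norm_num)
  have hlin : ∫⁻ x, ENNReal.ofReal ((w (x + z) - w x) ^ 2)
      ≤ ENNReal.ofReal (‖z‖ ^ 2 * ∫ x, ‖∇ w x‖ ^ 2) := by
    calc ∫⁻ x, ENNReal.ofReal ((w (x + z) - w x) ^ 2)
        ≤ ∫⁻ x, ∫⁻ s in Ioc (0 : ℝ) 1, ENNReal.ofReal (‖z‖ ^ 2 * ‖∇ w (x + s • z)‖ ^ 2) := by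
          refine lintegral_mono fun x => (ENNReal.ofReal_le_ofReal (hpt x)).trans (le_of_eq ?_)
          refine ofReal_integral_eq_lintegral_ofReal ?_
            (Eventually.of_forall fun s => by positivity)
          have : Continuous fun s : ℝ => ‖z‖ ^ 2 * ‖∇ w (x + s • z)‖ ^ 2 :=
            continuous_const.mul ((hc.comp (by fun_prop)).norm.pow 2)
          exact this.integrableOn_Ioc
      _ = ∫⁻ s in Ioc (0 : ℝ) 1, ∫⁻ x, ENNReal.ofReal (‖z‖ ^ 2 * ‖∇ w (x + s • z)‖ ^ 2) := by
          refine lintegral_lintegral_swap ?_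
          refine (Continuous.measurable ?_).ennreal_ofReal.aemeasurable
          exact continuous_const.mul ((hc.comp (by fun_prop)).norm.pow 2)
      _ = ∫⁻ s in Ioc (0 : ℝ) 1, ENNReal.ofReal (‖z‖ ^ 2 * ∫ x, ‖∇ w x‖ ^ 2) := by
          refine lintegral_congr fun s => ?_
          rw [lintegral_add_right_eq_self
            (fun x => ENNReal.ofReal (‖z‖ ^ 2 * ‖∇ w x‖ ^ 2)) (s • z), ← integral_const_mul,
            ofReal_integral_eq_lintegral_ofReal (hgi.const_mul _)
              (Eventually.of_forall fun s => by positivity)]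
      _ = _ := by simp
  have hm : AEStronglyMeasurable (fun x => (w (x + z) - w x) ^ 2) volume :=
    (((hw.continuous.comp (continuous_add_const z)).sub hw.continuous).pow 2).aestronglyMeasurable
  rw [integral_eq_lintegral_of_nonneg_ae (Eventually.of_forall fun x => sq_nonneg _) hm]
  exact ENNReal.toReal_le_of_le_ofReal (by positivity) hlin

lemma abs_integral_mul_sub_translate_le {w : EuclideanSpace ℝ (Fin d) → ℝ} (hw : IsCcOn ⊤ Ω w)
    (z : EuclideanSpace ℝ (Fin d)) :
    |∫ x, w x * (w x - w (x + z))| ≤ ‖z‖ * (√(∫ x, w x ^ 2) * √(∫ x, ‖∇ w x‖ ^ 2)) := by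
  have hwt : MemLp (fun x => w (x + z)) 2 volume :=
    (hw.memLp 2 volume).comp_measurePreserving (measurePreserving_add_right volume z)
  have h1 := abs_integral_mul_le (hw.memLp 2 volume) ((hw.memLp 2 volume).sub hwt)
  have h2 := Real.sqrt_le_sqrt (integral_sq_translate_sub_le hw z)
  rw [Real.sqrt_mul (by positivity), Real.sqrt_sq (norm_nonneg z)] at h2
  have h3 : ∫ x, (w x - w (x + z)) ^ 2 = ∫ x, (w (x + z) - w x) ^ 2 :=
    integral_congr_ae (Eventually.of_forall fun x => by show _ = _; ring)
  simp only [Pi.sub_apply] at h1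
  rw [h3] at h1
  refine h1.trans ((mul_le_mul_of_nonneg_left h2 (Real.sqrt_nonneg _)).trans (le_of_eq ?_))
  ring

lemma integral_mul_self_sub_integral_mul_mollify {w ρ : EuclideanSpace ℝ (Fin d) → ℝ}
    (hw : IsCcOn ⊤ Ω w) (hρc : Continuous ρ) (hρs : HasCompactSupport ρ) (hone : ∫ z, ρ z = 1) :
    (∫ x, w x * w x) - ∫ x, w x * (∫ z, w z * ρ (z - x))
      = ∫ z, ρ z * ∫ x, w x * (w x - w (x + z)) := by
  have hρi : Integrable ρ volume := hρc.integrable_of_hasCompactSupport hρs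
  set v : EuclideanSpace ℝ (Fin d) → ℝ := fun x => ∫ z, w z * ρ (z - x) with hvdef
  have hcs : HasCompactSupport (Function.uncurry fun x z : EuclideanSpace ℝ (Fin d) =>
      ρ z * (w x * (w x - w (x + z)))) := by
    refine HasCompactSupport.intro (hw.2.1.isCompact.prod hρs.isCompact) ?_
    rintro ⟨x, z⟩ hxz
    simp only [mem_prod, not_and_or] at hxz
    rcases hxz with h | h
    · simp [image_eq_zero_of_notMem_tsupport h]
    · simp [image_eq_zero_of_notMem_tsupport h]
  have hcont : Continuous (Function.uncurry fun x z : EuclideanSpace ℝ (Fin d) =>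
      ρ z * (w x * (w x - w (x + z)))) := by
    have := hw.continuous
    simp only [Function.uncurry_def]
    fun_prop
  have hsw := integral_integral_swap_of_hasCompactSupport hcont hcs (μ := volume) (ν := volume)
  simp only [integral_const_mul] at hsw
  rw [← hsw, ← integral_sub]
  · refine integral_congr_ae (Eventually.of_forall fun x => ?_)
    show w x * w x - w x * v x = _
    have hv : v x = ∫ z, w (x + z) * ρ z := by
      show ∫ z, w z * ρ (z - x) = _
      rw [← integral_add_left_eq_self (fun z => w z * ρ (z - x)) x]
      simp
    have hi1 : Integrable (fun z => w (x + z) * ρ z) volume :=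
      ((hw.continuous.comp (continuous_const_add x)).mul hρc).integrable_of_hasCompactSupport
        hρs.mul_left
    calc w x * w x - w x * v x = w x * (w x * (∫ z, ρ z) - ∫ z, w (x + z) * ρ z) := by
          rw [hone, hv]; ring
      _ = w x * ∫ z, (w x * ρ z - w (x + z) * ρ z) := by
          rw [integral_sub (hρi.const_mul _) hi1, integral_const_mul]
      _ = _ := by
          rw [← integral_const_mul]
          exact integral_congr_ae (Eventually.of_forall fun z => by show _ = _; ring)
  · exact (hw.continuous.mul hw.continuous).integrable_of_hasCompactSupport hw.2.1.mul_right
  · have hvc : Continuous v := by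
      have hv : v = fun x => ∫ z, w z * ρ (z - x) := rfl
      rw [hv]
      refine continuous_parametric_integral_of_continuous
        (f := fun x z => w z * ρ (z - x)) (μ := volume) ?_ hw.2.1.isCompact |>.congr fun x => ?_
      · have := hw.continuous
        simp only [Function.uncurry_def]
        fun_prop
      · exact setIntegral_eq_integral_of_forall_compl_eq_zero fun z hz => by
          rw [image_eq_zero_of_notMem_tsupport hz, zero_mul]
    exact (hw.continuous.mul hvc).integrable_of_hasCompactSupport hw.2.1.mul_right

/-- Compactness of the embedding of `H₀¹` into `L²`, in quantitative form. -/
theorem exists_finite_family_l2_le (hΩ : IsSmoothBoundedDomain Ω) {h : ℝ} (hh : 0 < h) :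
    ∃ (N : ℕ) (ℓ : Fin N → EuclideanSpace ℝ (Fin d) → ℝ) (c : ℝ), 0 ≤ c ∧
      (∀ j, MemLp (ℓ j) 2 (volume.restrict Ω)) ∧
      ∀ w, IsCcOn ⊤ Ω w →
        √(∫ x in Ω, w x ^ 2) ≤ h * (√(∫ x in Ω, w x ^ 2) + √(∫ x in Ω, ‖∇ w x‖ ^ 2))
          + c * ∑ j, |∫ x in Ω, w x * ℓ j x| := by
  have := hΩ.isFiniteMeasure
  let b : ContDiffBump (0 : EuclideanSpace ℝ (Fin d)) := ⟨h / 2, h, by linarith, by linarith⟩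
  set ρ : EuclideanSpace ℝ (Fin d) → ℝ := b.normed volume with hρ
  have hρc : Continuous ρ := b.continuous_normed
  have hρs : HasCompactSupport ρ := b.hasCompactSupport_normed
  have hρd : ContDiff ℝ ∞ ρ := b.contDiff_normed
  obtain ⟨K, hK⟩ := hρd.lipschitzWith_of_hasCompactSupport hρs (by simp)
  set A := √((volume.restrict Ω).real univ) with hA
  have hA0 : 0 ≤ A := Real.sqrt_nonneg _
  obtain ⟨κ, hκ, hκA⟩ : ∃ κ : ℝ, 0 < κ ∧ A * (K * κ * A) ≤ h := by
    refine ⟨h / (A * A * K + 1), by positivity, ?_⟩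
    rw [show A * (K * (h / (A * A * K + 1)) * A) = h * ((A * A * K) / (A * A * K + 1)) by ring]
    refine mul_le_of_le_one_right hh.le ?_
    rw [div_le_one (by positivity)]; linarith
  have htb : TotallyBounded Ω := hΩ.isBounded.isCompact_closure.totallyBounded.subset subset_closure
  obtain ⟨t, htf, ht⟩ := Metric.totallyBounded_iff.1 htb κ hκ
  obtain ⟨N, y, hy⟩ : ∃ (N : ℕ) (y : Fin N → EuclideanSpace ℝ (Fin d)), range y = t := by
    have := htf.fintype
    refine ⟨Fintype.card t, fun i => ((Fintype.equivFin t).symm i : EuclideanSpace ℝ (Fin d)), ?_⟩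
    ext x
    constructor
    · rintro ⟨i, rfl⟩; exact ((Fintype.equivFin t).symm i).2
    · intro hx; exact ⟨Fintype.equivFin t ⟨x, hx⟩, by simp⟩
  have hℓc : ∀ x, Continuous fun z => ρ (z - x) := fun x => hρc.comp (continuous_sub_right x)
  refine ⟨N, fun j z => ρ (z - y j), A, hA0, fun j => ?_, fun w hw => ?_⟩
  · obtain ⟨B, hB⟩ := hρc.bounded_above_of_compact_support hρs
    exact MemLp.of_bound (hℓc _).aestronglyMeasurable B (Eventually.of_forall fun z => hB _)
  have hwi : ∀ f : EuclideanSpace ℝ (Fin d) → ℝ, ∫ x in Ω, w x * f x = ∫ x, w x * f x := fun f =>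
    setIntegral_eq_integral_of_forall_compl_eq_zero fun x hx => by rw [hw.eq_zero hx, zero_mul]
  have hw2 : ∫ x in Ω, w x ^ 2 = ∫ x, w x ^ 2 :=
    setIntegral_eq_integral_of_forall_compl_eq_zero fun x hx => by rw [hw.eq_zero hx]; simp
  have hg2 : ∫ x in Ω, ‖∇ w x‖ ^ 2 = ∫ x, ‖∇ w x‖ ^ 2 :=
    setIntegral_eq_integral_of_forall_compl_eq_zero fun x hx => by
      rw [hw.gradient_eq_zero hx]; simp
  set n := √(∫ x in Ω, w x ^ 2) with hn
  set g := √(∫ x in Ω, ‖∇ w x‖ ^ 2) with hg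
  have hn0 : 0 ≤ n := Real.sqrt_nonneg _
  have hg0 : 0 ≤ g := Real.sqrt_nonneg _
  -- the mollified function and its values
  let v : EuclideanSpace ℝ (Fin d) → ℝ := fun x => ∫ z, w z * ρ (z - x)
  set S := ∑ j, |∫ x in Ω, w x * ρ (x - y j)| with hS
  have hL1 : ∫ x in Ω, |w x| ≤ A * n := by
    have h2 := abs_integral_mul_le (μ := volume.restrict Ω) (f := fun _ => (1 : ℝ))
      (g := fun x => |w x|) (memLp_const 1) (hw.memLp 2 _).abs
    simp only [one_mul, one_pow, integral_const, smul_eq_mul, mul_one, sq_abs] at h2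
    exact (le_abs_self _).trans h2
  have hwint : ∀ f : EuclideanSpace ℝ (Fin d) → ℝ, Continuous f →
      Integrable (fun x => w x * f x) (volume.restrict Ω) := fun f hf =>
    ((hw.continuous.mul hf).integrable_of_hasCompactSupport hw.2.1.mul_right).restrict
  have hvb : ∀ x ∈ Ω, |v x| ≤ S + K * κ * (A * n) := by
    intro x hx
    obtain ⟨y', hy', hxy⟩ := mem_iUnion₂.1 (ht hx)
    obtain ⟨j, rfl⟩ : y' ∈ range y := hy ▸ hy'
    have e1 : v x = (∫ z in Ω, w z * ρ (z - y j)) + ∫ z in Ω, w z * (ρ (z - x) - ρ (z - y j)) := by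
      have hi := hwint (fun z => ρ (z - x) - ρ (z - y j)) ((hℓc _).sub (hℓc _))
      rw [← integral_add (hwint _ (hℓc _)) hi, show v x = ∫ z in Ω, w z * ρ (z - x) from (hwi _).symm]
      exact integral_congr_ae (Eventually.of_forall fun z => by show _ = _; ring)
    rw [e1]
    refine (abs_add_le _ _).trans (add_le_add ?_ ?_)
    · exact Finset.single_le_sum (f := fun j => |∫ x in Ω, w x * ρ (x - y j)|)
        (fun i _ => abs_nonneg _) (Finset.mem_univ j)
    · calc |∫ z in Ω, w z * (ρ (z - x) - ρ (z - y j))|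
          ≤ ∫ z in Ω, |w z * (ρ (z - x) - ρ (z - y j))| := abs_integral_le_integral_abs
        _ ≤ ∫ z in Ω, |w z| * (K * κ) := by
            refine integral_mono (hwint _ ((hℓc _).sub (hℓc _))).abs
              ((memLp_one_iff_integrable.1 (hw.memLp 1 _)).abs.mul_const _) fun z => ?_
            show |w z * (ρ (z - x) - ρ (z - y j))| ≤ |w z| * (K * κ)
            rw [abs_mul]
            have h1 := hK.dist_le_mul (z - x) (z - y j)
            rw [Real.dist_eq, dist_sub_left] at h1
            have h2 : dist x (y j) ≤ κ := le_of_lt hxy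
            gcongr
            exact h1.trans (by gcongr)
        _ ≤ K * κ * (A * n) := by
            rw [integral_mul_const, mul_comm]
            gcongr
  have hFub := integral_mul_self_sub_integral_mul_mollify hw hρc hρs b.integral_normed
  change (∫ x, w x * w x) - ∫ x, w x * v x = _ at hFub
  have hFb : |(∫ x, w x * w x) - ∫ x, w x * v x| ≤ h * (n * g) := by
    rw [hFub]
    have hρ0 : ∀ z, 0 ≤ ρ z := b.nonneg_normed
    calc |∫ z, ρ z * ∫ x, w x * (w x - w (x + z))|
        ≤ ∫ z, ρ z * (h * (n * g)) := by
          rw [← Real.norm_eq_abs]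
          refine norm_integral_le_of_norm_le (b.integrable_normed.mul_const _)
            (Eventually.of_forall fun z => ?_)
          rw [norm_mul, Real.norm_eq_abs, Real.norm_eq_abs, abs_of_nonneg (hρ0 z)]
          by_cases hz : ρ z = 0
          · rw [hz, zero_mul, zero_mul]
          · have hz' : z ∈ Function.support ρ := hz
            rw [hρ, b.support_normed_eq, mem_ball_zero_iff] at hz'
            refine mul_le_mul_of_nonneg_left ?_ (hρ0 z)
            have h1 := abs_integral_mul_sub_translate_le hw z
            rw [← hw2, ← hg2] at h1
            exact h1.trans (mul_le_mul_of_nonneg_right (le_of_lt hz') (by positivity))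
      _ = h * (n * g) := by
          rw [integral_mul_const, b.integral_normed, one_mul]
  have hwv : |∫ x, w x * v x| ≤ (A * n) * (S + K * κ * (A * n)) := by
    rw [← hwi]
    calc |∫ x in Ω, w x * v x| ≤ ∫ x in Ω, |w x| * (S + K * κ * (A * n)) := by
          rw [← Real.norm_eq_abs]
          refine norm_integral_le_of_norm_le
            ((memLp_one_iff_integrable.1 (hw.memLp 1 _)).abs.mul_const _) ?_
          filter_upwards [ae_restrict_mem hΩ.isOpen.measurableSet] with x hx
          rw [norm_mul, Real.norm_eq_abs, Real.norm_eq_abs]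
          exact mul_le_mul_of_nonneg_left (hvb x hx) (abs_nonneg _)
      _ ≤ (A * n) * (S + K * κ * (A * n)) := by
          rw [integral_mul_const]
          refine mul_le_mul_of_nonneg_right hL1 ?_
          have : 0 ≤ S := Finset.sum_nonneg fun j _ => abs_nonneg _
          positivity
  have hnn : ∫ x, w x * w x = n * n := by
    rw [hn, Real.mul_self_sqrt (integral_nonneg fun _ => sq_nonneg _), hw2]
    exact integral_congr_ae (Eventually.of_forall fun x => by show _ = _; ring)
  rw [hnn] at hFb
  have h1 := (abs_le.1 hFb).2
  have h2 := (abs_le.1 hwv).2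
  have h3 : n * n ≤ n * (h * (n + g) + A * S) := by
    nlinarith [mul_le_mul_of_nonneg_right hκA (mul_nonneg hn0 hn0)]
  rcases hn0.eq_or_lt with h0 | h0
  · rw [← h0]
    have : 0 ≤ S := Finset.sum_nonneg fun j _ => abs_nonneg _
    positivity
  · exact le_of_mul_le_mul_left h3 h0

/-! ### Galerkin subspaces of `H₀¹` -/

/-- The Hilbert space `L²(Ω) × L²(Ω; ℝ^d)`, in which `H₀¹(Ω)` is a closed subspace. -/
abbrev L2Pair (Ω : Set (EuclideanSpace ℝ (Fin d))) : Type :=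
  WithLp 2 (Lp ℝ 2 (volume.restrict Ω) × Lp (EuclideanSpace ℝ (Fin d)) 2 (volume.restrict Ω))

/-- The element of `L2Pair Ω` given by two square-integrable functions. -/
noncomputable def toPair {u : EuclideanSpace ℝ (Fin d) → ℝ}
    {g : EuclideanSpace ℝ (Fin d) → EuclideanSpace ℝ (Fin d)}
    (hu : MemLp u 2 (volume.restrict Ω)) (hg : MemLp g 2 (volume.restrict Ω)) : L2Pair Ω :=
  WithLp.toLp 2 (hu.toLp u, hg.toLp g)

section toPair

variable {u v : EuclideanSpace ℝ (Fin d) → ℝ}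
  {g k : EuclideanSpace ℝ (Fin d) → EuclideanSpace ℝ (Fin d)}
  (hu : MemLp u 2 (volume.restrict Ω)) (hg : MemLp g 2 (volume.restrict Ω))
  (hv : MemLp v 2 (volume.restrict Ω)) (hk : MemLp k 2 (volume.restrict Ω))

lemma inner_toPair : inner ℝ (toPair hu hg) (toPair hv hk)
    = (∫ x in Ω, u x * v x) + ∫ x in Ω, inner ℝ (g x) (k x) := by
  rw [WithLp.prod_inner_apply]
  simp only [toPair]
  rw [L2.inner_def, L2.inner_def]
  congr 1
  · refine integral_congr_ae ?_
    filter_upwards [hu.coeFn_toLp, hv.coeFn_toLp] with x h1 h2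
    rw [h1, h2]; simp [mul_comm]
  · refine integral_congr_ae ?_
    filter_upwards [hg.coeFn_toLp, hk.coeFn_toLp] with x h1 h2
    rw [h1, h2]

lemma norm_sq_toPair : ‖toPair hu hg‖ ^ 2
    = (∫ x in Ω, u x ^ 2) + ∫ x in Ω, ‖g x‖ ^ 2 := by
  rw [← real_inner_self_eq_norm_sq, inner_toPair]
  simp only [real_inner_self_eq_norm_sq, ← pow_two]

lemma norm_fst_toPair : ‖(toPair hu hg).fst‖ = √(∫ x in Ω, u x ^ 2) := by
  have := toReal_eLpNorm_two hu
  simp only [Real.norm_eq_abs, sq_abs] at this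
  rw [← this]
  simp [toPair]

lemma norm_snd_toPair : ‖(toPair hu hg).snd‖ = √(∫ x in Ω, ‖g x‖ ^ 2) := by
  rw [← toReal_eLpNorm_two hg]
  simp [toPair]

lemma toPair_congr (h1 : u = v) (h2 : g = k) : toPair hu hg = toPair hv hk := by
  subst h1 h2; rfl

lemma toPair_add : toPair hu hg + toPair hv hk = toPair (hu.add hv) (hg.add hk) := rfl

lemma toPair_smul (c : ℝ) : c • toPair hu hg = toPair (hu.const_smul c) (hg.const_smul c) := rfl

lemma toPair_sub : toPair hu hg - toPair hv hk = toPair (hu.sub hv) (hg.sub hk) := rfl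

end toPair

lemma sum_smul_toPair {ι : Type*} (s : Finset ι) (a : ι → ℝ)
    {u : ι → EuclideanSpace ℝ (Fin d) → ℝ}
    {g : ι → EuclideanSpace ℝ (Fin d) → EuclideanSpace ℝ (Fin d)}
    (hu : ∀ i, MemLp (u i) 2 (volume.restrict Ω)) (hg : ∀ i, MemLp (g i) 2 (volume.restrict Ω))
    (hsu : MemLp (fun x => ∑ i ∈ s, a i * u i x) 2 (volume.restrict Ω))
    (hsg : MemLp (fun x => ∑ i ∈ s, a i • g i x) 2 (volume.restrict Ω)) :
    ∑ i ∈ s, a i • toPair (hu i) (hg i) = toPair hsu hsg := by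
  classical
  induction s using Finset.induction_on with
  | empty =>
    rw [Finset.sum_empty]
    have h0 : ∀ (hu0 : MemLp (0 : EuclideanSpace ℝ (Fin d) → ℝ) 2 (volume.restrict Ω))
      (hg0 : MemLp (0 : EuclideanSpace ℝ (Fin d) → EuclideanSpace ℝ (Fin d)) 2
        (volume.restrict Ω)), (0 : L2Pair Ω) = toPair hu0 hg0 := fun _ _ => rfl
    rw [h0 MemLp.zero MemLp.zero]
    exact toPair_congr _ _ _ _ (by ext x; simp) (by ext x : 1; simp)
  | insert i s hi ih =>
    have h1 : MemLp (fun x => ∑ i ∈ s, a i * u i x) 2 (volume.restrict Ω) :=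
      memLp_finsetSum s fun i _ => (hu i).const_mul (a i)
    have h2 : MemLp (fun x => ∑ i ∈ s, a i • g i x) 2 (volume.restrict Ω) :=
      memLp_finsetSum s fun i _ => (hg i).const_smul (a i)
    rw [Finset.sum_insert hi, ih h1 h2, toPair_smul, toPair_add]
    exact toPair_congr _ _ _ _ (by ext x; simp [Finset.sum_insert hi])
      (by ext x : 1; simp [Finset.sum_insert hi])

lemma gradient_add_of_differentiable {f g : EuclideanSpace ℝ (Fin d) → ℝ}
    (hf : Differentiable ℝ f) (hg : Differentiable ℝ g) : ∇ (f + g) = ∇ f + ∇ g := by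
  ext x : 1
  simp only [gradient, Pi.add_apply]
  rw [fderiv_add (hf x) (hg x), map_add]

lemma gradient_const_smul_of_differentiable {f : EuclideanSpace ℝ (Fin d) → ℝ}
    (hf : Differentiable ℝ f) (c : ℝ) : ∇ (c • f) = c • ∇ f := by
  ext x : 1
  simp only [gradient, Pi.smul_apply]
  rw [fderiv_const_smul (hf x) c, map_smul]

lemma isCcOn_zero {X : Type*} [NormedAddCommGroup X] [NormedSpace ℝ X] {k : ℕ∞} {S : Set X} :
    IsCcOn k S (0 : X → ℝ) :=
  ⟨contDiff_const, HasCompactSupport.zero, by simp [tsupport]⟩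

lemma IsCcOn.add {X : Type*} [NormedAddCommGroup X] [NormedSpace ℝ X] {k : ℕ∞} {S : Set X}
    {f g : X → ℝ} (hf : IsCcOn k S f) (hg : IsCcOn k S g) : IsCcOn k S (f + g) :=
  ⟨hf.1.add hg.1, hf.2.1.add hg.2.1, (tsupport_add f g).trans (union_subset hf.2.2 hg.2.2)⟩

lemma IsCcOn.const_smul {X : Type*} [NormedAddCommGroup X] [NormedSpace ℝ X] {k : ℕ∞} {S : Set X}
    {f : X → ℝ} (hf : IsCcOn k S f) (c : ℝ) : IsCcOn k S (c • f) :=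
  ⟨hf.1.const_smul c, hf.2.1.smul_left (f := fun _ => c),
    (closure_mono (Function.support_const_smul_subset c f)).trans hf.2.2⟩

/-- The pairs `(φ, ∇φ)` with `φ` smooth and compactly supported in `Ω`. -/
noncomputable def ccPairs (Ω : Set (EuclideanSpace ℝ (Fin d))) : Submodule ℝ (L2Pair Ω) where
  carrier := {v | ∃ (φ : EuclideanSpace ℝ (Fin d) → ℝ) (h : IsCcOn ⊤ Ω φ),
    v = toPair (h.memLp 2 _) (h.memLp_gradient 2 _)}
  add_mem' := by
    rintro _ _ ⟨φ, hφ, rfl⟩ ⟨ψ, hψ, rfl⟩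
    refine ⟨φ + ψ, hφ.add hψ, ?_⟩
    rw [toPair_add]
    exact toPair_congr _ _ _ _ rfl
      (gradient_add_of_differentiable hφ.differentiable hψ.differentiable).symm
  zero_mem' := by
    refine ⟨0, isCcOn_zero, ?_⟩
    have h0 : (0 : L2Pair Ω) = toPair (MemLp.zero (p := 2)) (MemLp.zero (p := 2)) := rfl
    rw [h0]
    refine toPair_congr _ _ _ _ rfl ?_
    ext x : 1
    simp [gradient]
  smul_mem' := by
    rintro c _ ⟨φ, hφ, rfl⟩
    refine ⟨c • φ, hφ.const_smul c, ?_⟩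
    rw [toPair_smul]
    exact toPair_congr _ _ _ _ rfl (gradient_const_smul_of_differentiable hφ.differentiable c).symm

lemma toPair_mem_closure {u : EuclideanSpace ℝ (Fin d) → ℝ}
    {g : EuclideanSpace ℝ (Fin d) → EuclideanSpace ℝ (Fin d)} (h : IsH01 Ω u g) :
    toPair h.1 h.2.1 ∈ (ccPairs Ω).topologicalClosure := by
  obtain ⟨hu, hg, φ, hφ, h1, h2⟩ := h
  have t1 := (Lp.tendsto_Lp_iff_tendsto_eLpNorm'' φ (fun n => (hφ n).memLp 2 _) u hu).2 h1
  have t2 := (Lp.tendsto_Lp_iff_tendsto_eLpNorm'' (fun n => ∇ (φ n))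
    (fun n => (hφ n).memLp_gradient 2 _) g hg).2 h2
  have t3 : Tendsto (fun n => toPair ((hφ n).memLp 2 (volume.restrict Ω))
      ((hφ n).memLp_gradient 2 _)) atTop (𝓝 (toPair hu hg)) :=
    ((WithLp.prod_continuous_toLp 2 _ _).tendsto _).comp (t1.prodMk_nhds t2)
  exact mem_closure_of_tendsto t3 (Eventually.of_forall fun n => ⟨φ n, hφ n, rfl⟩)

lemma exists_finiteDimensional_projection_close (hΩ : IsSmoothBoundedDomain Ω) {η : ℝ}
    (hη : 0 < η) : ∃ U : Submodule ℝ (L2Pair Ω), ∃ _ : FiniteDimensional ℝ U, U ≤ ccPairs Ω ∧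
      ∀ x ∈ (ccPairs Ω).topologicalClosure, ‖(x - U.starProjection x).fst‖ ≤ η * ‖x‖ := by
  obtain ⟨N, ℓ, c, hc, hℓ, hE⟩ := exists_finite_family_l2_le hΩ (h := η / 4) (by positivity)
  set K := (ccPairs Ω).topologicalClosure with hK
  let L : Fin N → L2Pair Ω := fun j => toPair (hℓ j)
    (MemLp.zero : MemLp (0 : EuclideanSpace ℝ (Fin d) → EuclideanSpace ℝ (Fin d)) 2
      (volume.restrict Ω))
  have hfst : ∀ v : L2Pair Ω, ‖v.fst‖ ≤ ‖v‖ := WithLp.norm_fst_le _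
  have hsnd : ∀ v : L2Pair Ω, ‖v.snd‖ ≤ ‖v‖ := WithLp.norm_snd_le _
  have hEK : ∀ v ∈ K, ‖v.fst‖ ≤ η / 2 * ‖v‖ + c * ∑ j, |inner ℝ v (L j)| := by
    have hcl : IsClosed {v : L2Pair Ω | ‖v.fst‖ ≤ η / 2 * ‖v‖ + c * ∑ j, |inner ℝ v (L j)|} := by
      refine isClosed_le ?_ ?_
      · exact (WithLp.prod_continuous_ofLp 2 _ _).fst.norm
      · fun_prop
    refine fun v hv => closure_minimal ?_ hcl hv
    rintro _ ⟨φ, hφ, rfl⟩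
    have h1 := hE φ hφ
    rw [mem_ofPred_eq]
    set v := toPair (hφ.memLp 2 (volume.restrict Ω)) (hφ.memLp_gradient 2 (volume.restrict Ω))
    have h2 : ∀ j, inner ℝ v (L j) = ∫ x in Ω, φ x * ℓ j x := by
      intro j
      rw [inner_toPair]
      simp
    simp only [h2]
    rw [← norm_fst_toPair (hφ.memLp 2 (volume.restrict Ω)) (hφ.memLp_gradient 2 _),
      ← norm_snd_toPair (hφ.memLp 2 (volume.restrict Ω)) (hφ.memLp_gradient 2 _)] at h1
    refine h1.trans ?_
    have h3 := hfst v
    have h4 := hsnd v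
    have h5 : η / 4 * (‖v.fst‖ + ‖v.snd‖) ≤ η / 2 * ‖v‖ := by nlinarith
    exact add_le_add_left h5 _
  obtain ⟨θ, hθ, hθc⟩ : ∃ θ : ℝ, 0 < θ ∧ c * (N * θ) ≤ η / 2 := by
    refine ⟨η / 2 / (c * N + 1), by positivity, ?_⟩
    rw [show c * (N * (η / 2 / (c * N + 1))) = η / 2 * ((c * N) / (c * N + 1)) by ring]
    refine mul_le_of_le_one_right (by positivity) ?_
    rw [div_le_one (by positivity)]; linarith
  have hr : ∀ j, ∃ r ∈ ccPairs Ω, ‖K.starProjection (L j) - r‖ ≤ θ := by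
    intro j
    have hm : K.starProjection (L j) ∈ closure (ccPairs Ω : Set (L2Pair Ω)) :=
      K.starProjection_apply_mem (L j)
    obtain ⟨r, hr, hd⟩ := Metric.mem_closure_iff.1 hm θ hθ
    exact ⟨r, hr, by rw [← dist_eq_norm]; exact hd.le⟩
  choose r hrD hrθ using hr
  let U : Submodule ℝ (L2Pair Ω) := Submodule.span ℝ (range r)
  have hUD : U ≤ ccPairs Ω := Submodule.span_le.2 (by rintro _ ⟨j, rfl⟩; exact hrD j)
  have hUfin : FiniteDimensional ℝ U := FiniteDimensional.span_of_finite ℝ (finite_range r)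
  have hUK : U ≤ K := hUD.trans (ccPairs Ω).le_topologicalClosure
  have hproj : ∀ x ∈ K, ‖(x - U.starProjection x).fst‖ ≤ η * ‖x‖ := by
    intro x hx
    set w := x - U.starProjection x with hw
    have hwK : w ∈ K := K.sub_mem hx (hUK (U.starProjection_apply_mem x))
    have hwU : w ∈ Uᗮ := U.sub_starProjection_mem_orthogonal x
    have hwx : ‖w‖ ≤ ‖x‖ := by
      have h := Uᗮ.norm_starProjection_apply_le x
      rwa [U.starProjection_orthogonal_val] at h
    have hin : ∀ j, |inner ℝ w (L j)| ≤ θ * ‖x‖ := by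
      intro j
      have h1 : inner ℝ w (L j - K.starProjection (L j)) = 0 :=
        K.inner_right_of_mem_orthogonal hwK (K.sub_starProjection_mem_orthogonal _)
      have h2 : inner ℝ w (r j) = 0 :=
        U.inner_left_of_mem_orthogonal (Submodule.subset_span (mem_range_self j)) hwU
      have h3 : inner ℝ w (L j) = inner ℝ w (K.starProjection (L j) - r j) := by
        rw [inner_sub_right] at h1 ⊢
        linarith
      rw [h3]
      refine (abs_real_inner_le_norm _ _).trans ?_
      rw [mul_comm]
      gcongr
      exact hrθ j
    refine (hEK w hwK).trans ?_
    have h4 : ∑ j, |inner ℝ w (L j)| ≤ N * (θ * ‖x‖) := by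
      refine (Finset.sum_le_sum fun j _ => hin j).trans (le_of_eq ?_)
      simp
    have h5 : c * ∑ j, |inner ℝ w (L j)| ≤ c * (N * (θ * ‖x‖)) := by gcongr
    have h6 : c * (N * (θ * ‖x‖)) ≤ η / 2 * ‖x‖ := by
      calc c * (N * (θ * ‖x‖)) = c * (N * θ) * ‖x‖ := by ring
        _ ≤ _ := by gcongr
    have h7 : η / 2 * ‖w‖ ≤ η / 2 * ‖x‖ := by gcongr
    linarith
  exact ⟨U, hUfin, hUD, hproj⟩

lemma exists_orthonormal_starProjection_eq_sum {V : Type*} [NormedAddCommGroup V]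
    [InnerProductSpace ℝ V] (U : Submodule ℝ V) [FiniteDimensional ℝ U] :
    ∃ (n : ℕ) (B : Fin n → V), (∀ k, B k ∈ U) ∧
      (∀ a : Fin n → ℝ, ‖∑ k, a k • B k‖ ^ 2 = ∑ k, a k ^ 2) ∧
      ∀ x, U.starProjection x = ∑ k, (inner ℝ (B k) x : ℝ) • B k := by
  let B := stdOrthonormalBasis ℝ U
  refine ⟨_, fun k => (B k : V), fun k => (B k).2, fun a => ?_, fun x => ?_⟩
  · have ho : Orthonormal ℝ (fun k => (B k : V)) :=
      B.orthonormal.comp_linearIsometry U.subtypeₗᵢ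
    rw [← real_inner_self_eq_norm_sq, ho.inner_sum a a Finset.univ]
    simp [pow_two]
  · rw [B.starProjection_eq_sum_rankOne]
    simp

/-- There are finite-dimensional spaces of smooth compactly supported functions, given by bases
that are orthonormal in `H¹`, whose `H¹`-orthogonal projections are close to the identity from
`H₀¹` to `L²`. -/
theorem exists_galerkin_family (hΩ : IsSmoothBoundedDomain Ω) {η : ℝ} (hη : 0 < η) :
    ∃ (N : ℕ) (e : Fin N → EuclideanSpace ℝ (Fin d) → ℝ), (∀ k, IsCcOn ⊤ Ω (e k)) ∧
      (∀ a : Fin N → ℝ, (∫ x in Ω, (∑ k, a k * e k x) ^ 2)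
        + (∫ x in Ω, ‖∑ k, a k • ∇ (e k) x‖ ^ 2) = ∑ k, a k ^ 2) ∧
      ∀ u g, IsH01 Ω u g → ∀ b : Fin N → ℝ,
        (∀ k, b k = (∫ x in Ω, u x * e k x) + ∫ x in Ω, inner ℝ (g x) (∇ (e k) x)) →
        ∑ k, b k ^ 2 ≤ (∫ x in Ω, u x ^ 2) + (∫ x in Ω, ‖g x‖ ^ 2) ∧
        (∫ x in Ω, (u x - ∑ k, b k * e k x) ^ 2)
          ≤ η ^ 2 * ((∫ x in Ω, u x ^ 2) + ∫ x in Ω, ‖g x‖ ^ 2) := by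
  obtain ⟨U, hUfin, hUD, hproj⟩ := exists_finiteDimensional_projection_close hΩ hη
  obtain ⟨n, B, hBU, hnorm, hstar⟩ := exists_orthonormal_starProjection_eq_sum U
  have hB : ∀ k, ∃ (φ : EuclideanSpace ℝ (Fin d) → ℝ) (h : IsCcOn ⊤ Ω φ),
      B k = toPair (h.memLp 2 _) (h.memLp_gradient 2 _) := fun k => hUD (hBU k)
  choose e he heB using hB
  have hsum1 : ∀ a : Fin n → ℝ,
      MemLp (fun x => ∑ k, a k * e k x) 2 (volume.restrict Ω) := fun a =>
    memLp_finsetSum _ fun i _ => ((he i).memLp 2 _).const_mul (a i)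
  have hsum2 : ∀ a : Fin n → ℝ,
      MemLp (fun x => ∑ k, a k • ∇ (e k) x) 2 (volume.restrict Ω) := fun a =>
    memLp_finsetSum _ fun i _ => ((he i).memLp_gradient 2 _).const_smul (a i)
  have hsum : ∀ a : Fin n → ℝ, ∑ k, a k • B k = toPair (hsum1 a) (hsum2 a) := by
    intro a
    rw [← sum_smul_toPair Finset.univ a (fun i => (he i).memLp 2 _)
      (fun i => (he i).memLp_gradient 2 _)]
    exact Finset.sum_congr rfl fun k _ => by rw [heB k]
  refine ⟨n, e, he, fun a => ?_, fun u g hug b hb => ?_⟩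
  · rw [← norm_sq_toPair (hsum1 a) (hsum2 a), ← hsum, hnorm]
  · have hxK := toPair_mem_closure hug
    have hbk : ∀ k, b k = inner ℝ (B k) (toPair hug.1 hug.2.1) := by
      intro k
      rw [real_inner_comm, hb k, heB, inner_toPair]
    have hp : U.starProjection (toPair hug.1 hug.2.1) = ∑ k, b k • B k := by
      rw [hstar]
      exact Finset.sum_congr rfl fun k _ => by rw [hbk k]
    constructor
    · rw [← norm_sq_toPair hug.1 hug.2.1, ← hnorm, ← hp]
      gcongr
      exact U.norm_starProjection_apply_le _
    · have h1 := hproj _ hxK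
      rw [hp, hsum, toPair_sub, norm_fst_toPair] at h1
      have h2 := pow_le_pow_left₀ (Real.sqrt_nonneg _) h1 2
      rw [Real.sq_sqrt (integral_nonneg fun _ => sq_nonneg _), mul_pow, norm_sq_toPair] at h2
      exact h2

/-! ### Smooth approximation, and the distance in terms of a Galerkin family -/

/-- Soft thresholding at level `k`. -/
noncomputable def softThreshold (k s : ℝ) : ℝ := max (s - k) 0 + min (s + k) 0

lemma abs_softThreshold_sub_le {k : ℝ} (hk : 0 ≤ k) (s t : ℝ) :
    |softThreshold k s - softThreshold k t| ≤ |s - t| := by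
  unfold softThreshold
  rcases le_total (s - k) 0 with h1 | h1 <;> rcases le_total (s + k) 0 with h2 | h2 <;>
  rcases le_total (t - k) 0 with h3 | h3 <;> rcases le_total (t + k) 0 with h4 | h4 <;>
  simp only [h1, h2, h3, h4, max_eq_left, max_eq_right, min_eq_left, min_eq_right] <;>
  cases abs_cases (s - t) <;> rw [abs_le] <;> constructor <;> linarith

lemma softThreshold_eq_zero {k s : ℝ} (h : |s| ≤ k) : softThreshold k s = 0 := by
  have := abs_le.1 h
  unfold softThreshold
  rw [max_eq_right (by linarith [this.2]), min_eq_right (by linarith [this.1]), add_zero]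

lemma abs_softThreshold_sub_self_le {k : ℝ} (hk : 0 ≤ k) (s : ℝ) :
    |softThreshold k s - s| ≤ k := by
  unfold softThreshold
  rcases le_total (s - k) 0 with h1 | h1 <;> rcases le_total (s + k) 0 with h2 | h2 <;>
  simp only [h1, h2, max_eq_left, max_eq_right, min_eq_left, min_eq_right] <;>
  rw [abs_le] <;> constructor <;> linarith

lemma exists_isCcOn_mem_zeroLip_close (hd : 0 < d) (hΩ : IsSmoothBoundedDomain Ω)
    {ψ : EuclideanSpace ℝ (Fin d) → ℝ} (hψ : ψ ∈ zeroLip Ω) {κ : ℝ} (hκ : 0 < κ) :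
    ∃ φ, IsCcOn ⊤ Ω φ ∧ φ ∈ zeroLip Ω ∧ ∀ x, |φ x - ψ x| ≤ κ := by
  have hne' : Nonempty (Fin d) := ⟨⟨0, hd⟩⟩
  have hne : (Ωᶜ).Nonempty := by
    by_contra hc
    rw [not_nonempty_iff_eq_empty, compl_empty_iff] at hc
    exact NormedSpace.unbounded_univ ℝ (EuclideanSpace ℝ (Fin d)) (hc ▸ hΩ.isBounded)
  obtain ⟨k, hk, hkκ⟩ : ∃ k : ℝ, 0 < k ∧ k + k / 2 ≤ κ := ⟨κ / 2, by positivity, by linarith⟩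
  let θ : EuclideanSpace ℝ (Fin d) → ℝ := fun x => softThreshold k (ψ x)
  have hθL : ∀ x y, |θ x - θ y| ≤ dist x y := fun x y => by
    have h := hψ.1.dist_le_mul x y
    rw [NNReal.coe_one, one_mul, Real.dist_eq] at h
    exact (abs_softThreshold_sub_le hk.le _ _).trans h
  have hθc : Continuous θ := by
    have : LipschitzWith 1 θ := LipschitzWith.of_dist_le_mul fun x y => by
      rw [NNReal.coe_one, one_mul]; exact hθL x y
    exact this.continuous
  let b : ContDiffBump (0 : EuclideanSpace ℝ (Fin d)) :=
    ⟨k / 4, k / 2, by linarith, by linarith⟩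
  let ρ : EuclideanSpace ℝ (Fin d) → ℝ := b.normed volume
  let φ : EuclideanSpace ℝ (Fin d) → ℝ :=
    MeasureTheory.convolution ρ θ (ContinuousLinearMap.lsmul ℝ ℝ) volume
  have hφd : ∀ x, φ x = ∫ z, ρ z * θ (x - z) := fun x => rfl
  have hsmooth : ContDiff ℝ ∞ φ :=
    b.hasCompactSupport_normed.contDiff_convolution_left (n := ⊤)
      (ContinuousLinearMap.lsmul ℝ ℝ) b.contDiff_normed hθc.locallyIntegrable
  have hi : ∀ x, Integrable (fun z => ρ z * θ (x - z)) volume := fun x =>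
    (b.continuous_normed.mul (hθc.comp (continuous_sub_left x))).integrable_of_hasCompactSupport
      b.hasCompactSupport_normed.mul_right
  have hφL : LipschitzWith 1 φ := by
    refine LipschitzWith.of_dist_le_mul fun x y => ?_
    rw [NNReal.coe_one, one_mul, Real.dist_eq, hφd, hφd, ← integral_sub (hi x) (hi y),
      ← Real.norm_eq_abs]
    have h1 : ∫ z, ρ z * dist x y = dist x y := by
      rw [integral_mul_const, b.integral_normed, one_mul]
    rw [← h1]
    refine norm_integral_le_of_norm_le (b.integrable_normed.mul_const _)
      (Eventually.of_forall fun z => ?_)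
    rw [← mul_sub, norm_mul, Real.norm_eq_abs, Real.norm_eq_abs, abs_of_nonneg (b.nonneg_normed z)]
    refine mul_le_mul_of_nonneg_left ((hθL _ _).trans (le_of_eq ?_)) (b.nonneg_normed z)
    rw [dist_sub_right]
  have hclose : ∀ x, |φ x - ψ x| ≤ κ := by
    intro x
    have h1 : dist (φ x) (θ x) ≤ k / 2 :=
      b.dist_normed_convolution_le hθc.aestronglyMeasurable fun y hy =>
        (hθL y x).trans (le_of_lt hy)
    have h2 : |θ x - ψ x| ≤ k := abs_softThreshold_sub_self_le hk.le _
    rw [Real.dist_eq] at h1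
    calc |φ x - ψ x| = |(φ x - θ x) + (θ x - ψ x)| := by ring_nf
      _ ≤ |φ x - θ x| + |θ x - ψ x| := abs_add_le _ _
      _ ≤ κ := by linarith
  have hsupp : ∀ x, Metric.infDist x Ωᶜ < k / 2 → φ x = 0 := by
    intro x hx
    obtain ⟨y, hy, hxy⟩ := (Metric.infDist_lt_iff hne).1 hx
    rw [hφd]
    refine integral_eq_zero_of_ae (Eventually.of_forall fun z => ?_)
    show ρ z * θ (x - z) = 0
    by_cases hz : z ∈ Metric.ball (0 : EuclideanSpace ℝ (Fin d)) (k / 2)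
    · have hθ0 : θ (x - z) = 0 := by
        refine softThreshold_eq_zero ?_
        have h := hψ.1.dist_le_mul (x - z) y
        rw [hψ.2 y hy, Real.dist_eq, sub_zero, NNReal.coe_one, one_mul] at h
        have h2 : dist (x - z) x < k / 2 := by
          rw [dist_eq_norm, sub_sub_cancel_left, norm_neg]
          exact mem_ball_zero_iff.1 hz
        linarith [dist_triangle (x - z) x y]
      rw [hθ0, mul_zero]
    · have : ρ z = 0 := by
        have h : z ∉ Function.support ρ := by
          show z ∉ Function.support (b.normed volume)
          rw [b.support_normed_eq]; exact hz
        exact Function.notMem_support.1 h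
      rw [this, zero_mul]
  set S : Set (EuclideanSpace ℝ (Fin d)) := {x | k / 2 ≤ Metric.infDist x Ωᶜ} with hS
  have hScl : IsClosed S := isClosed_le continuous_const (Metric.continuous_infDist_pt _)
  have hSΩ : S ⊆ Ω := by
    intro x hx
    by_contra hxΩ
    have h0 : Metric.infDist x Ωᶜ = 0 := Metric.infDist_zero_of_mem hxΩ
    have hx' : k / 2 ≤ Metric.infDist x Ωᶜ := hx
    linarith
  have hSc : IsCompact S := Metric.isCompact_of_isClosed_isBounded hScl (hΩ.isBounded.subset hSΩ)
  have hts : tsupport φ ⊆ S := closure_minimal (fun x hx => by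
    by_contra h
    exact hx (hsupp x (not_le.1 h))) hScl
  have hcc : IsCcOn ⊤ Ω φ :=
    ⟨hsmooth, hSc.of_isClosed_subset (isClosed_tsupport φ) hts, hts.trans hSΩ⟩
  exact ⟨φ, hcc, ⟨hφL, fun x hx => hcc.eq_zero hx⟩, hclose⟩

lemma IsCcOn.isH01 {φ : EuclideanSpace ℝ (Fin d) → ℝ} (hφ : IsCcOn ⊤ Ω φ) :
    IsH01 Ω φ (∇ φ) :=
  ⟨hφ.memLp 2 _, hφ.memLp_gradient 2 _, fun _ => φ, fun _ => hφ, by simp, by simp⟩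

lemma SubProb.integral_sub_eq (hΩ : IsSmoothBoundedDomain Ω) {m n : SubProb Ω} (hm : m.InL2)
    (hn : n.InL2) {f : EuclideanSpace ℝ (Fin d) → ℝ} (hf : MemLp f 2 (volume.restrict Ω)) :
    ∫ x, f x ∂m.meas - ∫ x, f x ∂n.meas = ∫ x in Ω, (m.density x - n.density x) * f x := by
  have h1 : Integrable (fun x => f x * m.density x) (volume.restrict Ω) := hf.integrable_mul hm.2
  have h2 : Integrable (fun x => f x * n.density x) (volume.restrict Ω) := hf.integrable_mul hn.2
  rw [m.integral_eq hΩ.isOpen hm.1, n.integral_eq hΩ.isOpen hn.1, ← integral_sub h1 h2]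
  exact integral_congr_ae (Eventually.of_forall fun x => by show _ = _; ring)

lemma abs_sum_mul_le_sqrt {N : ℕ} (a b : Fin N → ℝ) :
    |∑ k, a k * b k| ≤ √(∑ k, a k ^ 2) * √(∑ k, b k ^ 2) := by
  rw [← Real.sqrt_mul (Finset.sum_nonneg fun k _ => sq_nonneg _), ← Real.sqrt_sq_eq_abs]
  exact Real.sqrt_le_sqrt (Finset.sum_mul_sq_le_sq_mul_sq _ _ _)

/-- The distance is controlled by a Galerkin family. -/
theorem exists_edist_le_galerkin (hd : 0 < d) (hΩ : IsSmoothBoundedDomain Ω) :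
    ∃ C : ℝ, 0 < C ∧ ∀ (η : ℝ) (_ : 0 < η) (N : ℕ) (e : Fin N → EuclideanSpace ℝ (Fin d) → ℝ)
      (_ : ∀ k, IsCcOn ⊤ Ω (e k))
      (_ : ∀ u g, IsH01 Ω u g → ∀ b : Fin N → ℝ,
        (∀ k, b k = (∫ x in Ω, u x * e k x) + ∫ x in Ω, inner ℝ (g x) (∇ (e k) x)) →
        ∑ k, b k ^ 2 ≤ (∫ x in Ω, u x ^ 2) + (∫ x in Ω, ‖g x‖ ^ 2) ∧
        (∫ x in Ω, (u x - ∑ k, b k * e k x) ^ 2)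
          ≤ η ^ 2 * ((∫ x in Ω, u x ^ 2) + ∫ x in Ω, ‖g x‖ ^ 2))
      (m n : SubProb Ω) (_ : m.InL2) (_ : n.InL2),
      edist m n ≤ ENNReal.ofReal (C * (√(∑ k, (∫ x, e k x ∂m.meas - ∫ x, e k x ∂n.meas) ^ 2)
        + η * √(∫ x in Ω, (m.density x - n.density x) ^ 2))) := by
  have := hΩ.isFiniteMeasure
  obtain ⟨D, hD, hb⟩ := exists_zeroLip_bound hd hΩ
  set vol := (volume.restrict Ω).real univ with hvol
  refine ⟨√(D ^ 2 * vol + vol) + 1, by positivity, ?_⟩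
  intro η hη N e he hgal m n hm hn
  refine edist_le_ofReal hΩ.isOpen fun ψ hψ => le_of_forall_pos_le_add fun κ hκ => ?_
  obtain ⟨φ, hφ, hφz, hφψ⟩ := exists_isCcOn_mem_zeroLip_close hd hΩ hψ (half_pos hκ)
  have happ : ∀ p : SubProb Ω, |∫ x, φ x ∂p.meas - ∫ x, ψ x ∂p.meas| ≤ κ / 2 := by
    intro p
    rw [← integral_sub
      (p.integrable_of_bound hφz.1.continuous.aestronglyMeasurable (hb φ hφz))
      (p.integrable_of_bound hψ.1.continuous.aestronglyMeasurable (hb ψ hψ))]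
    have h1 := norm_integral_le_of_norm_le_const (μ := p.meas) (f := fun x => φ x - ψ x)
      (C := κ / 2) (Eventually.of_forall hφψ)
    have h2 := p.measureReal_univ_le
    refine h1.trans ?_
    nlinarith
  set w : EuclideanSpace ℝ (Fin d) → ℝ := fun x => m.density x - n.density x with hw
  have hw2 : MemLp w 2 (volume.restrict Ω) := hm.2.sub hn.2
  have hφ2 := hφ.memLp 2 (volume.restrict Ω)
  set b : Fin N → ℝ := fun k =>
    (∫ x in Ω, φ x * e k x) + ∫ x in Ω, inner ℝ (∇ φ x) (∇ (e k) x) with hbdef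
  obtain ⟨hB1, hB2⟩ := hgal φ (∇ φ) hφ.isH01 b fun k => rfl
  set X := (∫ x in Ω, φ x ^ 2) + ∫ x in Ω, ‖∇ φ x‖ ^ 2 with hX
  have hXle : X ≤ D ^ 2 * vol + vol := by
    refine add_le_add ?_ ?_
    · have h1 : ∫ x in Ω, φ x ^ 2 ≤ ∫ x in Ω, D ^ 2 := by
        refine integral_mono hφ2.integrable_sq (integrable_const _) fun x => ?_
        show φ x ^ 2 ≤ D ^ 2
        rw [← sq_abs]
        exact pow_le_pow_left₀ (abs_nonneg _) (hb φ hφz x) 2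
      refine h1.trans (le_of_eq ?_)
      rw [integral_const, smul_eq_mul, mul_comm]
    · have h1 : ∫ x in Ω, ‖∇ φ x‖ ^ 2 ≤ ∫ x in Ω, (1 : ℝ) := by
        refine integral_mono ((hφ.memLp_gradient 2 _).integrable_norm_pow (by norm_num))
          (integrable_const _) fun x => ?_
        show ‖∇ φ x‖ ^ 2 ≤ 1
        rw [norm_gradient_eq]
        have h2 := norm_fderiv_le_of_lipschitz ℝ hφz.1 (x₀ := x)
        rw [NNReal.coe_one] at h2
        exact pow_le_one₀ (norm_nonneg _) h2
      refine h1.trans (le_of_eq ?_)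
      rw [integral_const, smul_eq_mul, mul_one]
  have hX0 : 0 ≤ X := by positivity
  set q := ∑ k, (∫ x, e k x ∂m.meas - ∫ x, e k x ∂n.meas) ^ 2 with hq
  have hsum2 : MemLp (fun x => ∑ k, b k * e k x) 2 (volume.restrict Ω) :=
    memLp_finsetSum _ fun i _ => ((he i).memLp 2 _).const_mul (b i)
  have hmain : ∫ x, φ x ∂m.meas - ∫ x, φ x ∂n.meas
      = (∫ x in Ω, w x * (φ x - ∑ k, b k * e k x))
        + ∑ k, b k * (∫ x, e k x ∂m.meas - ∫ x, e k x ∂n.meas) := by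
    rw [SubProb.integral_sub_eq hΩ hm hn hφ2]
    have h1 : ∀ k, b k * (∫ x, e k x ∂m.meas - ∫ x, e k x ∂n.meas)
        = ∫ x in Ω, w x * (b k * e k x) := by
      intro k
      rw [SubProb.integral_sub_eq hΩ hm hn ((he k).memLp 2 _), ← integral_const_mul]
      exact integral_congr_ae (Eventually.of_forall fun x => by show _ = _; ring)
    have hi : ∀ k ∈ Finset.univ, Integrable (fun x => w x * (b k * e k x)) (volume.restrict Ω) :=
      fun k _ => hw2.integrable_mul (((he k).memLp 2 _).const_mul (b k))
    simp only [h1]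
    have hi' : Integrable (fun x => w x * (φ x - ∑ k, b k * e k x)) (volume.restrict Ω) :=
      hw2.integrable_mul (hφ2.sub hsum2)
    rw [← integral_finsetSum _ hi, ← integral_add hi' (integrable_finsetSum _ hi)]
    refine integral_congr_ae (Eventually.of_forall fun x => ?_)
    show w x * φ x = w x * (φ x - ∑ k, b k * e k x) + ∑ k, w x * (b k * e k x)
    rw [← Finset.mul_sum]; ring
  have h1 : |∫ x in Ω, w x * (φ x - ∑ k, b k * e k x)| ≤ √(∫ x in Ω, w x ^ 2) * (η * √X) := by
    refine (abs_integral_mul_le hw2 (hφ2.sub hsum2)).trans ?_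
    refine mul_le_mul_of_nonneg_left ?_ (Real.sqrt_nonneg _)
    refine (Real.sqrt_le_sqrt hB2).trans (le_of_eq ?_)
    rw [Real.sqrt_mul (sq_nonneg _), Real.sqrt_sq hη.le]
  have h2 := abs_sum_mul_le_sqrt b fun k => ∫ x, e k x ∂m.meas - ∫ x, e k x ∂n.meas
  have h3 : √(∑ k, b k ^ 2) * √q ≤ √X * √q := by
    gcongr
  have h4 : √X ≤ √(D ^ 2 * vol + vol) := Real.sqrt_le_sqrt hXle
  have h5 := abs_le.1 (happ m)
  have h6 := abs_le.1 (happ n)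
  have h7 : ∫ x, φ x ∂m.meas - ∫ x, φ x ∂n.meas ≤ √X * (√q + η * √(∫ x in Ω, w x ^ 2)) := by
    rw [hmain]
    have := (abs_le.1 h1).2
    have := (abs_le.1 h2).2
    nlinarith
  have h8 : √X * (√q + η * √(∫ x in Ω, w x ^ 2))
      ≤ (√(D ^ 2 * vol + vol) + 1) * (√q + η * √(∫ x in Ω, w x ^ 2)) := by
    gcongr
    linarith
  linarith [h5.1, h5.2, h6.1, h6.2]

/-! ### Integration by parts -/

lemma IsCcOn.laplacian_eq {φ : EuclideanSpace ℝ (Fin d) → ℝ} (hφ : IsCcOn ⊤ Ω φ)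
    (x : EuclideanSpace ℝ (Fin d)) :
    Δ φ x = ∑ i, fderiv ℝ (fun y => fderiv ℝ φ y (EuclideanSpace.basisFun (Fin d) ℝ i)) x
      (EuclideanSpace.basisFun (Fin d) ℝ i) := by
  rw [InnerProductSpace.laplacian_eq_iteratedFDeriv_orthonormalBasis φ
    (EuclideanSpace.basisFun (Fin d) ℝ)]
  refine Finset.sum_congr rfl fun i _ => ?_
  have hd : DifferentiableAt ℝ (fderiv ℝ φ) x :=
    ((hφ.1.fderiv_right (m := (⊤ : ℕ∞)) (by simp)).differentiable (by simp)) x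
  rw [iteratedFDeriv_two_apply, fderiv_clm_apply hd (differentiableAt_const _)]
  simp

lemma IsCcOn.fderiv_apply {φ : EuclideanSpace ℝ (Fin d) → ℝ} (hφ : IsCcOn ⊤ Ω φ)
    (v : EuclideanSpace ℝ (Fin d)) : IsCcOn ⊤ Ω fun x => fderiv ℝ φ x v := by
  refine ⟨?_, hφ.2.1.fderiv_apply ℝ v, ?_⟩
  · exact (hφ.1.fderiv_right (m := (⊤ : ℕ∞)) (by simp)).clm_apply contDiff_const
  · exact (tsupport_fderiv_apply_subset ℝ v).trans hφ.2.2

lemma IsCcOn.memLp_laplacian {φ : EuclideanSpace ℝ (Fin d) → ℝ} (hφ : IsCcOn ⊤ Ω φ)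
    (p : ℝ≥0∞) (μ : Measure (EuclideanSpace ℝ (Fin d))) [IsFiniteMeasureOnCompacts μ] :
    MemLp (Δ φ) p μ := by
  have h : Δ φ = fun x => ∑ i, fderiv ℝ
      (fun y => fderiv ℝ φ y (EuclideanSpace.basisFun (Fin d) ℝ i)) x
      (EuclideanSpace.basisFun (Fin d) ℝ i) := funext hφ.laplacian_eq
  rw [h]
  exact memLp_finsetSum _ fun i _ => ((hφ.fderiv_apply _).fderiv_apply _).memLp p μ

lemma integral_mul_laplacian_of_isCcOn {φ ψ : EuclideanSpace ℝ (Fin d) → ℝ} (hφ : IsCcOn ⊤ Ω φ)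
    (hψ : IsCcOn ⊤ Ω ψ) :
    (∫ x in Ω, ψ x * Δ φ x) + ∫ x in Ω, inner ℝ (∇ ψ x) (∇ φ x) = 0 := by
  have h1 : ∫ x in Ω, ψ x * Δ φ x = ∫ x, ψ x * Δ φ x :=
    setIntegral_eq_integral_of_forall_compl_eq_zero fun x hx => by rw [hψ.eq_zero hx, zero_mul]
  have h2 : ∫ x in Ω, inner ℝ (∇ ψ x) (∇ φ x) = ∫ x, inner ℝ (∇ ψ x) (∇ φ x) :=
    setIntegral_eq_integral_of_forall_compl_eq_zero fun x hx => by
      rw [hψ.gradient_eq_zero hx, inner_zero_left]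
  rw [h1, h2]
  let v := EuclideanSpace.basisFun (Fin d) ℝ
  have hL2 : ∀ {a b : EuclideanSpace ℝ (Fin d) → ℝ}, IsCcOn ⊤ Ω a → IsCcOn ⊤ Ω b →
      Integrable (fun x => a x * b x) volume := fun ha hb =>
    (ha.memLp 2 volume).integrable_mul (hb.memLp 2 volume)
  have e1 : ∫ x, ψ x * Δ φ x
      = ∑ i, ∫ x, ψ x * fderiv ℝ (fun y => fderiv ℝ φ y (v i)) x (v i) := by
    rw [← integral_finsetSum _ fun i _ => hL2 hψ ((hφ.fderiv_apply _).fderiv_apply _)]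
    refine integral_congr_ae (Eventually.of_forall fun x => ?_)
    show ψ x * Δ φ x = _
    rw [hφ.laplacian_eq, Finset.mul_sum]
  have e2 : ∫ x, inner ℝ (∇ ψ x) (∇ φ x) = ∑ i, ∫ x, fderiv ℝ ψ x (v i) * fderiv ℝ φ x (v i) := by
    rw [← integral_finsetSum _ fun i _ => hL2 (hψ.fderiv_apply _) (hφ.fderiv_apply _)]
    refine integral_congr_ae (Eventually.of_forall fun x => ?_)
    show inner ℝ (∇ ψ x) (∇ φ x) = _
    rw [← v.sum_inner_mul_inner]
    refine Finset.sum_congr rfl fun i _ => ?_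
    rw [inner_gradient_left, real_inner_comm, inner_gradient_left]
  rw [e1, e2, ← Finset.sum_add_distrib]
  refine Finset.sum_eq_zero fun i _ => ?_
  rw [integral_mul_fderiv_eq_neg_fderiv_mul_of_integrable
    (hL2 (hψ.fderiv_apply _) (hφ.fderiv_apply _)) (hL2 hψ ((hφ.fderiv_apply _).fderiv_apply _))
    (hL2 hψ (hφ.fderiv_apply _)) (fun x _ => hψ.differentiable x)
    (fun x _ => (hφ.fderiv_apply _).differentiable x), neg_add_cancel]

/-- Integration by parts for functions in `H₀¹`. -/
theorem IsH01.integral_mul_laplacian {u : EuclideanSpace ℝ (Fin d) → ℝ}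
    {g : EuclideanSpace ℝ (Fin d) → EuclideanSpace ℝ (Fin d)} (hu : IsH01 Ω u g)
    {φ : EuclideanSpace ℝ (Fin d) → ℝ} (hφ : IsCcOn ⊤ Ω φ) :
    (∫ x in Ω, u x * Δ φ x) + ∫ x in Ω, inner ℝ (g x) (∇ φ x) = 0 := by
  set z := toPair (hφ.memLp_laplacian 2 (volume.restrict Ω)) (hφ.memLp_gradient 2 _) with hz
  have hcl : IsClosed {v : L2Pair Ω | inner ℝ v z = 0} :=
    isClosed_eq (continuous_id.inner continuous_const) continuous_const
  have hsub : (ccPairs Ω : Set (L2Pair Ω)) ⊆ {v : L2Pair Ω | inner ℝ v z = 0} := by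
    rintro _ ⟨ψ, hψ, rfl⟩
    rw [mem_ofPred_eq, hz, inner_toPair]
    exact integral_mul_laplacian_of_isCcOn hφ hψ
  have h := closure_minimal hsub hcl (toPair_mem_closure hu)
  rwa [mem_ofPred_eq, hz, inner_toPair] at h

lemma IsH01.sub {u v : EuclideanSpace ℝ (Fin d) → ℝ}
    {g k : EuclideanSpace ℝ (Fin d) → EuclideanSpace ℝ (Fin d)} (hu : IsH01 Ω u g)
    (hv : IsH01 Ω v k) : IsH01 Ω (fun x => u x - v x) (fun x => g x - k x) := by
  obtain ⟨hu1, hg1, φ, hφ, h1, h2⟩ := hu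
  obtain ⟨hv1, hk1, ψ, hψ, h3, h4⟩ := hv
  refine ⟨hu1.sub hv1, hg1.sub hk1, fun n => φ n + (-1 : ℝ) • ψ n,
    fun n => (hφ n).add ((hψ n).const_smul (-1)), ?_, ?_⟩
  · have h5 := h1.add h3
    rw [add_zero] at h5
    refine tendsto_of_tendsto_of_tendsto_of_le_of_le tendsto_const_nhds h5 (fun _ => zero_le)
      fun n => ?_
    refine le_trans (le_of_eq ?_) (eLpNorm_sub_le (((hφ n).memLp 2 _).sub hu1).1
      (((hψ n).memLp 2 _).sub hv1).1 (by norm_num))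
    congr 1
    ext x
    simp; ring
  · have h5 := h2.add h4
    rw [add_zero] at h5
    refine tendsto_of_tendsto_of_tendsto_of_le_of_le tendsto_const_nhds h5 (fun _ => zero_le)
      fun n => ?_
    refine le_trans (le_of_eq ?_) (eLpNorm_sub_le (((hφ n).memLp_gradient 2 _).sub hg1).1
      (((hψ n).memLp_gradient 2 _).sub hk1).1 (by norm_num))
    congr 1
    ext x : 1
    rw [gradient_add_of_differentiable (hφ n).differentiable
      ((hψ n).const_smul (-1)).differentiable,
      gradient_const_smul_of_differentiable (hψ n).differentiable]
    simp only [Pi.add_apply, Pi.smul_apply, Pi.sub_apply]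
    module

/-! ### Quadratic test functions -/

lemma IsCcOn.integrable {k : ℕ∞} {φ : EuclideanSpace ℝ (Fin d) → ℝ} (hφ : IsCcOn k Ω φ)
    (m : SubProb Ω) : Integrable φ m.meas :=
  hφ.continuous.integrable_of_hasCompactSupport hφ.2.1

lemma IsCcOn.continuous_integral (hΩ : IsOpen Ω) {φ : EuclideanSpace ℝ (Fin d) → ℝ}
    (hφ : IsCcOn ⊤ Ω φ) : Continuous fun m : SubProb Ω => ∫ x, φ x ∂m.meas := by
  obtain ⟨K, hK⟩ := hφ.lipschitz
  exact AbsorbedMFC.continuous_integral hΩ hK fun x hx => hφ.eq_zero hx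

lemma IsCcOn.exists_integral_bound {φ : EuclideanSpace ℝ (Fin d) → ℝ} (hφ : IsCcOn ⊤ Ω φ) :
    ∃ B : ℝ, ∀ m : SubProb Ω, |∫ x, φ x ∂m.meas| ≤ B := by
  obtain ⟨B, hB⟩ := hφ.continuous.bounded_above_of_compact_support hφ.2.1
  refine ⟨B, fun m => ?_⟩
  have h := norm_integral_le_of_norm_le_const (μ := m.meas) (Eventually.of_forall hB)
  have h2 := m.measureReal_univ_le
  have h3 : 0 ≤ B := (norm_nonneg _).trans (hB 0)
  exact h.trans (by nlinarith)

lemma SubProb.integral_mix (m m' : SubProb Ω) (r : unitInterval)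
    {f : EuclideanSpace ℝ (Fin d) → ℝ} (hf : Integrable f m.meas) (hf' : Integrable f m'.meas) :
    ∫ x, f x ∂(m.mix m' r).meas
      = r * ∫ x, f x ∂m'.meas + (1 - r) * ∫ x, f x ∂m.meas := by
  have h : (m.mix m' r).meas
      = ENNReal.ofReal (r : ℝ) • m'.meas + ENNReal.ofReal (1 - (r : ℝ)) • m.meas := rfl
  rw [h, integral_add_measure (hf'.smul_measure ENNReal.ofReal_ne_top)
    (hf.smul_measure ENNReal.ofReal_ne_top), integral_smul_measure, integral_smul_measure,
    ENNReal.toReal_ofReal r.2.1, ENNReal.toReal_ofReal (sub_nonneg.2 r.2.2)]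
  simp

lemma IsCcOn.finsetSum {X ι : Type*} [NormedAddCommGroup X] [NormedSpace ℝ X] {k : ℕ∞} {S : Set X}
    (s : Finset ι) {f : ι → X → ℝ} (a : ι → ℝ) (hf : ∀ i, IsCcOn k S (f i)) :
    IsCcOn k S fun x => ∑ i ∈ s, a i * f i x := by
  classical
  induction s using Finset.induction_on with
  | empty =>
    simp only [Finset.sum_empty]
    exact isCcOn_zero
  | insert i s hi ih =>
    have := ((hf i).const_smul (a i)).add ih
    simp only [Finset.sum_insert hi]
    exact this

lemma IsCcOn.of_le {X : Type*} [NormedAddCommGroup X] [NormedSpace ℝ X] {k l : ℕ∞} {S : Set X}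
    {f : X → ℝ} (hf : IsCcOn l S f) (h : k ≤ l) : IsCcOn k S f :=
  ⟨hf.1.of_le (by exact_mod_cast h), hf.2⟩

lemma continuousBoundedInC_sum {X : Type*} [NormedAddCommGroup X] [NormedSpace ℝ X] {S : Set X}
    {N k : ℕ} {T : ℝ} {a : Fin N → SubProb Ω → ℝ} {f : Fin N → X → ℝ}
    (hf : ∀ i, IsCcOn k S (f i)) (ha : ∀ i, Continuous (a i))
    (hab : ∀ i, ∃ B : ℝ, ∀ m, |a i m| ≤ B) :
    ContinuousBoundedInC k T fun _ m x => ∑ i, a i m * f i x := by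
  intro j hj
  have hcd : ∀ i, ContDiff ℝ j (f i) := fun i => (hf i).1.of_le (by exact_mod_cast hj)
  have hB : ∀ i, ∃ B : ℝ, ∀ x, ‖iteratedFDeriv ℝ j (f i) x‖ ≤ B := fun i =>
    ((hcd i).continuous_iteratedFDeriv le_rfl).bounded_above_of_compact_support
      ((hf i).2.1.iteratedFDeriv j)
  choose B hB using hB
  choose A hA using hab
  have hB0 : ∀ i, 0 ≤ B i := fun i => (norm_nonneg _).trans (hB i 0)
  have hform : ∀ c : Fin N → ℝ, ∀ x, iteratedFDeriv ℝ j (fun x => ∑ i, c i * f i x) x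
      = ∑ i, c i • iteratedFDeriv ℝ j (f i) x := by
    intro c x
    have h1 : (fun x => ∑ i, c i * f i x) = ∑ i, c i • f i := by
      ext x; simp
    rw [h1, iteratedFDeriv_sum_apply (f := fun i => c i • f i)
      fun i _ => ((hcd i).const_smul (c i)).contDiffAt]
    exact Finset.sum_congr rfl fun i _ => iteratedFDeriv_const_smul_apply (hcd i).contDiffAt
  refine ⟨fun p₀ _ => ?_, ∑ i, A i * B i, fun t _ m x => ?_⟩
  · rw [Metric.tendstoUniformly_iff]
    intro ε hε
    have hlim : Tendsto (fun p : ℝ × SubProb Ω => ∑ i, |a i p₀.2 - a i p.2| * B i)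
        (𝓝[Icc 0 T ×ˢ univ] p₀) (𝓝 0) := by
      have hc : Continuous fun p : ℝ × SubProb Ω => ∑ i, |a i p₀.2 - a i p.2| * B i := by
        refine continuous_finsetSum _ fun i _ => ?_
        exact (continuous_const.sub ((ha i).comp continuous_snd)).abs.mul continuous_const
      have := (hc.tendsto p₀).mono_left (nhdsWithin_le_nhds (s := Icc 0 T ×ˢ univ))
      simpa using this
    filter_upwards [hlim.eventually_lt_const hε] with p hp x
    refine lt_of_le_of_lt ?_ hp
    rw [hform, hform, dist_eq_norm, ← Finset.sum_sub_distrib]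
    refine (norm_sum_le _ _).trans (Finset.sum_le_sum fun i _ => ?_)
    rw [← sub_smul, norm_smul, Real.norm_eq_abs]
    exact mul_le_mul_of_nonneg_left (hB i x) (abs_nonneg _)
  · rw [hform]
    refine (norm_sum_le _ _).trans (Finset.sum_le_sum fun i _ => ?_)
    rw [norm_smul, Real.norm_eq_abs]
    exact mul_le_mul (hA i m) (hB i x) (norm_nonneg _) ((abs_nonneg _).trans (hA i m))

lemma IsCcOn.prodMul {k : ℕ∞} {φ : EuclideanSpace ℝ (Fin d) → ℝ} (hφ : IsCcOn k Ω φ) :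
    IsCcOn k (Ω ×ˢ Ω) fun p : EuclideanSpace ℝ (Fin d) × EuclideanSpace ℝ (Fin d) =>
      φ p.1 * φ p.2 := by
  have hcl : IsCompact (tsupport φ ×ˢ tsupport φ) := hφ.2.1.isCompact.prod hφ.2.1.isCompact
  have hts : tsupport (fun p : EuclideanSpace ℝ (Fin d) × EuclideanSpace ℝ (Fin d) =>
      φ p.1 * φ p.2) ⊆ tsupport φ ×ˢ tsupport φ := by
    refine closure_minimal (fun p hp => ?_) hcl.isClosed
    have hp' : φ p.1 * φ p.2 ≠ 0 := hp
    exact ⟨subset_tsupport _ (left_ne_zero_of_mul hp'), subset_tsupport _ (right_ne_zero_of_mul hp')⟩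
  exact ⟨(hφ.1.comp contDiff_fst).mul (hφ.1.comp contDiff_snd),
    hcl.of_isClosed_subset (isClosed_tsupport _) hts, hts.trans (prod_mono hφ.2.2 hφ.2.2)⟩

lemma projIcc_coe_of_mem_uIcc {r : ℝ} (hr : r ∈ uIcc (0 : ℝ) 1) :
    ((projIcc 0 1 zero_le_one r : unitInterval) : ℝ) = r := by
  rw [uIcc_of_le zero_le_one] at hr
  rw [projIcc_of_mem _ hr]

lemma integral_affine_mul (a a' c : ℝ) :
    ∫ r in (0 : ℝ)..1, (r * a' + (1 - r) * a - c) * (a' - a)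
      = ((a' - c) ^ 2 - (a - c) ^ 2) / 2 := by
  have h : ∀ r ∈ uIcc (0 : ℝ) 1, HasDerivAt (fun r : ℝ => (r * a' + (1 - r) * a - c) ^ 2 / 2)
      ((r * a' + (1 - r) * a - c) * (a' - a)) r := by
    intro r _
    have h1 : HasDerivAt (fun r : ℝ => r * a' + (1 - r) * a - c) (1 * a' + (0 - 1) * a) r :=
      (((hasDerivAt_id r).mul_const a').add
        (((hasDerivAt_const r (1 : ℝ)).sub (hasDerivAt_id r)).mul_const a)).sub_const c
    have h2 := (h1.pow 2).div_const 2
    convert! h2 using 1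
    ring
  rw [intervalIntegral.integral_eq_sub_of_hasDerivAt h
    ((by fun_prop : Continuous fun r : ℝ =>
      (r * a' + (1 - r) * a - c) * (a' - a)).intervalIntegrable _ _)]
  ring

/-- The test function `α(t) + β/2 ∑ₖ (∫ eₖ dm - cₖ)²`. -/
noncomputable def quadTest (T : ℝ) (hΩ : IsOpen Ω) {α α' : ℝ → ℝ}
    (hα : ∀ t, HasDerivAt α (α' t) t) (hα' : Continuous α') (β : ℝ) {N : ℕ}
    {e : Fin N → EuclideanSpace ℝ (Fin d) → ℝ} (he : ∀ k, IsCcOn ⊤ Ω (e k)) (c : Fin N → ℝ) :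
    SmoothTestFunction T Ω where
  toFun t m := α t + β / 2 * ∑ k, (∫ x, e k x ∂m.meas - c k) ^ 2
  dt t _ := α' t
  dm _ m x := ∑ k, (β * (∫ x, e k x ∂m.meas - c k)) * e k x
  dmm _ _ p := ∑ k, β * (e k p.1 * e k p.2)
  hasDeriv_dt t _ m := ((hα t).add_const _).hasDerivWithinAt
  continuous_dt := (hα'.comp continuous_fst).continuousOn
  hasDeriv_dm t _ m m' := by
    have hinteg : ∀ (b : Fin N → ℝ) (p : SubProb Ω), ∫ x, ∑ k, b k * e k x ∂p.meas
        = ∑ k, b k * ∫ x, e k x ∂p.meas := by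
      intro b p
      rw [integral_finsetSum _ fun k _ => ((he k).integrable p).const_mul (b k)]
      simp only [integral_const_mul]
    have h1 : ∀ r ∈ uIcc (0 : ℝ) 1,
        (∫ x, ∑ k, (β * (∫ y, e k y ∂(m.mix m' (projIcc 0 1 zero_le_one r)).meas - c k))
            * e k x ∂m'.meas
          - ∫ x, ∑ k, (β * (∫ y, e k y ∂(m.mix m' (projIcc 0 1 zero_le_one r)).meas - c k))
            * e k x ∂m.meas)
        = ∑ k, β * ((r * (∫ x, e k x ∂m'.meas) + (1 - r) * (∫ x, e k x ∂m.meas) - c k)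
          * ((∫ x, e k x ∂m'.meas) - ∫ x, e k x ∂m.meas)) := by
      intro r hr
      rw [hinteg, hinteg, ← Finset.sum_sub_distrib]
      refine Finset.sum_congr rfl fun k _ => ?_
      rw [SubProb.integral_mix _ _ _ ((he k).integrable m) ((he k).integrable m'),
        projIcc_coe_of_mem_uIcc hr]
      ring
    rw [intervalIntegral.integral_congr h1, intervalIntegral.integral_finsetSum fun k _ =>
      (by fun_prop : Continuous fun r : ℝ =>
        β * ((r * (∫ x, e k x ∂m'.meas) + (1 - r) * (∫ x, e k x ∂m.meas) - c k)
          * ((∫ x, e k x ∂m'.meas) - ∫ x, e k x ∂m.meas))).intervalIntegrable _ _]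
    simp only [intervalIntegral.integral_const_mul, integral_affine_mul]
    rw [add_sub_add_left_eq_sub, ← mul_sub, ← Finset.sum_sub_distrib, Finset.mul_sum]
    exact Finset.sum_congr rfl fun k _ => by ring
  hasDeriv_dmm t _ x _ m m' := by
    have hinteg : ∀ p : SubProb Ω, ∫ y, ∑ k, β * (e k x * e k y) ∂p.meas
        = ∑ k, β * (e k x * ∫ y, e k y ∂p.meas) := by
      intro p
      rw [integral_finsetSum _ fun k _ => (((he k).integrable p).const_mul (e k x)).const_mul β]
      simp only [integral_const_mul]
    simp only [hinteg]
    rw [intervalIntegral.integral_const, sub_zero, one_smul, ← Finset.sum_sub_distrib,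
      ← Finset.sum_sub_distrib]
    exact Finset.sum_congr rfl fun k _ => by ring
  dm_mem t _ m := (IsCcOn.finsetSum _ _ he).of_le le_top
  dmm_mem t _ m := (IsCcOn.finsetSum _ _ fun k => (he k).prodMul).of_le le_top
  continuous_dm := by
    refine continuousBoundedInC_sum (S := Ω) (fun i => (he i).of_le le_top) (fun i => ?_) fun i => ?_
    · exact continuous_const.mul (((he i).continuous_integral hΩ).sub continuous_const)
    · obtain ⟨B, hB⟩ := (he i).exists_integral_bound
      refine ⟨|β| * (B + |c i|), fun m => ?_⟩
      rw [abs_mul]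
      refine mul_le_mul_of_nonneg_left ((abs_sub _ _).trans ?_) (abs_nonneg _)
      exact add_le_add_left (hB m) _
  continuous_dmm := by
    refine continuousBoundedInC_sum (S := Ω ×ˢ Ω) (a := fun _ _ => β)
      (fun i => ((he i).prodMul).of_le le_top)
      (fun i => continuous_const) fun i => ⟨|β|, fun _ => le_rfl⟩

/-! ### The comparison of the two Hamiltonians -/

lemma gradient_finsetSum {N : ℕ} {e : Fin N → EuclideanSpace ℝ (Fin d) → ℝ}
    (he : ∀ k, IsCcOn ⊤ Ω (e k)) (a : Fin N → ℝ) (x : EuclideanSpace ℝ (Fin d)) :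
    ∇ (fun x => ∑ k, a k * e k x) x = ∑ k, a k • ∇ (e k) x := by
  simp only [gradient]
  rw [fderiv_fun_sum fun k _ => ((he k).differentiable x).const_mul (a k), map_sum]
  refine Finset.sum_congr rfl fun k _ => ?_
  rw [fderiv_const_mul ((he k).differentiable x), map_smul]

lemma integrable_inner_of_memLp {α F : Type*} {_ : MeasurableSpace α} [NormedAddCommGroup F]
    [InnerProductSpace ℝ F] {μ : Measure α} {f g : α → F} (hf : MemLp f 2 μ) (hg : MemLp g 2 μ) :
    Integrable (fun x => inner ℝ (f x) (g x)) μ := by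
  refine (L2.integrable_inner (𝕜 := ℝ) (hf.toLp f) (hg.toLp g)).congr ?_
  filter_upwards [hf.coeFn_toLp, hg.coeFn_toLp] with x h1 h2
  rw [h1, h2]

lemma integral_norm_sub_sq_le {α F : Type*} {_ : MeasurableSpace α} [NormedAddCommGroup F]
    {μ : Measure α} {f g : α → F} (hf : MemLp f 2 μ) (hg : MemLp g 2 μ) :
    ∫ x, ‖f x - g x‖ ^ 2 ∂μ ≤ 2 * (∫ x, ‖f x‖ ^ 2 ∂μ + ∫ x, ‖g x‖ ^ 2 ∂μ) := by
  have hi1 := hf.integrable_norm_pow (p := 2) (by norm_num)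
  have hi2 := hg.integrable_norm_pow (p := 2) (by norm_num)
  rw [← integral_add hi1 hi2, ← integral_const_mul]
  refine integral_mono ((hf.sub hg).integrable_norm_pow (p := 2) (by norm_num))
    ((hi1.add hi2).const_mul 2) fun x => ?_
  show ‖f x - g x‖ ^ 2 ≤ 2 * (‖f x‖ ^ 2 + ‖g x‖ ^ 2)
  have h1 := norm_sub_le (f x) (g x)
  have h2 := pow_le_pow_left₀ (norm_nonneg _) h1 2
  nlinarith [sq_nonneg (‖f x‖ - ‖g x‖)]

lemma exists_hamiltonian_bound (hΩ : IsSmoothBoundedDomain Ω)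
    {H : EuclideanSpace ℝ (Fin d) → EuclideanSpace ℝ (Fin d) → ℝ} {K : ℝ≥0}
    (hH : LipschitzOnWith K
      (fun z : EuclideanSpace ℝ (Fin d) × EuclideanSpace ℝ (Fin d) => H z.1 z.2) (Ω ×ˢ univ)) :
    ∃ C : ℝ, 0 ≤ C ∧ ∀ x ∈ Ω, ∀ p, |H x p| ≤ C + K * ‖p‖ := by
  obtain ⟨x₀, hx₀⟩ := hΩ.isConnected.nonempty
  obtain ⟨D, hD⟩ := Metric.isBounded_iff.1 hΩ.isBounded
  have hD0 : 0 ≤ D := dist_nonneg.trans (hD hx₀ hx₀)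
  refine ⟨|H x₀ 0| + K * D, by positivity, fun x hx p => ?_⟩
  have h1 := hH.dist_le_mul (x, p) ⟨hx, mem_univ _⟩ (x₀, 0) ⟨hx₀, mem_univ _⟩
  rw [Real.dist_eq, Prod.dist_eq] at h1
  have h2 : max (dist x x₀) (dist p 0) ≤ D + ‖p‖ := by
    rw [dist_zero_right]
    exact max_le ((hD hx hx₀).trans (by linarith [norm_nonneg p])) (by linarith)
  have h3 : |H x p| ≤ |H x₀ 0| + |H x p - H x₀ 0| := by
    have := abs_sub_abs_le_abs_sub (H x p) (H x₀ 0)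
    linarith
  have h4 : (K : ℝ) * max (dist x x₀) (dist p 0) ≤ K * (D + ‖p‖) := by gcongr
  simp only at h1
  linarith

lemma memLp_hamiltonian (hΩ : IsSmoothBoundedDomain Ω)
    {H : EuclideanSpace ℝ (Fin d) → EuclideanSpace ℝ (Fin d) → ℝ} {K : ℝ≥0}
    (hH : LipschitzOnWith K
      (fun z : EuclideanSpace ℝ (Fin d) × EuclideanSpace ℝ (Fin d) => H z.1 z.2) (Ω ×ˢ univ))
    {φ : EuclideanSpace ℝ (Fin d) → ℝ} (hφ : IsCcOn ⊤ Ω φ) :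
    MemLp (fun x => H x (∇ φ x)) 2 (volume.restrict Ω) := by
  have := hΩ.isFiniteMeasure
  obtain ⟨C, hC, hb⟩ := exists_hamiltonian_bound hΩ hH
  obtain ⟨B, hB⟩ := hφ.continuous_gradient.bounded_above_of_compact_support
    hφ.hasCompactSupport_gradient
  have hc : ContinuousOn (fun x => H x (∇ φ x)) Ω :=
    hH.continuousOn.comp (continuous_id.prodMk hφ.continuous_gradient).continuousOn
      fun x hx => ⟨hx, mem_univ _⟩
  refine MemLp.of_bound (hc.aestronglyMeasurable hΩ.isOpen.measurableSet) (C + K * B) ?_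
  filter_upwards [ae_restrict_mem hΩ.isOpen.measurableSet] with x hx
  refine (hb x hx _).trans ?_
  have := hB x
  gcongr

lemma abs_integral_mul_hamiltonian_le (hΩ : IsSmoothBoundedDomain Ω)
    {H : EuclideanSpace ℝ (Fin d) → EuclideanSpace ℝ (Fin d) → ℝ} {K : ℝ≥0}
    {C : ℝ} (hC : 0 ≤ C) (hHb : ∀ x ∈ Ω, ∀ p, |H x p| ≤ C + K * ‖p‖)
    {φ u : EuclideanSpace ℝ (Fin d) → ℝ} (hφ : IsCcOn ⊤ Ω φ)
    (hu2 : MemLp u 2 (volume.restrict Ω)) :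
    |∫ x in Ω, u x * H x (∇ φ x)|
      ≤ C * (√((volume.restrict Ω).real univ) * √(∫ x in Ω, u x ^ 2))
        + K * (√(∫ x in Ω, u x ^ 2) * √(∫ x in Ω, ‖∇ φ x‖ ^ 2)) := by
  have := hΩ.isFiniteMeasure
  have hgφ2 := hφ.memLp_gradient 2 (volume.restrict Ω)
  have hi1 : Integrable (fun x => |u x|) (volume.restrict Ω) := (hu2.integrable (by norm_num)).abs
  have hi2 : Integrable (fun x => |u x| * ‖∇ φ x‖) (volume.restrict Ω) :=
    hu2.abs.integrable_mul hgφ2.norm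
  have h1 : |∫ x in Ω, u x * H x (∇ φ x)|
      ≤ ∫ x in Ω, (C * |u x| + K * (|u x| * ‖∇ φ x‖)) := by
    rw [← Real.norm_eq_abs]
    refine norm_integral_le_of_norm_le ((hi1.const_mul C).add (hi2.const_mul K)) ?_
    filter_upwards [ae_restrict_mem hΩ.isOpen.measurableSet] with x hx
    rw [Real.norm_eq_abs, abs_mul]
    calc |u x| * |H x (∇ φ x)| ≤ |u x| * (C + K * ‖∇ φ x‖) :=
          mul_le_mul_of_nonneg_left (hHb x hx _) (abs_nonneg _)
      _ = _ := by ring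
  rw [integral_add (hi1.const_mul C) (hi2.const_mul K), integral_const_mul,
    integral_const_mul] at h1
  refine h1.trans (add_le_add (mul_le_mul_of_nonneg_left ?_ hC)
    (mul_le_mul_of_nonneg_left ?_ K.coe_nonneg))
  · have h2 := abs_integral_mul_le (μ := volume.restrict Ω) (f := fun _ => (1 : ℝ))
      (g := fun x => |u x|) (memLp_const 1) hu2.abs
    simp only [one_mul, one_pow, integral_const, smul_eq_mul, mul_one, sq_abs] at h2
    exact (le_abs_self _).trans h2
  · have h2 := abs_integral_mul_le (f := fun x => |u x|) (g := fun x => ‖∇ φ x‖) hu2.abs hgφ2.norm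
    simp only [sq_abs] at h2
    exact (le_abs_self _).trans h2

lemma penalization_arith {ε η C K s U U2 G2 G q r A P Hd : ℝ} (hε : 0 < ε)
    (hη : 0 < η) (hη1 : η ≤ 1 / 2) (hU20 : 0 ≤ U2) (hU : U = √U2) (hr : r = √q) (hq0 : 0 ≤ q)
    (hG20 : 0 ≤ G2) (hs : 0 ≤ s) (hG : G2 ≤ 2 * G) (hA : U2 - U * (η * √(U2 + G2)) ≤ A)
    (hP : P = -(ε⁻¹ * (A - q)))
    (hH : |Hd| ≤ C * (√s * U) + K * (U * (ε⁻¹ * r))) :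
    P - Hd ≤ 2 * η ^ 2 / ε * G + (1 + K ^ 2) * (q / ε) + C ^ 2 * s * ε := by
  set Y := √(U2 + G2) with hY
  have hUU : U ^ 2 = U2 := by rw [hU, Real.sq_sqrt hU20]
  have hYY : Y ^ 2 = U2 + G2 := Real.sq_sqrt (by positivity)
  have hrr : r ^ 2 = q := by rw [hr, Real.sq_sqrt hq0]
  have hss : √s ^ 2 = s := Real.sq_sqrt hs
  have hηη : η ^ 2 ≤ 1 / 4 := by nlinarith
  have hHt := (abs_le.1 hH).1
  have e1 : U * (η * Y) ≤ U ^ 2 / 4 + η ^ 2 * Y ^ 2 := by nlinarith [sq_nonneg (U / 2 - η * Y)]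
  have e2 : K * (U * r) ≤ U ^ 2 / 4 + K ^ 2 * r ^ 2 := by
    nlinarith [sq_nonneg (U / 2 - K * r)]
  have e3 : ε * (C * (√s * U)) ≤ U ^ 2 / 4 + C ^ 2 * √s ^ 2 * ε ^ 2 := by
    nlinarith [sq_nonneg (U / 2 - ε * C * √s)]
  have e4 : η ^ 2 * U2 ≤ 1 / 4 * U2 := mul_le_mul_of_nonneg_right hηη hU20
  have e5 : η ^ 2 * G2 ≤ η ^ 2 * (2 * G) := mul_le_mul_of_nonneg_left hG (sq_nonneg _)
  have hfin : ε * (P - Hd) ≤ 2 * η ^ 2 * G + (1 + K ^ 2) * q + C ^ 2 * s * ε ^ 2 := by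
    have h1 : ε * P = q - A := by
      rw [hP]
      field_simp
      ring
    have h2 : ε * -Hd ≤ ε * (C * (√s * U)) + K * (U * r) := by
      have h3 : ε * -Hd ≤ ε * (C * (√s * U) + K * (U * (ε⁻¹ * r))) :=
        mul_le_mul_of_nonneg_left (by linarith) hε.le
      refine h3.trans (le_of_eq ?_)
      field_simp
    rw [sub_eq_add_neg, mul_add, h1]
    rw [hYY] at e1
    rw [hrr] at e2
    rw [hss] at e3
    linarith
  have hdiv : 2 * η ^ 2 / ε * G + (1 + K ^ 2) * (q / ε) + C ^ 2 * s * ε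
      = ε⁻¹ * (2 * η ^ 2 * G + (1 + K ^ 2) * q + C ^ 2 * s * ε ^ 2) := by
    field_simp
  rw [hdiv, ← mul_le_mul_iff_of_pos_left hε, mul_inv_cancel_left₀ hε.ne']
  exact hfin

/-- The estimate on which uniqueness rests: for the gradient of the quadratic penalization, the
difference of the two Hamiltonians is controlled by the penalization. -/
theorem hamiltonian_sub_le (hΩ : IsSmoothBoundedDomain Ω)
    {H : EuclideanSpace ℝ (Fin d) → EuclideanSpace ℝ (Fin d) → ℝ} {K : ℝ≥0}
    (hH : LipschitzOnWith K
      (fun z : EuclideanSpace ℝ (Fin d) × EuclideanSpace ℝ (Fin d) => H z.1 z.2) (Ω ×ˢ univ))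
    {C : ℝ} (hC : 0 ≤ C) (hHb : ∀ x ∈ Ω, ∀ p, |H x p| ≤ C + K * ‖p‖)
    {η : ℝ} (hη : 0 < η) (hη1 : η ≤ 1 / 2) {ε : ℝ} (hε : 0 < ε) {N : ℕ}
    {e : Fin N → EuclideanSpace ℝ (Fin d) → ℝ} (he : ∀ k, IsCcOn ⊤ Ω (e k))
    (horth : ∀ a : Fin N → ℝ, (∫ x in Ω, (∑ k, a k * e k x) ^ 2)
        + (∫ x in Ω, ‖∑ k, a k • ∇ (e k) x‖ ^ 2) = ∑ k, a k ^ 2)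
    (hgal : ∀ u g, IsH01 Ω u g → ∀ b : Fin N → ℝ,
        (∀ k, b k = (∫ x in Ω, u x * e k x) + ∫ x in Ω, inner ℝ (g x) (∇ (e k) x)) →
        ∑ k, b k ^ 2 ≤ (∫ x in Ω, u x ^ 2) + (∫ x in Ω, ‖g x‖ ^ 2) ∧
        (∫ x in Ω, (u x - ∑ k, b k * e k x) ^ 2)
          ≤ η ^ 2 * ((∫ x in Ω, u x ^ 2) + ∫ x in Ω, ‖g x‖ ^ 2))
    {m n : SubProb Ω} (hm : m.InL2) (hn : n.InL2)
    {gm gn : EuclideanSpace ℝ (Fin d) → EuclideanSpace ℝ (Fin d)}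
    (hgm : IsH01 Ω m.density gm) (hgn : IsH01 Ω n.density gn) {a : Fin N → ℝ}
    (ha : ∀ k, a k = ε⁻¹ * (∫ x, e k x ∂m.meas - ∫ x, e k x ∂n.meas)) :
    (∫ x, Δ (fun x => ∑ k, a k * e k x) x ∂m.meas
        - ∫ x, Δ (fun x => ∑ k, a k * e k x) x ∂n.meas)
      - (∫ x, H x (∇ (fun x => ∑ k, a k * e k x) x) ∂m.meas
        - ∫ x, H x (∇ (fun x => ∑ k, a k * e k x) x) ∂n.meas)
      ≤ 2 * η ^ 2 / ε * ((∫ x in Ω, ‖gm x‖ ^ 2) + ∫ x in Ω, ‖gn x‖ ^ 2)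
        + (1 + (K : ℝ) ^ 2) * ((∑ k, (∫ x, e k x ∂m.meas - ∫ x, e k x ∂n.meas) ^ 2) / ε)
        + C ^ 2 * (volume.restrict Ω).real univ * ε := by
  have := hΩ.isFiniteMeasure
  set φ : EuclideanSpace ℝ (Fin d) → ℝ := fun x => ∑ k, a k * e k x with hφdef
  have hφ : IsCcOn ⊤ Ω φ := IsCcOn.finsetSum _ _ he
  have hgφ : ∀ x, ∇ φ x = ∑ k, a k • ∇ (e k) x := gradient_finsetSum he a
  set u : EuclideanSpace ℝ (Fin d) → ℝ := fun x => m.density x - n.density x with hu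
  set g : EuclideanSpace ℝ (Fin d) → EuclideanSpace ℝ (Fin d) := fun x => gm x - gn x with hg
  have hug : IsH01 Ω u g := hgm.sub hgn
  have hu2 : MemLp u 2 (volume.restrict Ω) := hug.1
  set b : Fin N → ℝ := fun k =>
    (∫ x in Ω, u x * e k x) + ∫ x in Ω, inner ℝ (g x) (∇ (e k) x) with hb
  obtain ⟨-, hB⟩ := hgal u g hug b fun k => rfl
  set Q : Fin N → ℝ := fun k => ∫ x, e k x ∂m.meas - ∫ x, e k x ∂n.meas with hQ
  have hQu : ∀ k, Q k = ∫ x in Ω, u x * e k x := fun k =>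
    SubProb.integral_sub_eq hΩ hm hn ((he k).memLp 2 _)
  set q := ∑ k, Q k ^ 2 with hq
  have hq0 : 0 ≤ q := Finset.sum_nonneg fun k _ => sq_nonneg _
  set U2 := ∫ x in Ω, u x ^ 2 with hU2
  set G2 := ∫ x in Ω, ‖g x‖ ^ 2 with hG2
  have hU20 : 0 ≤ U2 := integral_nonneg fun _ => sq_nonneg _
  have hG20 : 0 ≤ G2 := integral_nonneg fun _ => sq_nonneg _
  -- the second-order term
  have hsum2 : MemLp (fun x => ∑ k, b k * e k x) 2 (volume.restrict Ω) :=
    memLp_finsetSum _ fun i _ => ((he i).memLp 2 _).const_mul (b i)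
  have hΔ : ∫ x, Δ φ x ∂m.meas - ∫ x, Δ φ x ∂n.meas
      = - (ε⁻¹ * ((∑ k, Q k * b k) - q)) := by
    rw [SubProb.integral_sub_eq hΩ hm hn (hφ.memLp_laplacian 2 _)]
    have h1 := hug.integral_mul_laplacian hφ
    have h2 : ∫ x in Ω, inner ℝ (g x) (∇ φ x) = ∑ k, a k * ∫ x in Ω, inner ℝ (g x) (∇ (e k) x) := by
      have hi : ∀ k ∈ Finset.univ, Integrable (fun x => a k * inner ℝ (g x) (∇ (e k) x))
          (volume.restrict Ω) := fun k _ =>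
        (integrable_inner_of_memLp hug.2.1 ((he k).memLp_gradient 2 _)).const_mul _
      simp only [← integral_const_mul]
      rw [← integral_finsetSum _ hi]
      refine integral_congr_ae (Eventually.of_forall fun x => ?_)
      show inner ℝ (g x) (∇ φ x) = _
      rw [hgφ, inner_sum]
      simp only [inner_smul_right]
    have h3 : ∑ k, a k * ∫ x in Ω, inner ℝ (g x) (∇ (e k) x) = ε⁻¹ * ((∑ k, Q k * b k) - q) := by
      rw [hq, ← Finset.sum_sub_distrib, Finset.mul_sum]
      refine Finset.sum_congr rfl fun k _ => ?_
      have h4 : ∫ x in Ω, inner ℝ (g x) (∇ (e k) x) = b k - Q k := by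
        rw [hQu, hb]; ring
      rw [h4, ha]
      ring
    linarith
  have hQb : U2 - √U2 * (η * √(U2 + G2)) ≤ ∑ k, Q k * b k := by
    have h1 : ∑ k, Q k * b k = ∫ x in Ω, u x * ∑ k, b k * e k x := by
      have hi : ∀ k ∈ Finset.univ, Integrable (fun x => u x * (b k * e k x)) (volume.restrict Ω) :=
        fun k _ => hu2.integrable_mul (((he k).memLp 2 _).const_mul (b k))
      simp only [Finset.mul_sum]
      rw [integral_finsetSum _ hi]
      refine Finset.sum_congr rfl fun k _ => ?_
      rw [hQu, mul_comm, ← integral_const_mul]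
      exact integral_congr_ae (Eventually.of_forall fun x => by show _ = _; ring)
    have h2 : ∫ x in Ω, u x * ∑ k, b k * e k x
        = U2 - ∫ x in Ω, u x * (u x - ∑ k, b k * e k x) := by
      have hi : Integrable (fun x => u x * (u x - ∑ k, b k * e k x)) (volume.restrict Ω) :=
        hu2.integrable_mul (hu2.sub hsum2)
      rw [hU2, ← integral_sub hu2.integrable_sq hi]
      exact integral_congr_ae (Eventually.of_forall fun x => by show _ = _; ring)
    have h3 : |∫ x in Ω, u x * (u x - ∑ k, b k * e k x)| ≤ √U2 * (η * √(U2 + G2)) := by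
      refine (abs_integral_mul_le hu2 (hu2.sub hsum2)).trans ?_
      refine mul_le_mul_of_nonneg_left ?_ (Real.sqrt_nonneg _)
      refine (Real.sqrt_le_sqrt hB).trans (le_of_eq ?_)
      rw [Real.sqrt_mul (sq_nonneg _), Real.sqrt_sq hη.le]
    rw [h1, h2]
    linarith [(abs_le.1 h3).2]
  -- the first-order term
  have hHterm : |∫ x, H x (∇ φ x) ∂m.meas - ∫ x, H x (∇ φ x) ∂n.meas|
      ≤ C * (√((volume.restrict Ω).real univ) * √U2) + K * (√U2 * (ε⁻¹ * √q)) := by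
    rw [SubProb.integral_sub_eq hΩ hm hn (memLp_hamiltonian hΩ hH hφ)]
    refine (abs_integral_mul_hamiltonian_le hΩ hC hHb hφ hu2).trans
      (add_le_add le_rfl (mul_le_mul_of_nonneg_left (mul_le_mul_of_nonneg_left ?_
        (Real.sqrt_nonneg _)) K.coe_nonneg))
    have h3 : ∫ x in Ω, ‖∇ φ x‖ ^ 2 ≤ (ε⁻¹) ^ 2 * q := by
      have h4 := horth a
      have h5 : ∑ k, a k ^ 2 = (ε⁻¹) ^ 2 * q := by
        rw [hq, Finset.mul_sum]
        exact Finset.sum_congr rfl fun k _ => by rw [ha k, mul_pow]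
      simp only [hgφ]
      have h6 : 0 ≤ ∫ x in Ω, (∑ k, a k * e k x) ^ 2 := integral_nonneg fun _ => sq_nonneg _
      linarith
    refine (Real.sqrt_le_sqrt h3).trans (le_of_eq ?_)
    rw [Real.sqrt_mul (sq_nonneg _), Real.sqrt_sq (by positivity)]
  have hG : G2 ≤ 2 * ((∫ x in Ω, ‖gm x‖ ^ 2) + ∫ x in Ω, ‖gn x‖ ^ 2) :=
    integral_norm_sub_sq_le hgm.2.1 hgn.2.1
  exact penalization_arith hε hη hη1 hU20 rfl rfl hq0 hG20 measureReal_nonneg hG hQb hΔ hHterm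

/-! ### Doubling of variables in a compact space -/

section Doubling

lemma upperSemicontinuous_sub {X : Type*} [TopologicalSpace X]
    {f g : X → ℝ} (hf : UpperSemicontinuous f) (hg : LowerSemicontinuous g) :
    UpperSemicontinuous fun p : X × X => f p.1 - g p.2 := by
  intro p y hy
  obtain ⟨a, ha, hay⟩ : ∃ a, f p.1 < a ∧ a - g p.2 < y :=
    ⟨(f p.1 + (y + g p.2)) / 2, by linarith, by linarith⟩
  have h1 := (continuous_fst (X := X) (Y := X)).continuousAt.eventually (hf p.1 a ha)
  have h2 := (continuous_snd (X := X) (Y := X)).continuousAt.eventually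
    (hg p.2 (a - y) (by linarith))
  filter_upwards [h1, h2] with q hq1 hq2
  linarith

variable {X : Type*} [PseudoEMetricSpace X] [CompactSpace X]

/-- If `f - g ≤ S` on the diagonal of `B₁ × B₂`, then `f x - g y` is at most `S + τ` near it. -/
lemma exists_sub_lt_of_edist_le {f g : X → ℝ} (hf : UpperSemicontinuous f)
    (hg : LowerSemicontinuous g) {B₁ B₂ : Set X} (hB₁ : IsClosed B₁) (hB₂ : IsClosed B₂) {S : ℝ}
    (hS : ∀ x ∈ B₁, x ∈ B₂ → f x - g x ≤ S) {τ : ℝ} (hτ : 0 < τ) :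
    ∃ ρ : ℝ, 0 < ρ ∧ ∀ x ∈ B₁, ∀ y ∈ B₂, edist x y ≤ ENNReal.ofReal ρ → f x - g y < S + τ := by
  set Z : Set (X × X) := (B₁ ×ˢ B₂) ∩ (fun p : X × X => f p.1 - g p.2) ⁻¹' Ici (S + τ) with hZ
  have hZc : IsClosed Z :=
    (hB₁.prod hB₂).inter ((upperSemicontinuous_sub hf hg).isClosed_preimage _)
  rcases Z.eq_empty_or_nonempty with h0 | hne
  · refine ⟨1, one_pos, fun x hx y hy _ => ?_⟩
    by_contra hcon
    have : (x, y) ∈ Z := ⟨⟨hx, hy⟩, not_lt.1 hcon⟩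
    simp [h0] at this
  obtain ⟨p, hpZ, hp⟩ := hZc.isCompact.exists_isMinOn hne
    (continuous_edist (α := X)).continuousOn
  have hpos : edist p.1 p.2 ≠ 0 := by
    intro h
    have hins : Inseparable p.1 p.2 := EMetric.inseparable_iff.2 h
    have hB : p.1 ∈ B₂ := (hins.mem_closed_iff hB₂).2 hpZ.1.2
    have hgle : g p.1 ≤ g p.2 := by
      by_contra hlt
      exact lt_irrefl (g p.2) (show g p.2 < g p.2 from
        (hins.mem_open_iff (hg.isOpen_preimage (g p.2))).1 (not_le.1 hlt))
    have h1 := hS p.1 hpZ.1.1 hB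
    have h2 : S + τ ≤ f p.1 - g p.2 := hpZ.2
    linarith
  obtain ⟨ρ, hρ, hρlt⟩ := ENNReal.lt_iff_exists_nnreal_btwn.1 (pos_iff_ne_zero.2 hpos)
  refine ⟨ρ, by simpa using hρ, fun x hx y hy hxy => ?_⟩
  by_contra hcon
  have hle : edist p.1 p.2 ≤ edist x y := hp (show (x, y) ∈ Z from ⟨⟨hx, hy⟩, not_lt.1 hcon⟩)
  rw [ENNReal.ofReal_coe_nnreal] at hxy
  exact absurd hρlt (not_lt.2 (hle.trans hxy))

/-- A penalized difference attains its maximum over `A × A`, where `N` is coercive on `A`. -/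
lemma exists_max_doubling {f g : X → ℝ} (hf : UpperSemicontinuous f)
    (hg : LowerSemicontinuous g) {A : Set X} {N : X → ℝ} (hN : ∀ x, 0 ≤ N x)
    (hA : ∀ R, IsClosed {x | x ∈ A ∧ N x ≤ R}) (hne : A.Nonempty) {M : ℝ}
    (hM : ∀ x y, f x - g y ≤ M) {P : X × X → ℝ} (hP : Continuous P) (hP0 : ∀ p, 0 ≤ P p)
    {δ : ℝ} (hδ : 0 < δ) :
    ∃ x₀ ∈ A, ∃ y₀ ∈ A, ∀ x ∈ A, ∀ y ∈ A,
      f x - g y - δ * (N x + N y) - P (x, y) ≤ f x₀ - g y₀ - δ * (N x₀ + N y₀) - P (x₀, y₀) := by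
  obtain ⟨a, ha⟩ := hne
  set Ψ : X × X → ℝ := fun p => f p.1 - g p.2 - δ * (N p.1 + N p.2) - P p with hΨ
  set R : ℝ := max (N a) ((M - Ψ (a, a)) / δ) with hR
  set B : Set X := {x | x ∈ A ∧ N x ≤ R} with hB
  have haB : a ∈ B := ⟨ha, le_max_left _ _⟩
  have hout : ∀ x y, R < N x + N y → Ψ (x, y) ≤ Ψ (a, a) := by
    intro x y h
    have h1 : M - Ψ (a, a) ≤ R * δ := (div_le_iff₀ hδ).1 (le_max_right _ _)
    have h2 : R * δ ≤ (N x + N y) * δ := mul_le_mul_of_nonneg_right h.le hδ.le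
    have h3 := hM x y
    have h4 := hP0 (x, y)
    simp only [hΨ] at h1 ⊢
    linarith
  have husc : UpperSemicontinuousOn Ψ (B ×ˢ B) := by
    rintro p ⟨hp1, hp2⟩ y hy
    obtain ⟨c, hc, hcy⟩ : ∃ c, 0 < c ∧ Ψ p + (2 * δ + 2) * c < y := by
      refine ⟨(y - Ψ p) / (2 * (2 * δ + 2)), div_pos (by linarith) (by linarith), ?_⟩
      have h : (2 * δ + 2) * ((y - Ψ p) / (2 * (2 * δ + 2))) = (y - Ψ p) / 2 := by
        field_simp
      linarith
    have hlsc : ∀ x, ∀ᶠ x' in 𝓝 x, x' ∈ A → N x - c < N x' := by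
      intro x
      have hx : x ∈ {x' | x' ∈ A ∧ N x' ≤ N x - c}ᶜ := fun h => by linarith [h.2]
      filter_upwards [(hA (N x - c)).isOpen_compl.mem_nhds hx] with x' hx' hx'A
      by_contra hcon
      exact hx' ⟨hx'A, not_lt.1 hcon⟩
    have h1 := (upperSemicontinuous_sub hf hg) p (f p.1 - g p.2 + c) (by linarith)
    have h2 := (continuous_fst (X := X) (Y := X)).continuousAt.eventually (hlsc p.1)
    have h3 := (continuous_snd (X := X) (Y := X)).continuousAt.eventually (hlsc p.2)
    have h4 : ∀ᶠ q in 𝓝 p, P p - c < P q :=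
      hP.continuousAt.eventually (lt_mem_nhds (by linarith))
    filter_upwards [h1.filter_mono nhdsWithin_le_nhds, h2.filter_mono nhdsWithin_le_nhds,
      h3.filter_mono nhdsWithin_le_nhds, h4.filter_mono nhdsWithin_le_nhds,
      self_mem_nhdsWithin] with q hq1 hq2 hq3 hq4 hq
    have h5 := mul_lt_mul_of_pos_left (hq2 hq.1.1) hδ
    have h6 := mul_lt_mul_of_pos_left (hq3 hq.2.1) hδ
    simp only [hΨ] at hcy ⊢
    linarith
  obtain ⟨p, hp, hmax⟩ := husc.exists_isMaxOn (s := B ×ˢ B) ⟨(a, a), haB, haB⟩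
    ((hA R).isCompact.prod (hA R).isCompact)
  refine ⟨p.1, hp.1.1, p.2, hp.2.1, fun x hx y hy => ?_⟩
  show Ψ (x, y) ≤ Ψ p
  by_cases h : R < N x + N y
  · exact (hout x y h).trans (hmax (show (a, a) ∈ B ×ˢ B from ⟨haB, haB⟩))
  · exact hmax (show (x, y) ∈ B ×ˢ B from
      ⟨⟨hx, by linarith [hN y]⟩, ⟨hy, by linarith [hN x]⟩⟩)

end Doubling

/-! ### The viscosity inequalities at a doubled maximum -/

theorem le_of_doubled_max (hΩ : IsSmoothBoundedDomain Ω) {T : ℝ}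
    {H : EuclideanSpace ℝ (Fin d) → EuclideanSpace ℝ (Fin d) → ℝ} {K : ℝ≥0}
    (hH : LipschitzOnWith K
      (fun z : EuclideanSpace ℝ (Fin d) × EuclideanSpace ℝ (Fin d) => H z.1 z.2) (Ω ×ˢ univ))
    {C : ℝ} (hC : 0 ≤ C) (hHb : ∀ x ∈ Ω, ∀ p, |H x p| ≤ C + K * ‖p‖)
    {F : SubProb Ω → ℝ} {Vm Vp : ℝ → SubProb Ω → ℝ} {Cm Cp δ : ℝ} (hδ : 0 < δ)
    (hVm : ∀ (Φ : SmoothTestFunction T Ω) (δ : ℝ), 0 < δ →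
      ∀ t₀ ∈ Ico 0 T, ∀ m₀ : SubProb Ω, m₀.InL2 →
      IsMaxOn (fun p : ℝ × SubProb Ω => Vm p.1 p.2 - Φ.toFun p.1 p.2 - δ * p.2.l2NormSq)
        (Icc 0 T ×ˢ {m | m.InL2}) (t₀, m₀) →
      ∃ g, IsH01 Ω m₀.density g ∧
        - Φ.dt t₀ m₀ + δ * (∫ x in Ω, ‖g x‖ ^ 2) - (∫ x, Δ (Φ.dm t₀ m₀) x ∂m₀.meas)
          + (∫ x, H x (∇ (Φ.dm t₀ m₀) x) ∂m₀.meas) ≤ F m₀ + Cm * δ * m₀.l2NormSq)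
    (hVp : ∀ (Φ : SmoothTestFunction T Ω) (δ : ℝ), 0 < δ →
      ∀ t₀ ∈ Ico 0 T, ∀ m₀ : SubProb Ω, m₀.InL2 →
      IsMinOn (fun p : ℝ × SubProb Ω => Vp p.1 p.2 - Φ.toFun p.1 p.2 + δ * p.2.l2NormSq)
        (Icc 0 T ×ˢ {m | m.InL2}) (t₀, m₀) →
      ∃ g, IsH01 Ω m₀.density g ∧
        F m₀ - Cp * δ * m₀.l2NormSq ≤
          - Φ.dt t₀ m₀ - δ * (∫ x in Ω, ‖g x‖ ^ 2) - (∫ x, Δ (Φ.dm t₀ m₀) x ∂m₀.meas)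
            + (∫ x, H x (∇ (Φ.dm t₀ m₀) x) ∂m₀.meas))
    {η : ℝ} (hη : 0 < η) (hη1 : η ≤ 1 / 2) {ε : ℝ} (hε : 0 < ε) (hηδ : 2 * η ^ 2 / ε ≤ δ) {N : ℕ}
    {e : Fin N → EuclideanSpace ℝ (Fin d) → ℝ} (he : ∀ k, IsCcOn ⊤ Ω (e k))
    (horth : ∀ a : Fin N → ℝ, (∫ x in Ω, (∑ k, a k * e k x) ^ 2)
        + (∫ x in Ω, ‖∑ k, a k • ∇ (e k) x‖ ^ 2) = ∑ k, a k ^ 2)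
    (hgal : ∀ u g, IsH01 Ω u g → ∀ b : Fin N → ℝ,
        (∀ k, b k = (∫ x in Ω, u x * e k x) + ∫ x in Ω, inner ℝ (g x) (∇ (e k) x)) →
        ∑ k, b k ^ 2 ≤ (∫ x in Ω, u x ^ 2) + (∫ x in Ω, ‖g x‖ ^ 2) ∧
        (∫ x in Ω, (u x - ∑ k, b k * e k x) ^ 2)
          ≤ η ^ 2 * ((∫ x in Ω, u x ^ 2) + ∫ x in Ω, ‖g x‖ ^ 2))
    {l t₀ s₀ : ℝ} (ht₀ : t₀ ∈ Ico 0 T) (hs₀ : s₀ ∈ Ico 0 T) {m₀ n₀ : SubProb Ω}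
    (hm₀ : m₀.InL2) (hn₀ : n₀.InL2)
    (hmax : ∀ t ∈ Icc 0 T, ∀ m : SubProb Ω, m.InL2 → ∀ s ∈ Icc 0 T, ∀ n : SubProb Ω, n.InL2 →
      (Vm t m - l * (T - t)) - Vp s n - δ * (m.l2NormSq + n.l2NormSq)
        - ε⁻¹ / 2 * ((t - s) ^ 2 + ∑ k, (∫ x, e k x ∂m.meas - ∫ x, e k x ∂n.meas) ^ 2)
      ≤ (Vm t₀ m₀ - l * (T - t₀)) - Vp s₀ n₀ - δ * (m₀.l2NormSq + n₀.l2NormSq)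
        - ε⁻¹ / 2 * ((t₀ - s₀) ^ 2
          + ∑ k, (∫ x, e k x ∂m₀.meas - ∫ x, e k x ∂n₀.meas) ^ 2)) :
    l ≤ F m₀ - F n₀ + Cm * (δ * m₀.l2NormSq) + Cp * (δ * n₀.l2NormSq)
      + (1 + (K : ℝ) ^ 2) * ((∑ k, (∫ x, e k x ∂m₀.meas - ∫ x, e k x ∂n₀.meas) ^ 2) / ε)
      + C ^ 2 * (volume.restrict Ω).real univ * ε := by
  set a : Fin N → ℝ := fun k => ε⁻¹ * (∫ x, e k x ∂m₀.meas - ∫ x, e k x ∂n₀.meas) with ha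
  have hα : ∀ t, HasDerivAt (fun t => ε⁻¹ / 2 * (t - s₀) ^ 2 + l * (T - t))
      (ε⁻¹ * (t - s₀) - l) t := by
    intro t
    have h1 := (((hasDerivAt_id t).sub_const s₀).pow 2).const_mul (ε⁻¹ / 2)
    have h2 := ((hasDerivAt_id t).const_sub T).const_mul l
    refine (h1.add h2).congr_deriv ?_
    simp
    ring
  have hβ : ∀ s, HasDerivAt (fun s => -(ε⁻¹ / 2 * (t₀ - s) ^ 2)) (ε⁻¹ * (t₀ - s)) s := by
    intro s
    have h1 := ((((hasDerivAt_id s).const_sub t₀).pow 2).const_mul (ε⁻¹ / 2)).neg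
    refine h1.congr_deriv ?_
    simp
    ring
  obtain ⟨gm, hgm, hsub⟩ := hVm
    (quadTest T hΩ.isOpen hα (by fun_prop) ε⁻¹ he fun k => ∫ x, e k x ∂n₀.meas)
    δ hδ t₀ ht₀ m₀ hm₀ (by
      rintro ⟨t, m⟩ ⟨ht, hm⟩
      have := hmax t ht m hm s₀ ⟨hs₀.1, hs₀.2.le⟩ n₀ hn₀
      simp only [quadTest, mem_ofPred_eq]
      linarith)
  obtain ⟨gn, hgn, hsup⟩ := hVp
    (quadTest T hΩ.isOpen hβ (by fun_prop) (-ε⁻¹) he fun k => ∫ x, e k x ∂m₀.meas)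
    δ hδ s₀ hs₀ n₀ hn₀ (by
      rintro ⟨s, n⟩ ⟨hs, hn⟩
      have := hmax t₀ ⟨ht₀.1, ht₀.2.le⟩ m₀ hm₀ s hs n hn
      have hsq : ∀ n : SubProb Ω, ∑ k, (∫ x, e k x ∂n.meas - ∫ x, e k x ∂m₀.meas) ^ 2
          = ∑ k, (∫ x, e k x ∂m₀.meas - ∫ x, e k x ∂n.meas) ^ 2 := fun n =>
        Finset.sum_congr rfl fun k _ => by ring
      simp only [quadTest, mem_ofPred_eq, hsq]
      linarith)
  have hdm : (quadTest T hΩ.isOpen hβ (by fun_prop) (-ε⁻¹) he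
      fun k => ∫ x, e k x ∂m₀.meas).dm s₀ n₀ = fun x => ∑ k, a k * e k x := by
    funext x
    simp only [quadTest, ha]
    exact Finset.sum_congr rfl fun k _ => by ring
  rw [hdm] at hsup
  have hsub' : -(ε⁻¹ * (t₀ - s₀) - l) + δ * (∫ x in Ω, ‖gm x‖ ^ 2)
      - (∫ x, Δ (fun x => ∑ k, a k * e k x) x ∂m₀.meas)
      + (∫ x, H x (∇ (fun x => ∑ k, a k * e k x) x) ∂m₀.meas)
      ≤ F m₀ + Cm * δ * m₀.l2NormSq := hsub
  have hsup' : F n₀ - Cp * δ * n₀.l2NormSq ≤ -(ε⁻¹ * (t₀ - s₀)) - δ * (∫ x in Ω, ‖gn x‖ ^ 2)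
      - (∫ x, Δ (fun x => ∑ k, a k * e k x) x ∂n₀.meas)
      + (∫ x, H x (∇ (fun x => ∑ k, a k * e k x) x) ∂n₀.meas) := hsup
  have hham := hamiltonian_sub_le hΩ hH hC hHb hη hη1 hε he horth hgal hm₀ hn₀ hgm hgn
    (a := a) fun k => rfl
  have hg0 : 0 ≤ (∫ x in Ω, ‖gm x‖ ^ 2) + ∫ x in Ω, ‖gn x‖ ^ 2 :=
    add_nonneg (integral_nonneg fun _ => by positivity) (integral_nonneg fun _ => by positivity)
  have habs := mul_le_mul_of_nonneg_right hηδ hg0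
  linarith

/-! ### The comparison principle -/

lemma tendsto_coe_prod {T : ℝ} (x : Icc (0 : ℝ) T × SubProb Ω) :
    Tendsto (fun x : Icc (0 : ℝ) T × SubProb Ω => ((x.1 : ℝ), x.2)) (𝓝 x)
      (𝓝[Icc 0 T ×ˢ univ] ((x.1 : ℝ), x.2)) :=
  tendsto_nhdsWithin_iff.2 ⟨(by fun_prop : Continuous fun x : Icc (0 : ℝ) T × SubProb Ω =>
    ((x.1 : ℝ), x.2)).tendsto x, Eventually.of_forall fun x => ⟨x.1.2, mem_univ _⟩⟩

lemma upperSemicontinuous_sub_time {T l : ℝ} {V : ℝ → SubProb Ω → ℝ}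
    (hV : UpperSemicontinuousOn (fun p : ℝ × SubProb Ω => V p.1 p.2) (Icc 0 T ×ˢ univ)) :
    UpperSemicontinuous fun x : Icc (0 : ℝ) T × SubProb Ω => V x.1 x.2 - l * (T - x.1) := by
  have h1 : UpperSemicontinuous fun x : Icc (0 : ℝ) T × SubProb Ω => V x.1 x.2 := fun x y hy =>
    (tendsto_coe_prod x).eventually (hV (x.1, x.2) ⟨x.1.2, mem_univ _⟩ y hy)
  have h2 : Continuous fun x : Icc (0 : ℝ) T × SubProb Ω => -(l * (T - x.1)) := by fun_prop
  simpa only [sub_eq_add_neg] using h1.add h2.upperSemicontinuous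

lemma lowerSemicontinuous_coe_prod {T : ℝ} {V : ℝ → SubProb Ω → ℝ}
    (hV : LowerSemicontinuousOn (fun p : ℝ × SubProb Ω => V p.1 p.2) (Icc 0 T ×ˢ univ)) :
    LowerSemicontinuous fun x : Icc (0 : ℝ) T × SubProb Ω => V x.1 x.2 := fun x y hy =>
  (tendsto_coe_prod x).eventually (hV (x.1, x.2) ⟨x.1.2, mem_univ _⟩ y hy)

lemma exists_sub_le {X : Type*} [PseudoEMetricSpace X] [CompactSpace X] {f g : X → ℝ}
    (hf : UpperSemicontinuous f) (hg : LowerSemicontinuous g) :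
    ∃ M, ∀ x y, f x - g y ≤ M := by
  rcases isEmpty_or_nonempty (X × X) with h | ⟨⟨p⟩⟩
  · exact ⟨0, fun x y => (h.false (x, y)).elim⟩
  obtain ⟨q, -, hq⟩ := ((upperSemicontinuous_sub hf hg).upperSemicontinuousOn univ).exists_isMaxOn
    ⟨p, mem_univ _⟩ isCompact_univ
  exact ⟨f q.1 - g q.2, fun x y => hq (mem_univ (x, y))⟩

lemma exists_penalization_parameters {ρ δ c b M R : ℝ} (hρ : 0 < ρ) (hδ : 0 < δ) (hb : 0 < b)
    (C : ℝ) :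
    ∃ ε > 0, ∃ η > 0, √(2 * ε * M) ≤ ρ ∧ c * ε ≤ b ∧ η ≤ 1 / 2 ∧ 2 * η ^ 2 / ε ≤ δ ∧
      C * (√(2 * ε * M) + η * √(2 * R)) ≤ ρ := by
  have ht : ∀ {u : ℝ → ℝ} {B : ℝ}, Continuous u → u 0 < B → ∀ᶠ ε in 𝓝[>] (0 : ℝ), u ε ≤ B :=
    fun {u B} hu h => ((hu.tendsto 0).eventually_le_const h).filter_mono nhdsWithin_le_nhds
  obtain ⟨ε, ⟨h1, h2, h3⟩, hε⟩ := ((((ht (u := fun ε => √(2 * ε * M)) (B := ρ) (by fun_prop)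
    (by simpa)).and ((ht (u := fun ε => c * ε) (B := b) (by fun_prop) (by simpa)).and
    (ht (u := fun ε => C * √(2 * ε * M)) (B := ρ / 2) (by fun_prop)
      (by simpa)))).and self_mem_nhdsWithin)).exists
  obtain ⟨η, ⟨h4, h5, h6⟩, hη⟩ := ((((ht (u := fun η => η) (B := 1 / 2) (by fun_prop)
    (by norm_num)).and ((ht (u := fun η => 2 * η ^ 2 / ε) (B := δ) (by fun_prop) (by simpa)).and
    (ht (u := fun η => C * (η * √(2 * R))) (B := ρ / 2) (by fun_prop)
      (by simpa)))).and self_mem_nhdsWithin)).exists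
  exact ⟨ε, hε, η, hη, h1, h2, h4, h5, by linarith⟩

lemma integral_density_sub_sq_le {m n : SubProb Ω} (hm : m.InL2) (hn : n.InL2) :
    ∫ x in Ω, (m.density x - n.density x) ^ 2 ≤ 2 * (m.l2NormSq + n.l2NormSq) := by
  simpa only [SubProb.l2NormSq, Real.norm_eq_abs, sq_abs] using integral_norm_sub_sq_le hm.2 hn.2

theorem comparison_inL2 (hd : 0 < d) {T : ℝ} (hT : 0 < T) (hΩ : IsSmoothBoundedDomain Ω)
    {H : EuclideanSpace ℝ (Fin d) → EuclideanSpace ℝ (Fin d) → ℝ} {K : ℝ≥0}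
    (hH : LipschitzOnWith K
      (fun z : EuclideanSpace ℝ (Fin d) × EuclideanSpace ℝ (Fin d) => H z.1 z.2) (Ω ×ˢ univ))
    {F G : SubProb Ω → ℝ} {L : ℝ≥0} (hF : LipschitzWith L F) {Vm Vp : ℝ → SubProb Ω → ℝ}
    (hVm : IsViscositySubsolution T Ω H F G Vm) (hVp : IsViscositySupersolution T Ω H F G Vp)
    {t : ℝ} (ht : t ∈ Icc 0 T) {m : SubProb Ω} (hm : m.InL2) : Vm t m ≤ Vp t m := by
  by_contra hcon
  have := compactSpace_subProb hd hΩ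
  obtain ⟨Cm, hCm, hVm'⟩ := hVm.test
  obtain ⟨Cp, hCp, hVp'⟩ := hVp.test
  obtain ⟨C, hC, hHb⟩ := exists_hamiltonian_bound hΩ hH
  obtain ⟨Cg, hCg, hgalerkin⟩ := exists_edist_le_galerkin hd hΩ
  set κ : ℝ := (Vm t m - Vp t m) / 3 with hκ
  have hκ0 : 0 < κ := by rw [hκ]; linarith
  set l : ℝ := κ / T with hl
  have hl0 : 0 < l := div_pos hκ0 hT
  have hlT : ∀ s ∈ Icc 0 T, 0 ≤ l * (T - s) ∧ l * (T - s) ≤ κ := by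
    intro s hs
    have h : l * T = κ := div_mul_cancel₀ _ hT.ne'
    exact ⟨mul_nonneg hl0.le (by linarith [hs.2]), by nlinarith [mul_nonneg hl0.le hs.1]⟩
  set f : Icc (0 : ℝ) T × SubProb Ω → ℝ := fun x => Vm x.1 x.2 - l * (T - x.1) with hf
  set g : Icc (0 : ℝ) T × SubProb Ω → ℝ := fun x => Vp x.1 x.2 with hg
  set A : Set (Icc (0 : ℝ) T × SubProb Ω) := {x | x.2.InL2} with hA
  set n2 : Icc (0 : ℝ) T × SubProb Ω → ℝ := fun x => x.2.l2NormSq with hn2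
  have hn20 : ∀ x, 0 ≤ n2 x := fun x => x.2.l2NormSq_nonneg
  have hfu : UpperSemicontinuous f := upperSemicontinuous_sub_time hVm.usc
  have hgl : LowerSemicontinuous g := lowerSemicontinuous_coe_prod hVp.lsc
  have hAc : ∀ R, IsClosed {x | x ∈ A ∧ n2 x ≤ R} := fun R =>
    (isClosed_l2Ball hd hΩ R).preimage continuous_snd
  obtain ⟨M, hM⟩ := exists_sub_le hfu hgl
  set S : ℝ := sSup ((fun x => f x - g x) '' A) with hS
  have hbdd : BddAbove ((fun x => f x - g x) '' A) := by
    refine ⟨M, ?_⟩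
    rintro _ ⟨x, -, rfl⟩
    exact hM x x
  have hleS : ∀ x ∈ A, f x - g x ≤ S := fun x hx => le_csSup hbdd ⟨x, hx, rfl⟩
  have hxA : ((⟨t, ht⟩, m) : Icc (0 : ℝ) T × SubProb Ω) ∈ A := hm
  have hS2 : 2 * κ ≤ S := by
    refine le_trans ?_ (hleS _ hxA)
    have := (hlT t ht).2
    simp only [hf, hg]
    linarith
  have hden : 0 < 2 * (Cm + Cp) + 4 * (1 + (K : ℝ) ^ 2) := by positivity
  set τ : ℝ := min (κ / 2) (l / 4 / (2 * (Cm + Cp) + 4 * (1 + (K : ℝ) ^ 2))) with hτ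
  have hτ0 : 0 < τ := lt_min (by linarith) (by positivity)
  have hτκ : τ ≤ κ / 2 := min_le_left _ _
  have hτl : τ * (2 * (Cm + Cp) + 4 * (1 + (K : ℝ) ^ 2)) ≤ l / 4 :=
    (le_div_iff₀ hden).1 (min_le_right _ _)
  obtain ⟨_, ⟨x₁, hx₁, rfl⟩, hx₁S⟩ := exists_lt_of_lt_csSup
    (Nonempty.image (fun x => f x - g x) ⟨_, hxA⟩) (show S - τ / 2 < S by linarith)
  set δ : ℝ := τ / (4 * (n2 x₁ + 1)) with hδ
  have hpos1 : 0 < n2 x₁ + 1 := by linarith [hn20 x₁]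
  have hδ0 : 0 < δ := by positivity
  have hδx : δ * (n2 x₁ + n2 x₁) ≤ τ / 2 := by
    have : δ * (4 * (n2 x₁ + 1)) = τ := div_mul_cancel₀ _ (by positivity)
    linarith
  have hMS : S ≤ M := csSup_le (Nonempty.image _ ⟨_, hxA⟩) (by
    rintro _ ⟨x, -, rfl⟩
    exact hM x x)
  set M₁ : ℝ := M - S + τ with hM₁
  set R : ℝ := M₁ / δ with hR
  have hTc : IsClosed {x : Icc (0 : ℝ) T × SubProb Ω | (x.1 : ℝ) = T} :=
    isClosed_eq (by fun_prop) continuous_const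
  have hterm : ∀ x : Icc (0 : ℝ) T × SubProb Ω, (x.1 : ℝ) = T → f x - g x ≤ 0 := by
    intro x hx
    have h1 := hVm.terminal x.2
    have h2 := hVp.terminal x.2
    simp only [hf, hg, hx]
    linarith
  obtain ⟨ρ₁, hρ₁, hD⟩ := exists_sub_lt_of_edist_le hfu hgl (hAc R) (hAc R)
    (fun x hx _ => hleS x hx.1) hτ0
  obtain ⟨ρ₂, hρ₂, hTm⟩ := exists_sub_lt_of_edist_le hfu hgl hTc isClosed_univ
    (fun x hx _ => hterm x hx) hκ0
  obtain ⟨ρ₃, hρ₃, hTp⟩ := exists_sub_lt_of_edist_le hfu hgl isClosed_univ hTc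
    (fun x _ hx => hterm x hx) hκ0
  set ρ : ℝ := min (min ρ₁ ρ₂) (min ρ₃ (l / 4 / (L + 1))) with hρ
  have hL1 : 0 < (L : ℝ) + 1 := by positivity
  have hρ0 : 0 < ρ := lt_min (lt_min hρ₁ hρ₂) (lt_min hρ₃ (by positivity))
  have hρ1 : ρ ≤ ρ₁ := (min_le_left _ _).trans (min_le_left _ _)
  have hρ2 : ρ ≤ ρ₂ := (min_le_left _ _).trans (min_le_right _ _)
  have hρ3 : ρ ≤ ρ₃ := (min_le_right _ _).trans (min_le_left _ _)
  have hρL : L * ρ ≤ l / 4 := by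
    have : ρ * (L + 1) ≤ l / 4 :=
      (le_div_iff₀ hL1).1 ((min_le_right _ _).trans (min_le_right _ _))
    linarith
  obtain ⟨ε, hε, η, hη, hε1, hε2, hη1, hηδ, hηC⟩ := exists_penalization_parameters
    (c := C ^ 2 * (volume.restrict Ω).real univ) (b := l / 4) (M := M₁) (R := R)
    hρ0 hδ0 (by linarith) Cg
  obtain ⟨N, e, he, horth, hgal⟩ := exists_galerkin_family hΩ hη
  set q : SubProb Ω → SubProb Ω → ℝ := fun m n =>
    ∑ k, (∫ x, e k x ∂m.meas - ∫ x, e k x ∂n.meas) ^ 2 with hq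
  have hq0 : ∀ m n, 0 ≤ q m n := fun m n => Finset.sum_nonneg fun k _ => sq_nonneg _
  set P : (Icc (0 : ℝ) T × SubProb Ω) × (Icc (0 : ℝ) T × SubProb Ω) → ℝ := fun p =>
    ε⁻¹ / 2 * (((p.1.1 : ℝ) - p.2.1) ^ 2 + q p.1.2 p.2.2) with hP
  have hPc : Continuous P := by
    have hI : ∀ k, Continuous fun m : SubProb Ω => ∫ x, e k x ∂m.meas := fun k =>
      (he k).continuous_integral hΩ.isOpen
    refine continuous_const.mul (Continuous.add (by fun_prop) ?_)
    exact continuous_finsetSum _ fun k _ => (((hI k).comp (by fun_prop)).sub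
      ((hI k).comp (by fun_prop))).pow 2
  have hP0 : ∀ p, 0 ≤ P p := fun p =>
    mul_nonneg (by positivity) (add_nonneg (sq_nonneg _) (hq0 _ _))
  obtain ⟨x₀, hx₀, y₀, hy₀, hmax⟩ := exists_max_doubling hfu hgl hn20 hAc ⟨_, hxA⟩ hM hPc hP0 hδ0
  have hPx : P (x₁, x₁) = 0 := by simp [hP, hq]
  have hval : S - τ + δ * (n2 x₀ + n2 y₀) + P (x₀, y₀) ≤ f x₀ - g y₀ := by
    have h1 := hmax x₁ hx₁ x₁ hx₁
    rw [hPx] at h1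
    linarith
  have hδn : ∀ x, 0 ≤ δ * n2 x := fun x => mul_nonneg hδ0.le (hn20 x)
  have hPδ : δ * (n2 x₀ + n2 y₀) + P (x₀, y₀) ≤ M₁ := by linarith [hM x₀ y₀]
  have hnR : n2 x₀ + n2 y₀ ≤ R := by
    rw [hR, le_div_iff₀ hδ0]
    linarith [hP0 (x₀, y₀)]
  have hPeq : 2 * ε * P (x₀, y₀) = ((x₀.1 : ℝ) - y₀.1) ^ 2 + q x₀.2 y₀.2 := by
    simp only [hP]
    field_simp
  have hPM : 2 * ε * P (x₀, y₀) ≤ 2 * ε * M₁ :=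
    mul_le_mul_of_nonneg_left (by linarith [hδn x₀, hδn y₀]) (by positivity)
  have hdist : edist x₀ y₀ ≤ ENNReal.ofReal ρ := by
    rw [Prod.edist_eq]
    refine max_le ?_ ?_
    · rw [edist_dist]
      refine ENNReal.ofReal_le_ofReal (le_trans ?_ hε1)
      rw [Subtype.dist_eq, Real.dist_eq]
      exact Real.abs_le_sqrt (by linarith [hq0 x₀.2 y₀.2])
    · refine (hgalerkin η hη N e he hgal x₀.2 y₀.2 hx₀ hy₀).trans
        (ENNReal.ofReal_le_ofReal (le_trans ?_ hηC))
      have h1 : √(q x₀.2 y₀.2) ≤ √(2 * ε * M₁) :=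
        Real.sqrt_le_sqrt (by linarith [sq_nonneg ((x₀.1 : ℝ) - y₀.1)])
      have h2 : √(∫ x in Ω, (x₀.2.density x - y₀.2.density x) ^ 2) ≤ √(2 * R) :=
        Real.sqrt_le_sqrt ((integral_density_sub_sq_le hx₀ hy₀).trans (by linarith))
      exact mul_le_mul_of_nonneg_left (add_le_add h1 (mul_le_mul_of_nonneg_left h2 hη.le)) hCg.le
  have hmono : ∀ {r : ℝ}, ρ ≤ r → edist x₀ y₀ ≤ ENNReal.ofReal r := fun h =>
    hdist.trans (ENNReal.ofReal_le_ofReal h)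
  have hW := hD x₀ ⟨hx₀, by linarith [hn20 y₀]⟩ y₀ ⟨hy₀, by linarith [hn20 x₀]⟩ (hmono hρ1)
  have hlow : κ ≤ f x₀ - g y₀ := by linarith [hδn x₀, hδn y₀, hP0 (x₀, y₀)]
  have ht₀ : (x₀.1 : ℝ) ∈ Ico 0 T := by
    refine ⟨x₀.1.2.1, lt_of_le_of_ne x₀.1.2.2 fun h => ?_⟩
    linarith [hTm x₀ h y₀ (mem_univ _) (hmono hρ2)]
  have hs₀ : (y₀.1 : ℝ) ∈ Ico 0 T := by
    refine ⟨y₀.1.2.1, lt_of_le_of_ne y₀.1.2.2 fun h => ?_⟩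
    linarith [hTp x₀ (mem_univ _) y₀ h (hmono hρ3)]
  have hvisc := le_of_doubled_max hΩ hH hC hHb hδ0 hVm' hVp' hη hη1 hε hηδ he horth hgal
    ht₀ hs₀ hx₀ hy₀ (l := l) fun t ht m hm s hs n hn => hmax (⟨t, ht⟩, m) hm (⟨s, hs⟩, n) hn
  have hF1 : F x₀.2 - F y₀.2 ≤ L * ρ := by
    have h1 : edist (F x₀.2) (F y₀.2) ≤ ENNReal.ofReal (L * ρ) := by
      refine (hF x₀.2 y₀.2).trans ?_
      rw [ENNReal.ofReal_mul L.coe_nonneg, ENNReal.ofReal_coe_nnreal]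
      gcongr
      exact (le_max_right _ _).trans (Prod.edist_eq x₀ y₀ ▸ hdist)
    rw [edist_dist, ENNReal.ofReal_le_ofReal_iff (by positivity), Real.dist_eq] at h1
    exact (le_abs_self _).trans h1
  have hsmall : δ * (n2 x₀ + n2 y₀) + P (x₀, y₀) ≤ 2 * τ := by linarith
  have hqε : q x₀.2 y₀.2 / ε ≤ 4 * τ := by
    rw [div_le_iff₀ hε]
    have : 2 * ε * P (x₀, y₀) ≤ 2 * ε * (2 * τ) :=
      mul_le_mul_of_nonneg_left (by linarith [hδn x₀, hδn y₀]) (by positivity)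
    linarith [sq_nonneg ((x₀.1 : ℝ) - y₀.1)]
  have e1 : Cm * (δ * n2 x₀) ≤ Cm * (2 * τ) :=
    mul_le_mul_of_nonneg_left (by linarith [hδn y₀, hP0 (x₀, y₀)]) hCm.le
  have e2 : Cp * (δ * n2 y₀) ≤ Cp * (2 * τ) :=
    mul_le_mul_of_nonneg_left (by linarith [hδn x₀, hP0 (x₀, y₀)]) hCp.le
  have e3 : (1 + (K : ℝ) ^ 2) * (q x₀.2 y₀.2 / ε) ≤ (1 + (K : ℝ) ^ 2) * (4 * τ) :=
    mul_le_mul_of_nonneg_left hqε (by positivity)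
  simp only [hq] at e3
  simp only [hn2] at e1 e2
  linarith

theorem le_of_continuousAt (hd : 0 < d) (hΩ : IsSmoothBoundedDomain Ω) {U V : SubProb Ω → ℝ}
    (h : ∀ m : SubProb Ω, m.InL2 → U m ≤ V m) {m : SubProb Ω} (hU : ContinuousAt U m)
    (hV : ContinuousAt V m) : U m ≤ V m := by
  refine ContinuousWithinAt.closure_le (s := {n : SubProb Ω | n.InL2}) ?_
    hU.continuousWithinAt hV.continuousWithinAt h
  refine EMetric.mem_closure_iff.2 fun r hr => ?_
  obtain ⟨c, hc, hcr⟩ := ENNReal.lt_iff_exists_nnreal_btwn.1 hr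
  obtain ⟨n, hn, hnm⟩ := exists_inL2_edist_le hd hΩ m (r := c) (by simpa using hc)
  refine ⟨n, hn, ?_⟩
  rw [edist_comm]
  exact hnm.trans_lt (by rwa [ENNReal.ofReal_coe_nnreal])

end AbsorbedMFC

theorem theorem1p1 (d : ℕ) (hd : 0 < d) (T : ℝ) (hT : 0 < T)
    (Ω : Set (EuclideanSpace ℝ (Fin d))) (hΩ : AbsorbedMFC.IsSmoothBoundedDomain Ω)
    (H : EuclideanSpace ℝ (Fin d) → EuclideanSpace ℝ (Fin d) → ℝ)
    (hH : ∃ K : ℝ≥0, LipschitzOnWith K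
      (fun z : EuclideanSpace ℝ (Fin d) × EuclideanSpace ℝ (Fin d) => H z.1 z.2) (Ω ×ˢ univ))
    (F G : AbsorbedMFC.SubProb Ω → ℝ)
    (hF : AbsorbedMFC.IsC1 F) (hF' : ∃ K : ℝ≥0, LipschitzWith K F)
    (hG : AbsorbedMFC.IsC1 G) (hG' : ∃ K : ℝ≥0, LipschitzWith K G)
    (Vm Vp : ℝ → AbsorbedMFC.SubProb Ω → ℝ)
    (hVm : AbsorbedMFC.IsViscositySubsolution T Ω H F G Vm)
    (hVp : AbsorbedMFC.IsViscositySupersolution T Ω H F G Vp) :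
    (∀ t ∈ Icc 0 T, ∀ m : AbsorbedMFC.SubProb Ω, m.InL2 → Vm t m ≤ Vp t m) ∧
    (∀ t ∈ Icc 0 T, ∀ m : AbsorbedMFC.SubProb Ω,
      ContinuousAt (Vm t) m → ContinuousAt (Vp t) m → Vm t m ≤ Vp t m) := by
  obtain ⟨K, hK⟩ := hH
  obtain ⟨L, hL⟩ := hF'
  have h : ∀ t ∈ Icc 0 T, ∀ m : AbsorbedMFC.SubProb Ω, m.InL2 → Vm t m ≤ Vp t m :=
    fun t ht m hm => AbsorbedMFC.comparison_inL2 hd hT hΩ hK hL hVm hVp ht hm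
  exact ⟨h, fun t ht m hm hp => AbsorbedMFC.le_of_continuousAt hd hΩ (h t ht) hm hp⟩
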